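/- Let $n\in\{2,3\}$ and let $\Omega\subset\mathbb R^n$ be a bounded domain whose boundary is piecewise $C^1$: the set of boundary points near which $\Omega$ is not, in suitable Cartesian coordinates, the set of points on one side of the graph of a $C^1$ function (corners, edges, cusps) has finite $(n-2)$-dimensional Hausdorff measure, i.e. it is finite for $n=2$ and has finite length for $n=3$. Let $a_1,a_2\in C^0(\mathbb R)$ and $c\in L^\infty(\Omega)$ be such that, for some constant $\alpha>0$, $$\alpha\le a_i(u)\le \tfrac1\alpha\quad\text{for all }u\in\mathbb R,\ i=1,2,\qquad 0\le c(x)\le\tfrac1\alpha\quad\text{for a.e. }x\in\Omega .$$ Let $H^{1/2}(\partial\Omega)$ be the space of boundary traces of functions in $H^1(\Omega)$, with the norm $\|g\|_{H^{1/2}(\partial\Omega)}=\inf\{\|u\|_{H^1(\Omega)}: u\in H^1(\Omega),\ u|_{\partial\Omega}=g\}$, and let $H^{-1/2}(\partial\Omega)$ be its topological dual. For $a\in\{a_1,a_2\}$, let $\Lambda_{a,c}:H^{1/2}(\partial\Omega)\to H^{-1/2}(\partial\Omega)$ be the Dirichlet-to-Neumann map $g\mapsto a(u)\partial_n u$, where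 $u\in H^1(\Omega)$ is the weak solution of $$-\operatorname{div}(a(u)\nabla u)+cu=0\ \text{ in }\Omega,\qquad u=g\ \text{ on }\partial\Omega,$$ and the generalized conormal derivative $a(u)\partial_n u\in H^{-1/2}(\partial\Omega)$ is defined by $$\langle a(u)\partial_n u, v|_{\partial\Omega}\rangle=\int_\Omega a(u)\nabla u\cdot\nabla v+c\,u\,v\,dx\qquad\text{for all }v\in H^1(\Omega).$$ If $\Lambda_{a_1,c}=\Lambda_{a_2,c}$, then $a_1(u)=a_2(u)$ for every $u\in\mathbb R$. -/

import Mathlib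

open MeasureTheory Filter Topology Set
open scoped ENNReal

noncomputable section

namespace QuasilinearDtN

/-- `ℝⁿ` with the Euclidean norm. -/
abbrev Rn (n : ℕ) : Type := EuclideanSpace ℝ (Fin n)

/-- Surface measure on the boundary of `Ω ⊆ ℝⁿ`: the `(n-1)`-dimensional Hausdorff measure
restricted to `∂Ω`. -/
def surfaceMeasure {n : ℕ} (Ω : Set (Rn n)) : Measure (Rn n) :=
  (Measure.hausdorffMeasure ((n : ℝ) - 1)).restrict (frontier Ω)

/-- The boundary points near which `Ω` is, for some unit vector `e`, the set of points lying below
the graph, in direction `e`, of a `C¹` function `γ` of the component orthogonal to `e`. -/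
def regularBoundary {n : ℕ} (Ω : Set (Rn n)) : Set (Rn n) :=
  {x | x ∈ frontier Ω ∧ ∃ (r : ℝ) (e : Rn n) (γ : Rn n → ℝ),
    0 < r ∧ ‖e‖ = 1 ∧ ContDiff ℝ 1 γ ∧
    ∀ y ∈ Metric.ball x r, y ∈ Ω ↔ inner ℝ e y < γ (y - inner ℝ e y • e)}

/-- Bounded domains of `ℝⁿ` with piecewise `C¹` boundary.  The boundary points at which the
`C¹` pieces meet (corners, edges, vertices, cusps) form a set of finite `(n-2)`-dimensional
measure: finitely many points for `n = 2`, a set of finite length for `n = 3`. -/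
structure IsPiecewiseC1Domain {n : ℕ} (Ω : Set (Rn n)) : Prop where
  isOpen : IsOpen Ω
  isConnected : IsConnected Ω
  isBounded : Bornology.IsBounded Ω
  boundary : Measure.hausdorffMeasure ((n : ℝ) - 2) (frontier Ω \ regularBoundary Ω) < ∞

/-- Admissible coefficients: `a` continuous with `α ≤ a ≤ 1/α`, and `c ∈ L^∞(Ω)` with
`0 ≤ c ≤ 1/α` almost everywhere in `Ω`, for some `α > 0`. -/
def Admissible {n : ℕ} (Ω : Set (Rn n)) (a : ℝ → ℝ) (c : Rn n → ℝ) : Prop :=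
  Continuous a ∧ AEStronglyMeasurable c (volume.restrict Ω) ∧
    ∃ α : ℝ, 0 < α ∧ (∀ t, α ≤ a t ∧ a t ≤ 1 / α) ∧
      ∀ᵐ x ∂(volume.restrict Ω), 0 ≤ c x ∧ c x ≤ 1 / α

/-- `C_c^∞(Ω)`. -/
def IsTestFunction {n : ℕ} (Ω : Set (Rn n)) (φ : Rn n → ℝ) : Prop :=
  ContDiff ℝ (⊤ : ℕ∞) φ ∧ HasCompactSupport φ ∧ tsupport φ ⊆ Ω

/-- `u ∈ H¹(Ω)` with weak gradient `Du`. -/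
structure IsH1 {n : ℕ} (Ω : Set (Rn n)) (u : Rn n → ℝ) (Du : Rn n → Rn n) : Prop where
  memLp : MemLp u 2 (volume.restrict Ω)
  memLp_grad : MemLp Du 2 (volume.restrict Ω)
  weak_grad : ∀ φ, IsTestFunction Ω φ → ∀ w : Rn n,
    ∫ x in Ω, u x * fderiv ℝ φ x w = - ∫ x in Ω, inner ℝ (Du x) w * φ x

/-- The norm of `H¹(Ω)`. -/
def h1Norm {n : ℕ} (Ω : Set (Rn n)) (u : Rn n → ℝ) (Du : Rn n → Rn n) : ℝ :=
  Real.sqrt (∫ x in Ω, (u x ^ 2 + ‖Du x‖ ^ 2))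

/-- `g` is the boundary trace of `u`: at almost every point `x` of `∂Ω`, with respect to surface
measure, the mean of `|u - g(x)|` over `Ω ∩ B(x,r)` tends to `0` as `r → 0`. -/
def IsTrace {n : ℕ} (Ω : Set (Rn n)) (u : Rn n → ℝ) (g : Rn n → ℝ) : Prop :=
  ∀ᵐ x ∂(surfaceMeasure Ω),
    Tendsto (fun r : ℝ => ⨍ y in Ω ∩ Metric.ball x r, |u y - g x|) (𝓝[>] 0) (𝓝 0)


theorem IsH1.add {n : ℕ} {Ω : Set (Rn n)} {u v : Rn n → ℝ} {Du Dv : Rn n → Rn n}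
    (hu : IsH1 Ω u Du) (hv : IsH1 Ω v Dv) : IsH1 Ω (u + v) (Du + Dv) := by
  refine ⟨hu.memLp.add hv.memLp, hu.memLp_grad.add hv.memLp_grad, fun φ hφ w => ?_⟩
  have hφm : MemLp φ 2 (volume.restrict Ω) :=
    (hφ.1.continuous.memLp_of_hasCompactSupport hφ.2.1)
  have hdc : Continuous (fun x => fderiv ℝ φ x w) :=
    (hφ.1.continuous_fderiv (by simp)).clm_apply continuous_const
  have hdm : MemLp (fun x => fderiv ℝ φ x w) 2 (volume.restrict Ω) :=
    hdc.memLp_of_hasCompactSupport (hφ.2.1.fderiv_apply (𝕜 := ℝ) w)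
  have hiu := hu.memLp.integrable_mul hdm
  have hiv := hv.memLp.integrable_mul hdm
  have hgu := (hu.memLp_grad.inner_const w (𝕜 := ℝ)).integrable_mul hφm
  have hgv := (hv.memLp_grad.inner_const w (𝕜 := ℝ)).integrable_mul hφm
  have e1 := integral_add hiu hiv
  have e2 := integral_add hgu hgv
  simp only [Pi.mul_apply] at e1 e2
  simp only [Pi.add_apply, add_mul, inner_add_left]
  rw [e1, e2, hu.weak_grad φ hφ w, hv.weak_grad φ hφ w]
  ring

theorem IsH1.smul {n : ℕ} {Ω : Set (Rn n)} {u : Rn n → ℝ} {Du : Rn n → Rn n}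
    (t : ℝ) (hu : IsH1 Ω u Du) : IsH1 Ω (t • u) (t • Du) := by
  refine ⟨hu.memLp.const_smul t, hu.memLp_grad.const_smul t, fun φ hφ w => ?_⟩
  simp only [Pi.smul_apply, smul_eq_mul, mul_assoc, inner_smul_left, RCLike.conj_to_real]
  rw [integral_const_mul, integral_const_mul, hu.weak_grad φ hφ w]
  ring

theorem isH1_zero {n : ℕ} (Ω : Set (Rn n)) : IsH1 Ω 0 0 :=
  ⟨MemLp.zero, MemLp.zero, fun φ _ w => by simp⟩

theorem integrable_abs_sub {n : ℕ} {Ω : Set (Rn n)} {u : Rn n → ℝ}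
    (hu : MemLp u 2 (volume.restrict Ω)) (x : Rn n) (r t : ℝ) :
    Integrable (fun y => |u y - t|) (volume.restrict (Ω ∩ Metric.ball x r)) := by
  have : IsFiniteMeasure (volume.restrict (Ω ∩ Metric.ball x r)) :=
    ⟨by
      rw [Measure.restrict_apply_univ]
      exact lt_of_le_of_lt (measure_mono inter_subset_right) Metric.isBounded_ball.measure_lt_top⟩
  have h : MemLp u 2 (volume.restrict (Ω ∩ Metric.ball x r)) :=
    hu.mono_measure (Measure.restrict_mono inter_subset_left le_rfl)
  exact ((h.integrable (by norm_num)).sub (integrable_const t)).abs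

theorem IsTrace.add {n : ℕ} {Ω : Set (Rn n)} {u v g h : Rn n → ℝ}
    (hu : MemLp u 2 (volume.restrict Ω)) (hv : MemLp v 2 (volume.restrict Ω))
    (hg : IsTrace Ω u g) (hh : IsTrace Ω v h) : IsTrace Ω (u + v) (g + h) := by
  filter_upwards [hg, hh] with x hx hx'
  have hs := hx.add hx'
  rw [add_zero] at hs
  refine squeeze_zero (fun r => ?_) (fun r => ?_) hs
  · rw [setAverage_eq, smul_eq_mul]
    exact mul_nonneg (by positivity) (integral_nonneg fun y => abs_nonneg _)
  · simp only [setAverage_eq, smul_eq_mul]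
    rw [← mul_add, ← integral_add (integrable_abs_sub hu x r _) (integrable_abs_sub hv x r _)]
    refine mul_le_mul_of_nonneg_left ?_ (by positivity)
    refine integral_mono (integrable_abs_sub (hu.add hv) x r _)
      ((integrable_abs_sub hu x r _).add (integrable_abs_sub hv x r _)) fun y => ?_
    simp only [Pi.add_apply]
    rw [show u y + v y - (g x + h x) = (u y - g x) + (v y - h x) by ring]
    exact abs_add_le _ _

theorem IsTrace.smul {n : ℕ} {Ω : Set (Rn n)} {u g : Rn n → ℝ} (t : ℝ)
    (hg : IsTrace Ω u g) : IsTrace Ω (t • u) (t • g) := by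
  filter_upwards [hg] with x hx
  have hs := hx.const_mul |t|
  rw [mul_zero] at hs
  refine hs.congr fun r => ?_
  simp only [setAverage_eq, smul_eq_mul, Pi.smul_apply, ← mul_sub, abs_mul, integral_const_mul]
  ring

theorem IsTrace.congr {n : ℕ} {Ω : Set (Rn n)} {u g h : Rn n → ℝ}
    (hg : IsTrace Ω u g) (e : h =ᵐ[surfaceMeasure Ω] g) : IsTrace Ω u h := by
  filter_upwards [hg, e] with x hx hx'
  rw [hx']
  exact hx

/-- `H^{1/2}(∂Ω)`: the space of traces of functions in `H¹(Ω)`, as classes of functions on `∂Ω`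
modulo equality almost everywhere. -/
def HHalf {n : ℕ} (Ω : Set (Rn n)) : Submodule ℝ (Rn n →ₘ[surfaceMeasure Ω] ℝ) where
  carrier := {g | ∃ u Du, IsH1 Ω u Du ∧ IsTrace Ω u g}
  zero_mem' := by
    refine ⟨0, 0, isH1_zero Ω, IsTrace.congr (g := 0) ?_ AEEqFun.coeFn_zero⟩
    refine Eventually.of_forall fun x => ?_
    simp
  add_mem' := by
    rintro g h ⟨u, Du, hu, hg⟩ ⟨v, Dv, hv, hh⟩
    exact ⟨u + v, Du + Dv, hu.add hv,
      (hg.add hu.memLp hv.memLp hh).congr (AEEqFun.coeFn_add g h)⟩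
  smul_mem' := by
    rintro t g ⟨u, Du, hu, hg⟩
    exact ⟨t • u, t • Du, hu.smul t, (hg.smul t).congr (AEEqFun.coeFn_smul t g)⟩

/-- The quotient norm of `H^{1/2}(∂Ω)`. -/
def hHalfNorm {n : ℕ} (Ω : Set (Rn n)) (g : HHalf Ω) : ℝ :=
  sInf {s | ∃ u Du, IsH1 Ω u Du ∧ IsTrace Ω u (g : Rn n →ₘ[surfaceMeasure Ω] ℝ) ∧
    s = h1Norm Ω u Du}

/-- `H^{-1/2}(∂Ω)`: the bounded linear functionals on `H^{1/2}(∂Ω)`. -/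
def HNegHalf {n : ℕ} (Ω : Set (Rn n)) : Type :=
  {ψ : HHalf Ω →ₗ[ℝ] ℝ // ∃ C : ℝ, ∀ g, |ψ g| ≤ C * hHalfNorm Ω g}

/-- `∫_Ω a(u) ∇u · ∇v + c u v dx`. -/
def form {n : ℕ} (Ω : Set (Rn n)) (a : ℝ → ℝ) (c : Rn n → ℝ)
    (u : Rn n → ℝ) (Du : Rn n → Rn n) (v : Rn n → ℝ) (Dv : Rn n → Rn n) : ℝ :=
  ∫ x in Ω, (a (u x) * inner ℝ (Du x) (Dv x) + c x * u x * v x)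

/-- `u ∈ H¹(Ω)`, with weak gradient `Du`, is a weak solution of
`-div(a(u)∇u) + c u = 0` in `Ω`, `u = g` on `∂Ω`. -/
structure IsWeakSolution {n : ℕ} (Ω : Set (Rn n)) (a : ℝ → ℝ) (c : Rn n → ℝ) (g : HHalf Ω)
    (u : Rn n → ℝ) (Du : Rn n → Rn n) : Prop where
  isH1 : IsH1 Ω u Du
  trace : IsTrace Ω u (g : Rn n →ₘ[surfaceMeasure Ω] ℝ)
  equation : ∀ φ, IsTestFunction Ω φ → form Ω a c u Du φ (gradient φ) = 0

/-- `ψ ∈ H^{-1/2}(∂Ω)` is the generalized conormal derivative `a(u)∂ₙu`: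
`⟨ψ, v|_∂Ω⟩ = ∫_Ω a(u) ∇u · ∇v + c u v dx` for all `v ∈ H¹(Ω)`. -/
def IsConormalDerivative {n : ℕ} (Ω : Set (Rn n)) (a : ℝ → ℝ) (c : Rn n → ℝ)
    (u : Rn n → ℝ) (Du : Rn n → Rn n) (ψ : HNegHalf Ω) : Prop :=
  ∀ v Dv, IsH1 Ω v Dv → ∀ h : HHalf Ω, IsTrace Ω v (h : Rn n →ₘ[surfaceMeasure Ω] ℝ) →
    ψ.1 h = form Ω a c u Du v Dv

/-- The Dirichlet-to-Neumann map `Λ_{a,c} : H^{1/2}(∂Ω) → H^{-1/2}(∂Ω)`, `g ↦ a(u)∂ₙu`, given by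
its graph. -/
def dirichletToNeumann {n : ℕ} (Ω : Set (Rn n)) (a : ℝ → ℝ) (c : Rn n → ℝ) :
    Set (HHalf Ω × HNegHalf Ω) :=
  {p | ∃ u Du, IsWeakSolution Ω a c p.1 u Du ∧ IsConormalDerivative Ω a c u Du p.2}

end QuasilinearDtN

end

/-!
The Kirchhoff transform `A(s) = ∫₀ˢ a` satisfies `∇A(u) = a(u)∇u`, so that `w = A(u)` solves
`-Δw + c A⁻¹(w) = 0`, a semilinear equation with a monotone Lipschitz nonlinearity. It has a
solution for every smooth boundary value (`exists_semilinear`, by strong monotonicity and the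
Poincaré inequality), and the solution is bounded by the supremum of its boundary values
(`ae_abs_le_of_form_eq_zero`).

Suppose that `a₁` and `a₂` have the same Dirichlet-to-Neumann map, let `u₁`, `u₂` be solutions with
the same smooth boundary value `G`, and let `v` be harmonic. Subtracting the two conormal
identities with test function `v` gives `∫ ∇(A₁(u₁) - A₂(u₂)) · ∇v = - ∫ c (u₁ - u₂) v`. The
function `A₁(u₁) - A₂(u₂)` has the same trace as `H(G)` with `H = A₁ - A₂`, and `v` is harmonic, so
the left-hand side is `∫ (a₁ - a₂)(G) ∇G · ∇v`: the unknown solutions remain only in the term of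
order zero (`exists_integral_identity`).

If `a₁ - a₂ ≥ η > 0` on `[s₀ - δ, s₀ + δ]`, take `v = e^{k x₀} cos (k x₁)` and
`G = s₀ + (δ / L) arsinh (v / ε)`, where `ε = e^{-kR}`, `L = 2kR + 1` and `Ω ⊆ B(0, R)`. Then `G`
stays within `δ` of `s₀`, and `∇G · ∇v` is at least of order `(k² / L) e^{k x₀}`, that is, of order
`k e^{k x₀}`, whereas the maximum principle bounds `c (u₁ - u₂) v` by a constant times `e^{k x₀}`.
Letting `k → ∞` gives a contradiction (`mul_le_of_dirichletToNeumann_eq`).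

What makes this rigorous on a domain with corners, edges and cusps is that a function of `H¹(Ω)`
has trace zero, in the sense of means over `Ω ∩ B(x, r)` at almost every boundary point, if and only
if it belongs to `H₀¹(Ω)`, defined here by its extension by zero having a weak gradient on `ℝⁿ`.
* `IsH10.isTrace_zero`: near a regular boundary point the boundary is a Lipschitz graph, so a ball
  of radius comparable to `r` can be moved out of `Ω` over a distance comparable to `r`; this bounds
  the mean of `|v|` over `Ω ∩ B(x, r)` by `r^{1-n} ∫ |∇v|` over a comparable ball, and the
  `(n-1)`-dimensional density of `|∇v|` vanishes at almost every boundary point.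
* `IsH1.isH10`: truncation reduces this to a bounded function `v`. By the trace condition, the
  measure `|v| dx` has vanishing `n`-dimensional density at almost every boundary point, and up to a
  null set the boundary has σ-finite `(n-1)`-dimensional measure. It can therefore be covered by
  finitely many balls `B(x, r)` for which the sum of `r⁻¹ ∫ |v|` over `B(x, 2r)` is as small as
  desired (`coverCost`); the exceptional null set costs nothing because `v` is bounded. Products of
  the corresponding cutoff functions turn arbitrary test functions into test functions supported in
  `Ω`, at a cost that tends to zero.
-/

noncomputable section

namespace QuasilinearDtN

open scoped Convolution NNReal

variable {n : ℕ}

/-! ### Mollification and the chain rule for weak derivatives -/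

theorem tendsto_lintegral_translate_sub {f : Rn n → ℝ} (hf : Integrable f) :
    Tendsto (fun t => ∫⁻ x, ‖f (x - t) - f x‖ₑ) (𝓝 0) (𝓝 0) := by
  let Φ : C(Rn n, C(Rn n, Rn n)) := ContinuousMap.curry ⟨fun p => p.2 - p.1, by fun_prop⟩
  have hΦ : ∀ t, MeasurePreserving (Φ t) (volume : Measure (Rn n)) volume := fun t =>
    measurePreserving_sub_right volume t
  have hF : MemLp f 1 (volume : Measure (Rn n)) := memLp_one_iff_integrable.2 hf
  have hc := (continuous_const (y := hF.toLp f)).compMeasurePreservingLp Φ.continuous hΦ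
    ENNReal.one_ne_top
  have h0 := (hc.tendsto 0)
  rw [tendsto_iff_edist_tendsto_0] at h0
  refine h0.congr fun t => ?_
  rw [Lp.edist_def, eLpNorm_one_eq_lintegral_enorm]
  refine lintegral_congr_ae ?_
  have e1 : ∀ s, ⇑(Lp.compMeasurePreserving (Φ s) (hΦ s) (hF.toLp f)) =ᵐ[volume]
      fun x => f (x - s) := fun s =>
    (Lp.coeFn_compMeasurePreserving _ (hΦ s)).trans
      ((hΦ s).quasiMeasurePreserving.ae_eq_comp hF.coeFn_toLp)
  filter_upwards [e1 t, e1 0] with x hx hx0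
  simp only [Pi.sub_apply]
  rw [hx, hx0, sub_zero]

/-- Mollification does not move an integrable function further, in `L¹`, than the worst
translation by a vector of the support of the mollifier. -/
theorem lintegral_mollify_sub_le {f : Rn n → ℝ} (hf : Integrable f)
    (ρ : ContDiffBump (0 : Rn n)) {ε : ℝ≥0∞}
    (h : ∀ t ∈ Metric.ball (0 : Rn n) ρ.rOut, ∫⁻ x, ‖f (x - t) - f x‖ₑ ≤ ε) :
    ∫⁻ x, ‖(ρ.normed volume ⋆[ContinuousLinearMap.lsmul ℝ ℝ, volume] f) x - f x‖ₑ ≤ ε := by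
  set r := ρ.normed (volume : Measure (Rn n)) with hr
  have hrc : Continuous r := ρ.continuous_normed
  have hmeas : AEStronglyMeasurable (fun p : Rn n × Rn n => f (p.1 - p.2))
      (volume.prod volume) :=
    hf.1.comp_quasiMeasurePreserving (quasiMeasurePreserving_sub volume volume)
  have hmeas1 : AEStronglyMeasurable (fun p : Rn n × Rn n => f p.1) (volume.prod volume) :=
    hf.1.comp_quasiMeasurePreserving Measure.quasiMeasurePreserving_fst
  have key : ∀ x, ‖(r ⋆[ContinuousLinearMap.lsmul ℝ ℝ, volume] f) x - f x‖ₑ ≤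
      ∫⁻ t, ‖r t‖ₑ * ‖f (x - t) - f x‖ₑ := by
    intro x
    have i1 : Integrable (fun t => r t * f (x - t)) :=
      (ρ.hasCompactSupport_normed.convolutionExists_left (ContinuousLinearMap.lsmul ℝ ℝ)
        hrc hf.locallyIntegrable x)
    have i2 : Integrable (fun t => r t * f x) := ρ.integrable_normed.mul_const _
    have e : (r ⋆[ContinuousLinearMap.lsmul ℝ ℝ, volume] f) x - f x =
        ∫ t, r t * (f (x - t) - f x) := by
      simp only [mul_sub]
      rw [integral_sub i1 i2, integral_mul_const, ρ.integral_normed, one_mul]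
      rfl
    rw [e]
    refine (enorm_integral_le_lintegral_enorm _).trans (le_of_eq ?_)
    simp only [enorm_mul]
  calc ∫⁻ x, ‖(r ⋆[ContinuousLinearMap.lsmul ℝ ℝ, volume] f) x - f x‖ₑ
      ≤ ∫⁻ x, ∫⁻ t, ‖r t‖ₑ * ‖f (x - t) - f x‖ₑ := lintegral_mono key
    _ = ∫⁻ t, ∫⁻ x, ‖r t‖ₑ * ‖f (x - t) - f x‖ₑ := by
        refine lintegral_lintegral_swap ?_
        refine AEMeasurable.mul ?_ (hmeas.sub hmeas1).enorm
        exact (hrc.comp continuous_snd).enorm.aemeasurable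
    _ ≤ ∫⁻ t, ‖r t‖ₑ * ε := by
        refine lintegral_mono fun t => ?_
        dsimp only
        rw [lintegral_const_mul' _ _ enorm_ne_top]
        by_cases ht : t ∈ Metric.ball (0 : Rn n) ρ.rOut
        · gcongr
          exact h t ht
        · have : r t = 0 := by
            rw [← Function.notMem_support, hr, ρ.support_normed_eq]
            exact ht
          simp [this]
    _ = ε := by
        rw [lintegral_mul_const _ hrc.enorm.measurable]
        have : ∫⁻ t, ‖r t‖ₑ = 1 := by
          rw [← ofReal_integral_norm_eq_lintegral_enorm ρ.integrable_normed]
          have : (fun t => ‖r t‖) = r := by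
            funext t
            exact Real.norm_of_nonneg (ρ.nonneg_normed t)
          rw [this, ρ.integral_normed, ENNReal.ofReal_one]
        rw [this, one_mul]

theorem tendsto_lintegral_mollify_sub {f : Rn n → ℝ} (hf : Integrable f)
    {ρ : ℕ → ContDiffBump (0 : Rn n)} (hρ : Tendsto (fun k => (ρ k).rOut) atTop (𝓝 0)) :
    Tendsto (fun k => ∫⁻ x,
      ‖((ρ k).normed volume ⋆[ContinuousLinearMap.lsmul ℝ ℝ, volume] f) x - f x‖ₑ)
      atTop (𝓝 0) := by
  rw [ENNReal.tendsto_nhds_zero]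
  intro ε hε
  have h := (ENNReal.tendsto_nhds_zero.1 (tendsto_lintegral_translate_sub hf)) ε hε
  obtain ⟨δ, hδ, hb⟩ := Metric.eventually_nhds_iff_ball.1 h
  filter_upwards [hρ.eventually_lt_const hδ] with k hk
  exact lintegral_mollify_sub_le hf _ fun t ht => hb t (Metric.ball_subset_ball hk.le ht)

/-- A locally integrable function whose weak derivative in the direction `w` on `Ω` is `p`:
at points at distance more than the mollification radius from the complement of `Ω`, the
derivative of the mollification is the mollification of `p`. -/
theorem fderiv_mollify_eq {Ω : Set (Rn n)} (hΩ : MeasurableSet Ω) {u p : Rn n → ℝ} {w : Rn n}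
    (hu : IntegrableOn u Ω)
    (hup : ∀ φ, IsTestFunction Ω φ → ∫ x in Ω, u x * fderiv ℝ φ x w = - ∫ x in Ω, p x * φ x)
    (ρ : ContDiffBump (0 : Rn n)) {x : Rn n} (hx : Metric.closedBall x ρ.rOut ⊆ Ω) :
    fderiv ℝ (ρ.normed volume ⋆[ContinuousLinearMap.lsmul ℝ ℝ, volume] (Ω.indicator u)) x w =
      (ρ.normed volume ⋆[ContinuousLinearMap.lsmul ℝ ℝ, volume] (Ω.indicator p)) x := by
  set r := ρ.normed (volume : Measure (Rn n)) with hr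
  have hrc : Continuous r := ρ.continuous_normed
  have hrs : ContDiff ℝ (⊤ : ℕ∞) r := ρ.contDiff_normed
  have hu' : Integrable (Ω.indicator u) := (integrable_indicator_iff hΩ).2 hu
  have hψ : IsTestFunction Ω (fun t => r (x - t)) := by
    refine ⟨hrs.comp (contDiff_const.sub contDiff_id), ?_, ?_⟩
    · exact ρ.hasCompactSupport_normed.comp_homeomorph (Homeomorph.subLeft x)
    · refine Subset.trans ?_ hx
      refine closure_minimal ?_ Metric.isClosed_closedBall
      intro t ht
      have ht' : x - t ∈ Function.support r := ht
      rw [hr, ρ.support_normed_eq, mem_ball_zero_iff] at ht'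
      rw [Metric.mem_closedBall, dist_comm, dist_eq_norm]
      exact ht'.le
  have hd : ∀ t, fderiv ℝ (fun t => r (x - t)) t w = - fderiv ℝ r (x - t) w := by
    intro t
    have h1 : HasFDerivAt r (fderiv ℝ r (x - t)) (x - t) :=
      (hrs.differentiable (by simp)).differentiableAt.hasFDerivAt
    have h2 := h1.comp t ((hasFDerivAt_id t).const_sub x)
    have h3 : fderiv ℝ (fun t => r (x - t)) t = _ := h2.fderiv
    rw [h3]
    simp
  have hD := (ρ.hasCompactSupport_normed.hasFDerivAt_convolution_left
    (ContinuousLinearMap.lsmul ℝ ℝ) (hrs.of_le (by simp)) hu'.locallyIntegrable x).fderiv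
  rw [← hr] at hD
  rw [hD]
  have hex := (ρ.hasCompactSupport_normed.fderiv ℝ).convolutionExists_left
    ((ContinuousLinearMap.lsmul ℝ ℝ : ℝ →L[ℝ] ℝ →L[ℝ] ℝ).precompL (Rn n))
    (hrs.continuous_fderiv (by simp)) hu'.locallyIntegrable x
  rw [convolution_def, ContinuousLinearMap.integral_apply hex, ← integral_sub_left_eq_self _ _ x,
    convolution_lsmul_swap]
  have hl : ∀ t, ((ContinuousLinearMap.lsmul ℝ ℝ : ℝ →L[ℝ] ℝ →L[ℝ] ℝ).precompL (Rn n)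
      (fderiv ℝ r (x - t)) (Ω.indicator u (x - (x - t)))) w =
      - Ω.indicator (fun t => u t * fderiv ℝ (fun t => r (x - t)) t w) t := by
    intro t
    rw [ContinuousLinearMap.precompL_apply, sub_sub_cancel]
    by_cases ht : t ∈ Ω
    · rw [indicator_of_mem ht, indicator_of_mem ht, hd t]
      simp [mul_comm]
    · rw [indicator_of_notMem ht, indicator_of_notMem ht]
      simp
  refine (integral_congr_ae (Eventually.of_forall hl)).trans ?_
  rw [integral_neg, integral_indicator hΩ, hup _ hψ, neg_neg, ← integral_indicator hΩ]
  refine integral_congr_ae (Eventually.of_forall fun t => ?_)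
  by_cases ht : t ∈ Ω
  · simp [ht, mul_comm]
  · simp [ht]

/-- A product of a uniformly bounded, almost everywhere convergent sequence with a sequence
converging in `L¹` converges in `L¹`. -/
theorem tendsto_lintegral_mul_sub {b : ℕ → Rn n → ℝ} {b₀ : Rn n → ℝ} {p : ℕ → Rn n → ℝ}
    {p₀ : Rn n → ℝ} {K : ℝ} (hb : ∀ k, AEStronglyMeasurable (b k) volume)
    (hb₀ : AEStronglyMeasurable b₀ volume)
    (hbK : ∀ k x, |b k x| ≤ K) (hb₀K : ∀ x, |b₀ x| ≤ K)
    (hlim : ∀ᵐ x, Tendsto (fun k => b k x) atTop (𝓝 (b₀ x)))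
    (hp₀ : Integrable p₀) (hp : Tendsto (fun k => ∫⁻ x, ‖p k x - p₀ x‖ₑ) atTop (𝓝 0)) :
    Tendsto (fun k => ∫⁻ x, ‖b k x * p k x - b₀ x * p₀ x‖ₑ) atTop (𝓝 0) := by
  have h1 : Tendsto (fun k => ∫⁻ x, ‖b k x - b₀ x‖ₑ * ‖p₀ x‖ₑ) atTop (𝓝 (∫⁻ _ : Rn n, 0)) := by
    refine tendsto_lintegral_of_dominated_convergence'
      (fun x => ENNReal.ofReal (2 * K) * ‖p₀ x‖ₑ) ?_ ?_ ?_ ?_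
    · intro k
      exact ((hb k).sub hb₀).enorm.mul hp₀.1.enorm
    · intro k
      refine Eventually.of_forall fun x => ?_
      dsimp only
      gcongr
      rw [← ofReal_norm]
      refine ENNReal.ofReal_le_ofReal ?_
      have := abs_sub (b k x) (b₀ x)
      rw [Real.norm_eq_abs]
      linarith [hbK k x, hb₀K x]
    · rw [lintegral_const_mul' _ _ ENNReal.ofReal_ne_top]
      exact ENNReal.mul_ne_top ENNReal.ofReal_ne_top hp₀.2.ne
    · filter_upwards [hlim] with x hx
      have h2 : Tendsto (fun k => ‖b k x - b₀ x‖ₑ) atTop (𝓝 0) := by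
        have := (hx.sub_const (b₀ x)).enorm
        simpa using this
      have := ENNReal.Tendsto.mul_const (b := ‖p₀ x‖ₑ) h2 (Or.inr enorm_ne_top)
      simpa using this
  have h2 : Tendsto (fun k => ENNReal.ofReal K * ∫⁻ x, ‖p k x - p₀ x‖ₑ) atTop (𝓝 0) := by
    have := ENNReal.Tendsto.const_mul (a := ENNReal.ofReal K) hp (Or.inr ENNReal.ofReal_ne_top)
    simpa using this
  have h3 := h2.add h1
  simp only [lintegral_zero, add_zero] at h3
  refine tendsto_of_tendsto_of_tendsto_of_le_of_le tendsto_const_nhds h3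
    (fun _ => zero_le) fun k => ?_
  dsimp only
  rw [← lintegral_const_mul' _ _ ENNReal.ofReal_ne_top, ← lintegral_add_right']
  · refine lintegral_mono fun x => ?_
    have e : b k x * p k x - b₀ x * p₀ x = b k x * (p k x - p₀ x) + (b k x - b₀ x) * p₀ x := by
      ring
    dsimp only
    rw [e]
    refine (enorm_add_le _ _).trans ?_
    rw [enorm_mul, enorm_mul]
    gcongr
    rw [← ofReal_norm]
    exact ENNReal.ofReal_le_ofReal (hbK k x)
  · exact ((hb k).sub hb₀).enorm.mul hp₀.1.enorm

/-- Mollifiers concentrating at the origin. -/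
def mollifier (n k : ℕ) : ContDiffBump (0 : Rn n) where
  rIn := 1 / ((k : ℝ) + 1)
  rOut := 2 / ((k : ℝ) + 1)
  rIn_pos := by positivity
  rIn_lt_rOut := by gcongr; norm_num

theorem tendsto_mollifier_rOut : Tendsto (fun k => (mollifier n k).rOut) atTop (𝓝 0) := by
  have h := (tendsto_one_div_add_atTop_nhds_zero_nat (𝕜 := ℝ)).const_mul 2
  rw [mul_zero] at h
  refine h.congr fun k => ?_
  simp [mollifier, div_eq_mul_inv]

theorem abs_sub_le_of_hasDerivAt {G τ : ℝ → ℝ} (hG : ∀ s, HasDerivAt G (τ s) s) {K : ℝ}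
    (hK : ∀ s, |τ s| ≤ K) (s t : ℝ) : |G s - G t| ≤ K * |s - t| := by
  have := Convex.norm_image_sub_le_of_norm_hasDerivWithin_le (f := G) (f' := τ) (s := univ)
    (C := K) (x := t) (y := s) (fun x _ => (hG x).hasDerivWithinAt) (fun x _ => hK x)
    convex_univ (mem_univ _) (mem_univ _)
  simpa using this

/-- The chain rule for weak derivatives. -/
theorem weak_chain_rule {Ω : Set (Rn n)} (hΩ : IsOpen Ω) {u p : Rn n → ℝ} {w : Rn n}
    (hu : IntegrableOn u Ω) (hp : IntegrableOn p Ω)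
    (hup : ∀ φ, IsTestFunction Ω φ → ∫ x in Ω, u x * fderiv ℝ φ x w = - ∫ x in Ω, p x * φ x)
    {G τ : ℝ → ℝ} (hG : ∀ s, HasDerivAt G (τ s) s) (hτ : Continuous τ) {K : ℝ}
    (hK : ∀ s, |τ s| ≤ K) {φ : Rn n → ℝ} (hφ : IsTestFunction Ω φ) :
    ∫ x in Ω, G (u x) * fderiv ℝ φ x w = - ∫ x in Ω, τ (u x) * p x * φ x := by
  obtain ⟨hφs, hφc, hφΩ⟩ := hφ
  set f := Ω.indicator u with hf
  set q := Ω.indicator p with hq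
  have hfi : Integrable f := (integrable_indicator_iff hΩ.measurableSet).2 hu
  have hqi : Integrable q := (integrable_indicator_iff hΩ.measurableSet).2 hp
  set F : ℕ → Rn n → ℝ := fun k =>
    (mollifier n k).normed volume ⋆[ContinuousLinearMap.lsmul ℝ ℝ, volume] f with hF
  set Q : ℕ → Rn n → ℝ := fun k =>
    (mollifier n k).normed volume ⋆[ContinuousLinearMap.lsmul ℝ ℝ, volume] q with hQ
  have hFs : ∀ k, ContDiff ℝ 1 (F k) := fun k =>
    (mollifier n k).hasCompactSupport_normed.contDiff_convolution_left _
      (mollifier n k).contDiff_normed hfi.locallyIntegrable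
  have hQc : ∀ k, Continuous (Q k) := fun k =>
    ((mollifier n k).hasCompactSupport_normed.contDiff_convolution_left (n := 0) _
      (mollifier n k).contDiff_normed hqi.locallyIntegrable).continuous
  have hG1 : ContDiff ℝ 1 G := by
    rw [contDiff_one_iff_deriv]
    refine ⟨fun s => (hG s).differentiableAt, ?_⟩
    rw [show deriv G = τ from funext fun s => (hG s).deriv]
    exact hτ
  have hdφ : Continuous fun x => fderiv ℝ φ x w :=
    (hφs.continuous_fderiv (by simp)).clm_apply continuous_const
  have hdφc : HasCompactSupport fun x => fderiv ℝ φ x w := hφc.fderiv_apply (𝕜 := ℝ) w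
  have hdφ0 : ∀ x ∉ Ω, fderiv ℝ φ x w = 0 := by
    intro x hx
    have : x ∉ tsupport φ := fun h => hx (hφΩ h)
    rw [fderiv_of_notMem_tsupport ℝ this]
    rfl
  have hφ0 : ∀ x ∉ Ω, φ x = 0 := fun x hx => image_eq_zero_of_notMem_tsupport fun h => hx (hφΩ h)
  obtain ⟨δ, hδ, hδΩ⟩ := hφc.isCompact.exists_cthickening_subset_open hΩ hφΩ
  -- the identity for the mollified functions
  have hid : ∀ᶠ k in atTop, ∫ x, G (F k x) * fderiv ℝ φ x w = - ∫ x, φ x * τ (F k x) * Q k x := by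
    filter_upwards [(tendsto_mollifier_rOut (n := n)).eventually_lt_const hδ] with k hk
    have hGF : ContDiff ℝ 1 (fun x => G (F k x)) := hG1.comp (hFs k)
    have hc1 : Continuous fun x => fderiv ℝ (fun x => G (F k x)) x w :=
      (hGF.continuous_fderiv (by simp)).clm_apply continuous_const
    rw [integral_mul_fderiv_eq_neg_fderiv_mul_of_integrable]
    · congr 1
      refine integral_congr_ae (Eventually.of_forall fun x => ?_)
      by_cases hx : x ∈ tsupport φ
      · have hb : Metric.closedBall x (mollifier n k).rOut ⊆ Ω :=
          ((Metric.closedBall_subset_closedBall hk.le).trans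
            (Metric.closedBall_subset_cthickening hx δ)).trans hδΩ
        have h1 := fderiv_mollify_eq hΩ.measurableSet hu hup (mollifier n k) hb
        have h2 : HasFDerivAt (F k) (fderiv ℝ (F k) x) x :=
          ((hFs k).differentiable (by simp)).differentiableAt.hasFDerivAt
        have h3 : fderiv ℝ (fun x => G (F k x)) x = τ (F k x) • fderiv ℝ (F k) x :=
          ((hG (F k x)).comp_hasFDerivAt x h2).fderiv
        dsimp only
        rw [h3, smul_apply, h1, smul_eq_mul]
        ring
      · simp [image_eq_zero_of_notMem_tsupport hx]
    · exact (hc1.mul hφs.continuous).integrable_of_hasCompactSupport hφc.mul_left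
    · exact (hGF.continuous.mul hdφ).integrable_of_hasCompactSupport hdφc.mul_left
    · exact (hGF.continuous.mul hφs.continuous).integrable_of_hasCompactSupport hφc.mul_left
    · exact fun x _ => (hGF.differentiable (by simp)).differentiableAt
    · exact fun x _ => (hφs.differentiable (by simp)).differentiableAt
  obtain ⟨B, hB⟩ := hdφc.exists_bound_of_continuous hdφ
  obtain ⟨B', hB'⟩ := hφc.exists_bound_of_continuous hφs.continuous
  have hK0 : 0 ≤ K := (abs_nonneg _).trans (hK 0)
  have hGL := abs_sub_le_of_hasDerivAt hG hK
  have hGc : Continuous G := hG1.continuous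
  have hGfi : Integrable fun x => G (f x) * fderiv ℝ φ x w := by
    have h1 : Integrable fun x => |G 0| * fderiv ℝ φ x w :=
      (hdφ.integrable_of_hasCompactSupport hdφc).const_mul _
    have h2 : Integrable fun x => K * B * f x := hfi.const_mul _
    refine (h1.norm.add h2.norm).mono'
      ((hGc.comp_aestronglyMeasurable hfi.1).mul hdφ.aestronglyMeasurable) ?_
    refine Eventually.of_forall fun x => ?_
    have hBx := hB x
    have e := hGL (f x) 0
    rw [sub_zero] at e
    have e2 : |G (f x)| ≤ |G 0| + K * |f x| := by
      have := abs_sub_abs_le_abs_sub (G (f x)) (G 0)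
      linarith
    simp only [Pi.add_apply, norm_mul, Real.norm_eq_abs, abs_abs] at hBx ⊢
    have hB0 : 0 ≤ B := (abs_nonneg _).trans hBx
    rw [abs_of_nonneg hK0, abs_of_nonneg hB0]
    have : K * |f x| * |fderiv ℝ φ x w| ≤ K * |f x| * B :=
      mul_le_mul_of_nonneg_left hBx (by positivity)
    have := mul_le_mul_of_nonneg_right e2 (abs_nonneg (fderiv ℝ φ x w))
    nlinarith
  -- passage to the limit on the left
  have hL : Tendsto (fun k => ∫ x, G (F k x) * fderiv ℝ φ x w) atTop
      (𝓝 (∫ x, G (f x) * fderiv ℝ φ x w)) := by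
    refine tendsto_integral_of_L1 _ hGfi.1 ?_ ?_
    · exact Eventually.of_forall fun k =>
        ((hGc.comp (hFs k).continuous).mul hdφ).integrable_of_hasCompactSupport hdφc.mul_left
    · have h0 := ENNReal.Tendsto.const_mul (a := ENNReal.ofReal (K * B))
        (tendsto_lintegral_mollify_sub hfi (tendsto_mollifier_rOut (n := n)))
        (Or.inr ENNReal.ofReal_ne_top)
      rw [mul_zero] at h0
      refine tendsto_of_tendsto_of_tendsto_of_le_of_le tendsto_const_nhds h0
        (fun _ => zero_le) fun k => ?_
      dsimp only
      rw [← lintegral_const_mul' _ _ ENNReal.ofReal_ne_top]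
      refine lintegral_mono fun x => ?_
      have hBx := hB x
      have hB0 : 0 ≤ B := (norm_nonneg _).trans hBx
      rw [← sub_mul, ← ofReal_norm, ← ofReal_norm,
        ← ENNReal.ofReal_mul (by positivity)]
      refine ENNReal.ofReal_le_ofReal ?_
      rw [norm_mul]
      have := hGL (F k x) (f x)
      rw [← Real.norm_eq_abs, ← Real.norm_eq_abs] at this
      calc _ ≤ K * ‖F k x - f x‖ * B := by gcongr
        _ = _ := by ring
  -- passage to the limit on the right
  have hR : Tendsto (fun k => ∫ x, φ x * τ (F k x) * Q k x) atTop
      (𝓝 (∫ x, φ x * τ (f x) * q x)) := by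
    have hbd : ∀ g : Rn n → ℝ, ∀ x, |φ x * τ (g x)| ≤ B' * K := by
      intro g x
      rw [abs_mul]
      have := hB' x
      rw [Real.norm_eq_abs] at this
      exact mul_le_mul this (hK _) (abs_nonneg _) ((abs_nonneg _).trans this)
    have hbm : AEStronglyMeasurable (fun x => φ x * τ (f x)) volume :=
      hφs.continuous.aestronglyMeasurable.mul (hτ.comp_aestronglyMeasurable hfi.1)
    refine tendsto_integral_of_L1 _ ?_ ?_ ?_
    · exact hbm.mul hqi.1
    · exact Eventually.of_forall fun k =>
        ((hφs.continuous.mul (hτ.comp (hFs k).continuous)).mul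
          (hQc k)).integrable_of_hasCompactSupport hφc.mul_right.mul_right
    · refine tendsto_lintegral_mul_sub (b := fun k x => φ x * τ (F k x))
        (b₀ := fun x => φ x * τ (f x)) (K := B' * K) ?_ hbm (fun k => hbd (F k)) (hbd f) ?_ hqi
        (tendsto_lintegral_mollify_sub hqi (tendsto_mollifier_rOut (n := n)))
      · exact fun k =>
          (hφs.continuous.mul (hτ.comp (hFs k).continuous)).aestronglyMeasurable
      · have := ContDiffBump.ae_convolution_tendsto_right_of_locallyIntegrable
          (μ := (volume : Measure (Rn n))) (φ := mollifier n) (K := 2)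
          (tendsto_mollifier_rOut (n := n))
          (Eventually.of_forall fun k => by simp [mollifier, div_eq_mul_inv])
          hfi.locallyIntegrable
        filter_upwards [this] with x hx
        exact ((hτ.tendsto _).comp hx).const_mul _
  have hfin := tendsto_nhds_unique hL ((hR.neg).congr' (hid.mono fun k hk => hk.symm))
  have e1 : ∫ x in Ω, G (u x) * fderiv ℝ φ x w = ∫ x, G (f x) * fderiv ℝ φ x w := by
    refine Eq.trans (setIntegral_congr_fun hΩ.measurableSet fun x hx => ?_)
      (setIntegral_eq_integral_of_forall_compl_eq_zero fun x hx => ?_)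
    · simp [hf, hx]
    · rw [hdφ0 x hx, mul_zero]
  have e2 : ∫ x in Ω, τ (u x) * p x * φ x = ∫ x, φ x * τ (f x) * q x := by
    refine Eq.trans (setIntegral_congr_fun hΩ.measurableSet fun x hx => ?_)
      (setIntegral_eq_integral_of_forall_compl_eq_zero fun x hx => ?_)
    · simp only [hf, hq, indicator_of_mem hx]
      ring
    · rw [hφ0 x hx, zero_mul, zero_mul]
  rw [e1, e2, hfin]

/-! ### Regular boundary points: local Lipschitz graphs -/

/-- The component of `y` orthogonal to the unit vector `e`. -/
def tangential (e y : Rn n) : Rn n := y - inner ℝ e y • e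

theorem continuous_tangential (e : Rn n) : Continuous (tangential e) := by
  unfold tangential
  fun_prop

theorem tangential_sub (e y z : Rn n) :
    tangential e y - tangential e z = tangential e (y - z) := by
  simp only [tangential, inner_sub_right, sub_smul]
  abel

theorem norm_tangential_le {e : Rn n} (he : ‖e‖ = 1) (y : Rn n) : ‖tangential e y‖ ≤ ‖y‖ := by
  have h : ‖tangential e y‖ ^ 2 = ‖y‖ ^ 2 - inner ℝ e y ^ 2 := by
    rw [tangential, norm_sub_sq_real, inner_smul_right, norm_smul, he, real_inner_comm,
      Real.norm_eq_abs, mul_one, sq_abs]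
    ring
  refine le_of_sq_le_sq ?_ (norm_nonneg _)
  nlinarith [sq_nonneg (inner ℝ e y)]

theorem dist_tangential_le {e : Rn n} (he : ‖e‖ = 1) (y z : Rn n) :
    dist (tangential e y) (tangential e z) ≤ dist y z := by
  rw [dist_eq_norm, dist_eq_norm, tangential_sub]
  exact norm_tangential_le he _

/-- In the ball `B(x,r)` the set `Ω` lies below the graph, in the direction `e`, of a
function `γ` with Lipschitz constant `K`. -/
structure IsLocalGraph (Ω : Set (Rn n)) (x : Rn n) (r : ℝ) (e : Rn n) (γ : Rn n → ℝ)
    (K : ℝ≥0) : Prop where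
  pos : 0 < r
  norm_eq : ‖e‖ = 1
  lipschitz : LipschitzOnWith K γ (Metric.ball (tangential e x) r)
  mem_iff : ∀ y ∈ Metric.ball x r, y ∈ Ω ↔ inner ℝ e y < γ (tangential e y)

theorem exists_isLocalGraph {Ω : Set (Rn n)} {x : Rn n} (hx : x ∈ regularBoundary Ω) :
    ∃ r e γ K, IsLocalGraph Ω x r e γ K := by
  obtain ⟨-, r, e, γ, hr, he, hγ, h⟩ := hx
  obtain ⟨K, t, ht, hK⟩ := (hγ.contDiffAt (x := tangential e x)).exists_lipschitzOnWith
  obtain ⟨δ, hδ, hδt⟩ := Metric.mem_nhds_iff.1 ht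
  refine ⟨min r δ, e, γ, K, lt_min hr hδ, he,
    hK.mono ((Metric.ball_subset_ball (min_le_right _ _)).trans hδt), fun y hy => ?_⟩
  exact h y (Metric.ball_subset_ball (min_le_left _ _) hy)

namespace IsLocalGraph

variable {Ω : Set (Rn n)} {x e : Rn n} {r : ℝ} {γ : Rn n → ℝ} {K : ℝ≥0}

theorem tangential_mem (h : IsLocalGraph Ω x r e γ K) {y : Rn n} (hy : y ∈ Metric.ball x r) :
    tangential e y ∈ Metric.ball (tangential e x) r :=
  (dist_tangential_le h.norm_eq y x).trans_lt hy

theorem inner_eq (h : IsLocalGraph Ω x r e γ K) (hΩ : IsOpen Ω) {y : Rn n}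
    (hy : y ∈ Metric.ball x r) (hyf : y ∈ frontier Ω) : inner ℝ e y = γ (tangential e y) := by
  rw [hΩ.frontier_eq] at hyf
  refine le_antisymm ?_ (not_lt.1 fun hlt => hyf.2 ((h.mem_iff y hy).2 hlt))
  by_contra! hlt
  have hc : ContinuousAt (fun z => γ (tangential e z)) y :=
    ContinuousAt.comp (f := tangential e) (h.lipschitz.continuousOn.continuousAt
      (Metric.isOpen_ball.mem_nhds (h.tangential_mem hy))) (continuous_tangential e).continuousAt
  have hi : ContinuousAt (fun z : Rn n => (inner ℝ e z : ℝ)) y := by fun_prop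
  have hev := hc.eventually_lt hi hlt
  obtain ⟨z, hzΩ, hz1, hz2⟩ := ((mem_closure_iff_frequently.1 hyf.1).and_eventually
    (hev.and (Metric.isOpen_ball.mem_nhds hy))).exists
  exact absurd ((h.mem_iff z hz2).1 hzΩ) (not_lt.2 hz1.le)

theorem abs_sub_le (h : IsLocalGraph Ω x r e γ K) {y z : Rn n}
    (hy : y ∈ Metric.ball x r) (hz : z ∈ Metric.ball x r) :
    |γ (tangential e y) - γ (tangential e z)| ≤ K * dist y z := by
  refine (h.lipschitz.dist_le_mul _ (h.tangential_mem hy) _ (h.tangential_mem hz)).trans ?_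
  gcongr
  exact dist_tangential_le h.norm_eq y z

/-- `Ω` contains a ball of comparable size below each boundary point. -/
theorem ball_subset (h : IsLocalGraph Ω x r e γ K) (hΩ : IsOpen Ω) {y : Rn n}
    (hy : y ∈ Metric.ball x (r / 2)) (hyf : y ∈ frontier Ω) {s : ℝ} (hs : s ≤ r / 4) :
    Metric.ball (y - s • e) (s / (K + 1)) ⊆ Ω := by
  intro z hz
  have hs0 : 0 < s := by
    have := dist_nonneg.trans_lt hz
    by_contra! hs
    exact absurd this (not_lt.2 (div_nonpos_of_nonpos_of_nonneg hs (by positivity)))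
  have hK : (0 : ℝ) ≤ K := K.2
  have hr := h.pos
  have hys : dist (y - s • e) y = s := by
    rw [dist_eq_norm, sub_sub_cancel_left, norm_neg, norm_smul, h.norm_eq, mul_one,
      Real.norm_of_nonneg hs0.le]
  have hyr : y ∈ Metric.ball x r := Metric.ball_subset_ball (by linarith) hy
  rw [Metric.mem_ball] at hz hy
  have hle : s / (K + 1) ≤ s := div_le_self hs0.le (by linarith)
  have hzy : dist z y ≤ 2 * s := by
    have := dist_triangle z (y - s • e) y
    linarith
  have hzr : z ∈ Metric.ball x r := by
    have := dist_triangle z y x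
    rw [Metric.mem_ball]
    linarith
  have hwr : y - s • e ∈ Metric.ball x r := by
    have := dist_triangle (y - s • e) y x
    rw [Metric.mem_ball]
    linarith
  rw [h.mem_iff z hzr]
  have h1 := h.abs_sub_le hzr hwr
  have e2 : tangential e (y - s • e) = tangential e y := by
    simp only [tangential, inner_sub_right, inner_smul_right, real_inner_self_eq_norm_sq,
      h.norm_eq]
    module
  rw [e2, ← h.inner_eq hΩ hyr hyf] at h1
  have h3 : inner ℝ e z - inner ℝ e (y - s • e) ≤ dist z (y - s • e) := by
    rw [← inner_sub_right, dist_eq_norm]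
    refine (real_inner_le_norm _ _).trans ?_
    rw [h.norm_eq, one_mul]
  have h4 : (inner ℝ e (y - s • e) : ℝ) = inner ℝ e y - s := by
    simp [inner_sub_right, inner_smul_right, h.norm_eq]
  have h5 : (K + 1) * dist z (y - s • e) < s := by
    rw [lt_div_iff₀ (by positivity)] at hz
    linarith
  have h6 := (abs_le.1 h1).1
  nlinarith

/-- `Ω` does not meet a ball of comparable size above each boundary point. -/
theorem disjoint_ball (h : IsLocalGraph Ω x r e γ K) (hΩ : IsOpen Ω) {y : Rn n}
    (hy : y ∈ Metric.ball x (r / 2)) (hyf : y ∈ frontier Ω) {s : ℝ} (hs : 0 < s)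
    (hsr : (K + 2) * s ≤ r / 2) {z : Rn n}
    (hz : z ∈ Metric.closedBall (y + ((K + 1) * s) • e) s) : z ∉ Ω := by
  have hK : (0 : ℝ) ≤ K := K.2
  have hr := h.pos
  have hys : dist (y + ((K + 1) * s) • e) y = (K + 1) * s := by
    rw [dist_eq_norm, add_sub_cancel_left, norm_smul, h.norm_eq, mul_one,
      Real.norm_of_nonneg (by positivity)]
  have hyr : y ∈ Metric.ball x r := Metric.ball_subset_ball (by linarith) hy
  rw [Metric.mem_closedBall] at hz
  rw [Metric.mem_ball] at hy
  have hzr : z ∈ Metric.ball x r := by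
    have h1 := dist_triangle z y x
    have h2 := dist_triangle z (y + ((K + 1) * s) • e) y
    rw [Metric.mem_ball]
    nlinarith
  have hwr : y + ((K + 1) * s) • e ∈ Metric.ball x r := by
    have := dist_triangle (y + ((K + 1) * s) • e) y x
    rw [Metric.mem_ball]
    nlinarith
  rw [h.mem_iff z hzr, not_lt]
  have h1 := h.abs_sub_le hzr hwr
  have e2 : tangential e (y + ((K + 1) * s) • e) = tangential e y := by
    simp only [tangential, inner_add_right, inner_smul_right, real_inner_self_eq_norm_sq,
      h.norm_eq]
    module
  rw [e2, ← h.inner_eq hΩ hyr hyf] at h1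
  have h3 : inner ℝ e (y + ((K + 1) * s) • e) - inner ℝ e z ≤
      dist z (y + ((K + 1) * s) • e) := by
    rw [← inner_sub_right, dist_comm, dist_eq_norm]
    refine (real_inner_le_norm _ _).trans ?_
    rw [h.norm_eq, one_mul]
  have h4 : (inner ℝ e (y + ((K + 1) * s) • e) : ℝ) = inner ℝ e y + (K + 1) * s := by
    simp [inner_add_right, inner_smul_right, h.norm_eq]
  have h6 := (abs_le.1 h1).2
  nlinarith

/-- The part of the boundary near a regular point is a Lipschitz graph, so its
`(n-1)`-dimensional measure is at most that of a ball of the tangent space. -/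
theorem hausdorffMeasure_le (h : IsLocalGraph Ω x r e γ K) (hΩ : IsOpen Ω) :
    ∃ C : ℝ≥0, ∀ (y : Rn n) (s : ℝ), 0 ≤ s →
      Measure.hausdorffMeasure ((n : ℝ) - 1)
        (frontier Ω ∩ Metric.ball x r ∩ Metric.closedBall y s) ≤
        C * ENNReal.ofReal (s ^ (n - 1)) := by
  set W : Submodule ℝ (Rn n) := (ℝ ∙ e)ᗮ with hW
  have he0 : e ≠ 0 := by
    intro h0
    have := h.norm_eq
    simp [h0] at this
  have hn : 0 < n := by
    rcases Nat.eq_zero_or_pos n with rfl | hn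
    · exact absurd (Subsingleton.elim e 0) he0
    · exact hn
  have hfr : Module.finrank ℝ W = n - 1 := by
    have h1 := Submodule.finrank_add_finrank_orthogonal (ℝ ∙ e)
    rw [finrank_span_singleton he0, finrank_euclideanSpace_fin, ← hW] at h1
    omega
  have hcast : ((n : ℝ) - 1) = ((n - 1 : ℕ) : ℝ) := by
    rw [Nat.cast_sub hn, Nat.cast_one]
  have hmem : ∀ y, tangential e y ∈ W := by
    intro y
    rw [hW, Submodule.mem_orthogonal_singleton_iff_inner_right]
    simp [tangential, inner_sub_right, inner_smul_right, h.norm_eq]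
  set μ : Measure W := Measure.hausdorffMeasure ((Module.finrank ℝ W : ℕ) : ℝ) with hμ
  have hfin : μ (Metric.ball 0 1) ≠ ∞ := Metric.isBounded_ball.measure_lt_top.ne
  refine ⟨(K + 1) ^ (n - 1) * (μ (Metric.ball 0 1)).toNNReal, fun y s hs => ?_⟩
  set S : Set W := {p : W | (p : Rn n) ∈ Metric.ball (tangential e x) r} ∩
    Metric.closedBall (⟨tangential e y, hmem y⟩ : W) s with hS
  have hlip : LipschitzOnWith (K + 1) (fun p : W => (p : Rn n) + γ p • e) S := by
    refine LipschitzOnWith.of_dist_le_mul fun p hp q hq => ?_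
    have h1 := h.lipschitz.dist_le_mul _ hp.1 _ hq.1
    rw [dist_eq_norm]
    have e1 : (p : Rn n) + γ p • e - ((q : Rn n) + γ q • e) =
        ((p : Rn n) - q) + (γ p - γ q) • e := by module
    rw [e1]
    refine (norm_add_le _ _).trans ?_
    rw [norm_smul, h.norm_eq, mul_one, ← dist_eq_norm, ← dist_eq_norm]
    have : dist (p : Rn n) (q : Rn n) = dist p q := rfl
    rw [this] at h1 ⊢
    push_cast
    linarith
  have hsub : frontier Ω ∩ Metric.ball x r ∩ Metric.closedBall y s ⊆
      (fun p : W => (p : Rn n) + γ p • e) '' S := by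
    rintro z ⟨⟨hz, hzr⟩, hzs⟩
    refine ⟨⟨tangential e z, hmem z⟩, ⟨h.tangential_mem hzr, ?_⟩, ?_⟩
    · exact (dist_tangential_le h.norm_eq z y).trans hzs
    · simp only
      rw [← h.inner_eq hΩ hzr hz]
      simp [tangential]
  calc Measure.hausdorffMeasure ((n : ℝ) - 1)
        (frontier Ω ∩ Metric.ball x r ∩ Metric.closedBall y s)
      ≤ Measure.hausdorffMeasure ((n : ℝ) - 1) ((fun p : W => (p : Rn n) + γ p • e) '' S) :=
        measure_mono hsub
    _ ≤ ((K + 1 : ℝ≥0) : ℝ≥0∞) ^ ((n : ℝ) - 1) * Measure.hausdorffMeasure ((n : ℝ) - 1) S :=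
        hlip.hausdorffMeasure_image_le (by rw [hcast]; positivity)
    _ ≤ ((K + 1 : ℝ≥0) : ℝ≥0∞) ^ (n - 1) *
        (ENNReal.ofReal (s ^ (n - 1)) * μ (Metric.ball 0 1)) := by
        rw [hcast, ENNReal.rpow_natCast]
        gcongr
        rw [← hfr, ← hμ]
        exact (measure_mono inter_subset_right).trans_eq (Measure.addHaar_closedBall _ _ hs)
    _ = _ := by
        push_cast
        rw [ENNReal.coe_toNNReal hfin]
        ring

end IsLocalGraph

/-! ### The space `H₀¹(Ω)` -/

variable {Ω : Set (Rn n)}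

/-- `v ∈ H₀¹(Ω)` with weak gradient `Dv`, in the sense that the extensions of `v` and `Dv` by zero
satisfy the definition of the weak gradient on the whole of `ℝⁿ`. -/
structure IsH10 (Ω : Set (Rn n)) (v : Rn n → ℝ) (Dv : Rn n → Rn n) : Prop where
  isH1 : IsH1 Ω v Dv
  weak_grad : ∀ φ : Rn n → ℝ, ContDiff ℝ (⊤ : ℕ∞) φ → HasCompactSupport φ → ∀ w : Rn n,
    ∫ x in Ω, v x * fderiv ℝ φ x w = - ∫ x in Ω, inner ℝ (Dv x) w * φ x

theorem isFiniteMeasure_restrict (hb : Bornology.IsBounded Ω) :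
    IsFiniteMeasure (volume.restrict Ω) :=
  ⟨by rw [Measure.restrict_apply_univ]; exact hb.measure_lt_top⟩

theorem IsH1.integrableOn {u : Rn n → ℝ} {Du : Rn n → Rn n} (hb : Bornology.IsBounded Ω)
    (hu : IsH1 Ω u Du) : IntegrableOn u Ω := by
  have := isFiniteMeasure_restrict hb
  exact hu.memLp.integrable (by norm_num)

theorem IsH1.integrableOn_grad {u : Rn n → ℝ} {Du : Rn n → Rn n} (hb : Bornology.IsBounded Ω)
    (hu : IsH1 Ω u Du) : IntegrableOn Du Ω := by
  have := isFiniteMeasure_restrict hb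
  exact hu.memLp_grad.integrable (by norm_num)

theorem memLp_comp_lipschitz (hb : Bornology.IsBounded Ω) {u : Rn n → ℝ}
    (hu : MemLp u 2 (volume.restrict Ω)) {G : ℝ → ℝ} {K : ℝ}
    (hG : ∀ s t, |G s - G t| ≤ K * |s - t|) : MemLp (fun x => G (u x)) 2 (volume.restrict Ω) := by
  have := isFiniteMeasure_restrict hb
  have hL : LipschitzWith (Real.toNNReal K) G := by
    refine LipschitzWith.of_dist_le_mul fun s t => ?_
    rw [Real.dist_eq, Real.dist_eq]
    refine (hG s t).trans ?_
    gcongr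
    exact Real.le_coe_toNNReal K
  have h0 : MemLp (fun _ : Rn n => |G 0|) 2 (volume.restrict Ω) := memLp_const _
  have h1 := h0.add (hu.norm.const_mul K)
  refine h1.mono' (hL.continuous.comp_aestronglyMeasurable hu.1) (Eventually.of_forall fun x => ?_)
  have h2 := hG (u x) 0
  rw [sub_zero] at h2
  have := abs_sub_abs_le_abs_sub (G (u x)) (G 0)
  simp only [Pi.add_apply, Real.norm_eq_abs]
  linarith

theorem memLp_comp_smul {u : Rn n → ℝ} {Du : Rn n → Rn n} (hu : IsH1 Ω u Du)
    {τ : ℝ → ℝ} (hτ : Continuous τ) {K : ℝ} (hK : ∀ s, |τ s| ≤ K) :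
    MemLp (fun x => τ (u x) • Du x) 2 (volume.restrict Ω) := by
  refine (hu.memLp_grad.const_smul K).mono
    ((hτ.comp_aestronglyMeasurable hu.memLp.1).smul hu.memLp_grad.1)
    (Eventually.of_forall fun x => ?_)
  rw [Pi.smul_apply, norm_smul, norm_smul]
  gcongr
  exact (hK _).trans (le_abs_self K)

theorem IsH1.comp (hΩ : IsOpen Ω) (hb : Bornology.IsBounded Ω) {u : Rn n → ℝ} {Du : Rn n → Rn n}
    (hu : IsH1 Ω u Du) {G τ : ℝ → ℝ} (hG : ∀ s, HasDerivAt G (τ s) s) (hτ : Continuous τ)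
    {K : ℝ} (hK : ∀ s, |τ s| ≤ K) :
    IsH1 Ω (fun x => G (u x)) (fun x => τ (u x) • Du x) := by
  refine ⟨memLp_comp_lipschitz hb hu.memLp (abs_sub_le_of_hasDerivAt hG hK),
    memLp_comp_smul hu hτ hK, fun φ hφ w => ?_⟩
  have := weak_chain_rule hΩ (w := w) (hu.integrableOn hb)
    (((hu.integrableOn_grad hb).inner_const w (𝕜 := ℝ)))
    (fun φ hφ => hu.weak_grad φ hφ w) hG hτ hK hφ
  simp only [inner_smul_left, RCLike.conj_to_real]
  exact this

theorem IsH10.comp (hΩ : IsOpen Ω) (hb : Bornology.IsBounded Ω) {v : Rn n → ℝ}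
    {Dv : Rn n → Rn n} (hv : IsH10 Ω v Dv) {G τ : ℝ → ℝ} (hG : ∀ s, HasDerivAt G (τ s) s)
    (hG0 : G 0 = 0) (hτ : Continuous τ) {K : ℝ} (hK : ∀ s, |τ s| ≤ K) :
    IsH10 Ω (fun x => G (v x)) (fun x => τ (v x) • Dv x) := by
  refine ⟨hv.isH1.comp hΩ hb hG hτ hK, fun φ hφ hφc w => ?_⟩
  have hv1 : IntegrableOn (Ω.indicator v) univ := by
    rw [integrableOn_univ, integrable_indicator_iff hΩ.measurableSet]
    exact hv.isH1.integrableOn hb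
  have hv2 : IntegrableOn (Ω.indicator fun x => (inner ℝ (Dv x) w : ℝ)) univ := by
    rw [integrableOn_univ, integrable_indicator_iff hΩ.measurableSet]
    exact (hv.isH1.integrableOn_grad hb).inner_const w (𝕜 := ℝ)
  have hind : ∀ g h : Rn n → ℝ, ∫ x in univ, Ω.indicator g x * h x = ∫ x in Ω, g x * h x := by
    intro g h
    rw [setIntegral_univ, ← integral_indicator hΩ.measurableSet]
    simp only [indicator_mul_left]
  have := weak_chain_rule isOpen_univ (w := w) hv1 hv2 (fun ψ hψ => by
    rw [hind, hind]
    exact hv.weak_grad ψ hψ.1 hψ.2.1 w) hG hτ hK ⟨hφ, hφc, subset_univ _⟩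
  have e1 : ∀ x, G (Ω.indicator v x) = Ω.indicator (fun x => G (v x)) x := by
    intro x
    by_cases hx : x ∈ Ω <;> simp [hx, hG0]
  have e2 : ∀ x, τ (Ω.indicator v x) * Ω.indicator (fun x => (inner ℝ (Dv x) w : ℝ)) x =
      Ω.indicator (fun x => (inner ℝ (τ (v x) • Dv x) w : ℝ)) x := by
    intro x
    by_cases hx : x ∈ Ω <;> simp [hx, inner_smul_left]
  simp only [e1, e2, hind] at this
  exact this

/-- On a bounded set, test functions in the definition of `H₀¹` need not have compact support. -/
theorem IsH10.integral_fderiv (hΩ : IsOpen Ω) (hb : Bornology.IsBounded Ω) {v : Rn n → ℝ}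
    {Dv : Rn n → Rn n} (hv : IsH10 Ω v Dv) {φ : Rn n → ℝ} (hφ : ContDiff ℝ (⊤ : ℕ∞) φ)
    (w : Rn n) :
    ∫ x in Ω, v x * fderiv ℝ φ x w = - ∫ x in Ω, inner ℝ (Dv x) w * φ x := by
  obtain ⟨R, hR0, hR⟩ := hb.subset_ball_lt 0 0
  let χ : ContDiffBump (0 : Rn n) := ⟨R, R + 1, hR0, by linarith⟩
  have h := hv.weak_grad (fun x => χ x * φ x) (χ.contDiff.mul hφ) χ.hasCompactSupport.mul_right w
  have h1 : ∀ x ∈ Ω, (fun x => χ x * φ x) =ᶠ[𝓝 x] φ := by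
    intro x hx
    filter_upwards [hΩ.mem_nhds hx] with y hy
    rw [χ.one_of_mem_closedBall (Metric.ball_subset_closedBall (hR hy)), one_mul]
  have e1 : ∫ x in Ω, v x * fderiv ℝ (fun x => χ x * φ x) x w =
      ∫ x in Ω, v x * fderiv ℝ φ x w :=
    setIntegral_congr_fun hΩ.measurableSet fun x hx => by
      rw [(h1 x hx).fderiv_eq]
  have e2 : ∫ x in Ω, (inner ℝ (Dv x) w : ℝ) * (χ x * φ x) =
      ∫ x in Ω, (inner ℝ (Dv x) w : ℝ) * φ x :=
    setIntegral_congr_fun hΩ.measurableSet fun x hx => by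
      have := (h1 x hx).eq_of_nhds
      rw [this]
  rw [← e1, ← e2, h]

theorem abs_div_sqrt_le_one (s δ : ℝ) : |s / Real.sqrt (s ^ 2 + δ ^ 2)| ≤ 1 := by
  rw [abs_div, abs_of_nonneg (Real.sqrt_nonneg _)]
  refine div_le_one_of_le₀ ?_ (Real.sqrt_nonneg _)
  exact Real.abs_le_sqrt (by nlinarith [sq_nonneg δ])

theorem hasDerivAt_sqrt_sq_add {δ : ℝ} (hδ : 0 < δ) (s : ℝ) :
    HasDerivAt (fun s => Real.sqrt (s ^ 2 + δ ^ 2) - δ) (s / Real.sqrt (s ^ 2 + δ ^ 2)) s := by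
  have h : HasDerivAt (fun s : ℝ => s ^ 2 + δ ^ 2) (2 * s) s := by
    simpa using (hasDerivAt_pow 2 s).add_const (δ ^ 2)
  have h2 := (h.sqrt (by positivity)).sub_const δ
  refine h2.congr_deriv ?_
  rw [mul_div_mul_left _ _ two_ne_zero]

/-- Sliding a bump function out of `Ω` in the direction `e` controls the mean of an `H₀¹`
function by its gradient. -/
theorem IsH10.setIntegral_abs_le_of_translate (hΩ : IsOpen Ω) (hb : Bornology.IsBounded Ω)
    {v : Rn n → ℝ} {Dv : Rn n → Rn n} (hv : IsH10 Ω v Dv) {y e : Rn n} (he : ‖e‖ = 1) {s T : ℝ}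
    (hs : 0 < s) (hT : 0 < T) (hdis : ∀ z ∈ Metric.closedBall (y + T • e) (2 * s), z ∉ Ω) :
    ∫ x in Ω ∩ Metric.ball y s, |v x| ≤
      T * ∫ x in Ω ∩ Metric.closedBall y (T + 2 * s), ‖Dv x‖ := by
  set M := ∫ x in Ω ∩ Metric.closedBall y (T + 2 * s), ‖Dv x‖ with hM
  have hvi := hv.isH1.integrableOn hb
  have hDvi := hv.isH1.integrableOn_grad hb
  let β : ContDiffBump y := ⟨s, 2 * s, hs, by linarith⟩
  have hβs : ContDiff ℝ (⊤ : ℕ∞) β := β.contDiff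
  have main : ∀ δ > 0, ∫ x in Ω ∩ Metric.ball y s, |v x| ≤
      T * M + δ * volume.real (Metric.ball y s) := by
    intro δ hδ
    set f : Rn n → ℝ := fun x => Real.sqrt (v x ^ 2 + δ ^ 2) - δ with hf
    set τ : ℝ → ℝ := fun s => s / Real.sqrt (s ^ 2 + δ ^ 2) with hτd
    have hτ : Continuous τ := by
      refine continuous_id.div (by fun_prop) fun t => ?_
      positivity
    have hfH : IsH10 Ω f (fun x => τ (v x) • Dv x) :=
      hv.comp hΩ hb (hasDerivAt_sqrt_sq_add hδ) (by simp [Real.sqrt_sq hδ.le]) hτ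
        (fun t => abs_div_sqrt_le_one t δ)
    have hfi : IntegrableOn f Ω := hfH.isH1.integrableOn hb
    have hf0 : ∀ x, 0 ≤ f x := by
      intro x
      rw [hf, sub_nonneg]
      exact Real.le_sqrt_of_sq_le (by nlinarith [sq_nonneg (v x)])
    have hfv : ∀ x, |v x| ≤ f x + δ := by
      intro x
      rw [hf, sub_add_cancel]
      exact Real.abs_le_sqrt (by nlinarith [sq_nonneg δ])
    have hdc : Continuous fun x => fderiv ℝ β x e :=
      (hβs.continuous_fderiv (by simp)).clm_apply continuous_const
    obtain ⟨B, hB⟩ := (β.hasCompactSupport.fderiv_apply (𝕜 := ℝ) e).exists_bound_of_continuous hdc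
    have hsh : ∀ (t : ℝ) (x : Rn n), HasFDerivAt (fun x => β (x - t • e))
        (fderiv ℝ β (x - t • e)) x := by
      intro t x
      have h1 : HasFDerivAt β (fderiv ℝ β (x - t • e)) (x - t • e) :=
        (hβs.differentiable (by simp)).differentiableAt.hasFDerivAt
      exact h1.comp x ((hasFDerivAt_id x).sub_const (t • e))
    -- the function whose increment over `[0, T]` is estimated
    set F : ℝ → ℝ := fun t => ∫ x in Ω, f x * β (x - t • e) with hF
    set F' : ℝ → ℝ := fun t => ∫ x in Ω, f x * (- fderiv ℝ β (x - t • e) e) with hF'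
    have hint : ∀ t : ℝ, IntegrableOn (fun x => f x * β (x - t • e)) Ω := fun t =>
      hfi.mul_bdd (c := 1) (β.continuous.comp (by fun_prop)).aestronglyMeasurable
        (Eventually.of_forall fun x => by
          rw [Real.norm_of_nonneg β.nonneg]; exact β.le_one)
    have hder : ∀ t, HasDerivAt F (F' t) t := by
      intro t
      refine (hasDerivAt_integral_of_dominated_loc_of_deriv_le
        (F := fun t x => f x * β (x - t • e))
        (F' := fun t x => f x * (- fderiv ℝ β (x - t • e) e))
        (bound := fun x => ‖f x‖ * B) (s := univ) univ_mem ?_ (hint t) ?_ ?_ ?_ ?_).2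
      · exact Eventually.of_forall fun t => (hint t).1
      · exact hfi.1.mul (hdc.comp (by fun_prop)).neg.aestronglyMeasurable
      · refine Eventually.of_forall fun x t _ => ?_
        rw [norm_mul, norm_neg]
        gcongr
        exact hB _
      · exact hfi.norm.mul_const B
      · refine Eventually.of_forall fun x t _ => ?_
        have h1 : HasFDerivAt β (fderiv ℝ β (x - t • e)) (x - t • e) :=
          (hβs.differentiable (by simp)).differentiableAt.hasFDerivAt
        have h2 : HasDerivAt (fun t : ℝ => x - t • e) (-e) t := by
          simpa using ((hasDerivAt_id t).smul_const e).const_sub x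
        have h3 := (h1.comp_hasDerivAt t h2).const_mul (f x)
        simpa using h3
    have hF'eq : ∀ t, F' t = ∫ x in Ω, inner ℝ (τ (v x) • Dv x) e * β (x - t • e) := by
      intro t
      have hc : HasCompactSupport fun x => β (x - t • e) :=
        β.hasCompactSupport.comp_homeomorph (Homeomorph.subRight (t • e))
      have h := hfH.weak_grad (fun x => β (x - t • e))
        (hβs.comp (contDiff_id.sub contDiff_const)) hc e
      simp only [hF', mul_neg, integral_neg]
      simp only [(hsh t _).fderiv] at h
      rw [h, neg_neg]
    have hbound : ∀ t ∈ Icc 0 T, ‖F' t‖ ≤ M := by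
      intro t ht
      rw [hF'eq, hM, inter_comm, ← Measure.restrict_restrict measurableSet_closedBall,
        ← integral_indicator measurableSet_closedBall]
      refine norm_integral_le_of_norm_le (hDvi.norm.indicator measurableSet_closedBall)
        (Eventually.of_forall fun x => ?_)
      by_cases hx : x ∈ Metric.closedBall y (T + 2 * s)
      · rw [indicator_of_mem hx, norm_mul, Real.norm_of_nonneg β.nonneg]
        refine (mul_le_of_le_one_right (norm_nonneg _) β.le_one).trans ?_
        refine (norm_inner_le_norm _ _).trans ?_
        rw [he, mul_one, norm_smul]
        exact mul_le_of_le_one_left (norm_nonneg _) (abs_div_sqrt_le_one _ _)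
      · have h0 : β (x - t • e) = 0 := by
          refine β.zero_of_le_dist ?_
          rw [Metric.mem_closedBall, not_le] at hx
          have h1 := dist_triangle x (x - t • e) y
          have h2 : dist x (x - t • e) = t := by
            rw [dist_eq_norm, sub_sub_cancel, norm_smul, he, mul_one, Real.norm_of_nonneg ht.1]
          have := ht.2
          change 2 * s ≤ _
          linarith
        rw [indicator_of_notMem hx, h0, mul_zero, norm_zero]
    have hFT : F T = 0 := by
      rw [hF]
      refine setIntegral_eq_zero_of_forall_eq_zero fun x hx => ?_
      have h0 : β (x - T • e) = 0 := by
        refine β.zero_of_le_dist ?_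
        by_contra! hlt
        refine hdis x ?_ hx
        have e1 : dist (x - T • e) y = dist x (y + T • e) := by
          rw [dist_eq_norm, dist_eq_norm, sub_sub, add_comm]
        rw [Metric.mem_closedBall, ← e1]
        exact hlt.le
      rw [h0, mul_zero]
    have hF0 : F 0 ≤ T * M := by
      have h := Convex.norm_image_sub_le_of_norm_hasDerivWithin_le (f := F) (f' := F')
        (s := Icc 0 T) (C := M) (x := T) (y := 0) (fun t _ => (hder t).hasDerivWithinAt) hbound
        (convex_Icc 0 T) (right_mem_Icc.2 hT.le) (left_mem_Icc.2 hT.le)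
      rw [hFT, sub_zero, zero_sub, norm_neg, Real.norm_of_nonneg hT.le, mul_comm] at h
      exact (le_abs_self _).trans h
    have hsub : ∫ x in Ω ∩ Metric.ball y s, f x ≤ F 0 := by
      have e1 : ∫ x in Ω ∩ Metric.ball y s, f x =
          ∫ x in Ω ∩ Metric.ball y s, f x * β (x - (0 : ℝ) • e) := by
        refine setIntegral_congr_fun (hΩ.measurableSet.inter measurableSet_ball) fun x hx => ?_
        rw [zero_smul, sub_zero, β.one_of_mem_closedBall (Metric.ball_subset_closedBall hx.2),
          mul_one]
      rw [e1]
      exact setIntegral_mono_set (hint 0)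
        (Eventually.of_forall fun x => mul_nonneg (hf0 x) β.nonneg)
        (inter_subset_left.eventuallyLE)
    have hfin : volume (Ω ∩ Metric.ball y s) ≠ ∞ :=
      (hb.subset inter_subset_left).measure_lt_top.ne
    calc ∫ x in Ω ∩ Metric.ball y s, |v x|
        ≤ ∫ x in Ω ∩ Metric.ball y s, (f x + δ) := by
          refine integral_mono (hvi.mono_set inter_subset_left).abs
            ((hfi.mono_set inter_subset_left).add (integrableOn_const hfin)) hfv
      _ = (∫ x in Ω ∩ Metric.ball y s, f x) + δ * volume.real (Ω ∩ Metric.ball y s) := by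
          rw [integral_add (hfi.mono_set inter_subset_left) (integrableOn_const hfin),
            setIntegral_const, smul_eq_mul, mul_comm]
      _ ≤ T * M + δ * volume.real (Metric.ball y s) := by
          gcongr
          · exact hsub.trans hF0
          · exact measure_ball_lt_top.ne
          · exact inter_subset_right
  have hlim : Tendsto (fun δ : ℝ => T * M + δ * volume.real (Metric.ball y s)) (𝓝[>] 0)
      (𝓝 (T * M + 0 * volume.real (Metric.ball y s))) :=
    tendsto_nhdsWithin_of_tendsto_nhds (by
      exact (continuous_const.add (continuous_id.mul continuous_const)).tendsto 0)
  rw [zero_mul, add_zero] at hlim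
  exact ge_of_tendsto hlim (by
    filter_upwards [self_mem_nhdsWithin] with δ hδ using main δ hδ)

/-! ### Functions in `H₀¹(Ω)` have trace zero -/

/-- The singular part of the boundary is negligible for surface measure. -/
theorem IsPiecewiseC1Domain.hausdorffMeasure_singular (hΩ : IsPiecewiseC1Domain Ω) :
    Measure.hausdorffMeasure ((n : ℝ) - 1) (frontier Ω \ regularBoundary Ω) = 0 :=
  (Measure.hausdorffMeasure_zero_or_top (by linarith : (n : ℝ) - 2 < (n : ℝ) - 1) _).resolve_right
    hΩ.boundary.ne

/-- A property of boundary points that holds almost everywhere near each regular boundary point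
holds almost everywhere on the boundary. -/
theorem IsPiecewiseC1Domain.ae_surfaceMeasure (hΩ : IsPiecewiseC1Domain Ω) {p : Rn n → Prop}
    (h : ∀ x r e γ K, IsLocalGraph Ω x r e γ K →
      ∀ᵐ y ∂((Measure.hausdorffMeasure ((n : ℝ) - 1)).restrict (frontier Ω ∩ Metric.ball x (r / 2))),
        p y) :
    ∀ᵐ y ∂(surfaceMeasure Ω), p y := by
  rw [surfaceMeasure, ae_restrict_iff' isClosed_frontier.measurableSet, ae_iff]
  have hsub : {y | ¬ (y ∈ frontier Ω → p y)} ⊆ (frontier Ω \ regularBoundary Ω) ∪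
      {y | y ∈ regularBoundary Ω ∧ ¬ p y} := by
    intro y hy
    simp only [mem_ofPred_eq, not_forall] at hy
    obtain ⟨h1, h2⟩ := hy
    by_cases hr : y ∈ regularBoundary Ω
    · exact Or.inr ⟨hr, h2⟩
    · exact Or.inl ⟨h1, hr⟩
  refine measure_mono_null hsub (measure_union_null hΩ.hausdorffMeasure_singular ?_)
  refine measure_null_of_locally_null _ fun x hx => ?_
  obtain ⟨r, e, γ, K, hg⟩ := exists_isLocalGraph hx.1
  have hr2 : 0 < r / 2 := by linarith [hg.pos]
  refine ⟨_, inter_mem_nhdsWithin _ (Metric.ball_mem_nhds x hr2), ?_⟩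
  have h1 := h x r e γ K hg
  rw [ae_restrict_iff' (isClosed_frontier.measurableSet.inter measurableSet_ball), ae_iff] at h1
  refine measure_mono_null ?_ h1
  rintro y ⟨⟨hy1, hy2⟩, hy3⟩
  simp only [mem_ofPred_eq, not_forall]
  exact ⟨⟨hy1.1, hy3⟩, hy2⟩

theorem IsLocalGraph.pos_dim {x e : Rn n} {r : ℝ} {γ : Rn n → ℝ} {K : ℝ≥0}
    (h : IsLocalGraph Ω x r e γ K) : 0 < n := by
  rcases Nat.eq_zero_or_pos n with rfl | hn
  · have h1 := h.norm_eq
    rw [Subsingleton.elim e 0, norm_zero] at h1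
    norm_num at h1
  · exact hn

/-- An integrable function on `Ω` has vanishing `(n-1)`-dimensional density at almost every
boundary point. -/
theorem IsLocalGraph.ae_tendsto_density {x e : Rn n} {r : ℝ} {γ : Rn n → ℝ} {K : ℝ≥0}
    (h : IsLocalGraph Ω x r e γ K) (hΩ : IsOpen Ω) {g : Rn n → ℝ} (hg : IntegrableOn g Ω)
    (hg0 : ∀ z, 0 ≤ g z) :
    ∀ᵐ y ∂((Measure.hausdorffMeasure ((n : ℝ) - 1)).restrict (frontier Ω ∩ Metric.ball x (r / 2))),
      ∀ ε > 0, ∀ᶠ s in 𝓝[>] (0 : ℝ),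
        ∫ z in Ω ∩ Metric.closedBall y s, g z ≤ ε * s ^ (n - 1) := by
  obtain ⟨C, hC⟩ := h.hausdorffMeasure_le hΩ
  have hr := h.pos
  set σ := (Measure.hausdorffMeasure ((n : ℝ) - 1) : Measure (Rn n)).restrict
    (frontier Ω ∩ Metric.ball x (r / 2)) with hσ
  have hσC : ∀ (y : Rn n) (s : ℝ), 0 ≤ s →
      σ (Metric.closedBall y s) ≤ C * ENNReal.ofReal (s ^ (n - 1)) := by
    intro y s hs
    rw [hσ, Measure.restrict_apply measurableSet_closedBall, inter_comm]
    refine (measure_mono ?_).trans (hC y s hs)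
    gcongr
    linarith
  have hσfin : IsFiniteMeasure σ := by
    refine ⟨?_⟩
    rw [hσ, Measure.restrict_apply_univ]
    refine lt_of_le_of_lt (measure_mono ?_) ((hC x r hr.le).trans_lt
      (ENNReal.mul_lt_top ENNReal.coe_lt_top ENNReal.ofReal_lt_top))
    intro z hz
    have : z ∈ Metric.ball x r := Metric.ball_subset_ball (by linarith) hz.2
    exact ⟨⟨hz.1, this⟩, Metric.ball_subset_closedBall this⟩
  set μ := (volume.restrict Ω).withDensity (fun z => ENNReal.ofReal (g z)) with hμ
  have hμfin : IsFiniteMeasure μ := by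
    refine isFiniteMeasure_withDensity ?_
    rw [← ofReal_integral_eq_lintegral_ofReal hg (Eventually.of_forall hg0)]
    exact ENNReal.ofReal_ne_top
  have hsing : μ ⟂ₘ σ := by
    refine ⟨Ωᶜ, hΩ.measurableSet.compl, ?_, ?_⟩
    · rw [hμ, withDensity_apply _ hΩ.measurableSet.compl,
        Measure.restrict_restrict hΩ.measurableSet.compl, compl_inter_self]
      simp
    · rw [compl_compl, hσ, Measure.restrict_apply hΩ.measurableSet]
      have : Ω ∩ (frontier Ω ∩ Metric.ball x (r / 2)) = ∅ := by
        rw [← inter_assoc, hΩ.inter_frontier_eq, empty_inter]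
      rw [this, measure_empty]
  filter_upwards [Besicovitch.ae_tendsto_rnDeriv μ σ, hsing.rnDeriv_ae_eq_zero] with y hy hy0 ε hε
  rw [hy0, Pi.zero_apply] at hy
  have hε' : (0 : ℝ) < ε / (C + 1) := by positivity
  have hev := hy.eventually_lt_const (ENNReal.ofReal_pos.2 hε')
  filter_upwards [hev, self_mem_nhdsWithin] with s hs hs0
  have hs0' : (0 : ℝ) < s := hs0
  have h1 : μ (Metric.closedBall y s) ≤
      ENNReal.ofReal (ε / (C + 1)) * σ (Metric.closedBall y s) :=
    (ENNReal.div_le_iff_le_mul (Or.inr ENNReal.ofReal_ne_top)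
      (Or.inl (measure_ne_top _ _))).1 hs.le
  have h2 : μ (Metric.closedBall y s) =
      ENNReal.ofReal (∫ z in Ω ∩ Metric.closedBall y s, g z) := by
    rw [hμ, withDensity_apply _ measurableSet_closedBall,
      Measure.restrict_restrict measurableSet_closedBall, inter_comm,
      ofReal_integral_eq_lintegral_ofReal (hg.mono_set inter_subset_left)
        (Eventually.of_forall hg0)]
  have h3 := h1.trans (mul_le_mul_right (hσC y s hs0'.le) _)
  have h4 : ENNReal.ofReal (ε / (C + 1)) * (C * ENNReal.ofReal (s ^ (n - 1))) =
      ENNReal.ofReal (ε / (C + 1) * (C * s ^ (n - 1))) := by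
    rw [ENNReal.ofReal_mul hε'.le, ENNReal.ofReal_mul (NNReal.coe_nonneg C)]
    simp
  rw [h2, h4, ENNReal.ofReal_le_ofReal_iff (by positivity)] at h3
  refine h3.trans ?_
  have hC0 : (0 : ℝ) ≤ C := C.2
  rw [← mul_assoc]
  gcongr
  rw [div_mul_eq_mul_div, div_le_iff₀ (by positivity)]
  nlinarith

/-- Functions of `H₀¹(Ω)` have trace zero. -/
theorem IsH10.isTrace_zero (hΩ : IsPiecewiseC1Domain Ω) {v : Rn n → ℝ} {Dv : Rn n → Rn n}
    (hv : IsH10 Ω v Dv) : IsTrace Ω v 0 := by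
  refine hΩ.ae_surfaceMeasure fun x r e γ K h => ?_
  have ho := hΩ.isOpen
  have hb := hΩ.isBounded
  have hr := h.pos
  have hn := h.pos_dim
  have hK : (0 : ℝ) ≤ K := K.2
  have hmem : ∀ᵐ y ∂((Measure.hausdorffMeasure ((n : ℝ) - 1)).restrict
      (frontier Ω ∩ Metric.ball x (r / 2))), y ∈ frontier Ω ∩ Metric.ball x (r / 2) :=
    ae_restrict_mem (isClosed_frontier.measurableSet.inter measurableSet_ball)
  filter_upwards [h.ae_tendsto_density ho (hv.isH1.integrableOn_grad hb).norm
    (fun _ => norm_nonneg _), hmem] with y hy ⟨hyf, hyx⟩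
  simp only [Pi.zero_apply, sub_zero]
  -- a lower bound for the measure of `Ω ∩ B(y,s)`
  set ω : ℝ := volume.real (Metric.ball (0 : Rn n) 1) with hω
  have hω0 : 0 < ω := by
    rw [hω, measureReal_def]
    exact ENNReal.toReal_pos (Metric.measure_ball_pos _ _ one_pos).ne' measure_ball_lt_top.ne
  set κ : ℝ := 1 / (2 * (K + 1)) with hκ
  have hκ0 : 0 < κ := by positivity
  have hvol : ∀ s, 0 < s → s ≤ r / 2 → (κ * s) ^ n * ω ≤ volume.real (Ω ∩ Metric.ball y s) := by
    intro s hs hsr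
    have hsub : Metric.ball (y - (s / 2) • e) (s / 2 / (K + 1)) ⊆ Ω ∩ Metric.ball y s := by
      refine subset_inter (h.ball_subset ho hyx hyf (by linarith)) ?_
      refine Metric.ball_subset_ball' ?_
      rw [dist_eq_norm, sub_sub_cancel_left, norm_neg, norm_smul, h.norm_eq, mul_one,
        Real.norm_of_nonneg (by positivity)]
      have : s / 2 / (K + 1) ≤ s / 2 := div_le_self (by positivity) (by linarith)
      linarith
    have e1 : s / 2 / (K + 1) = κ * s := by
      rw [hκ]
      field_simp
    have e2 : volume.real (Metric.ball (y - (s / 2) • e) (s / 2 / (K + 1))) = (κ * s) ^ n * ω := by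
      rw [measureReal_def, Measure.addHaar_ball_of_pos _ _ (by positivity), ENNReal.toReal_mul,
        ENNReal.toReal_ofReal (by positivity), finrank_euclideanSpace_fin, e1]
      rfl
    rw [← e2]
    exact measureReal_mono hsub (hb.subset inter_subset_left).measure_lt_top.ne
  set T : ℝ := 2 * (K + 1) with hT
  set A : ℝ := T + 2 with hA
  have hA0 : 0 < A := by positivity
  rw [Metric.tendsto_nhds]
  intro ε hε
  set ε' : ℝ := ε / 2 * (κ ^ n * ω) / (T * A ^ (n - 1)) with hε'
  have hε'0 : 0 < ε' := by positivity
  have hscale : Tendsto (fun s : ℝ => A * s) (𝓝[>] 0) (𝓝[>] 0) := by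
    refine tendsto_nhdsWithin_iff.2 ⟨?_, ?_⟩
    · have : Tendsto (fun s : ℝ => A * s) (𝓝 0) (𝓝 (A * 0)) :=
        (continuous_const.mul continuous_id).tendsto 0
      rw [mul_zero] at this
      exact tendsto_nhdsWithin_of_tendsto_nhds this
    · filter_upwards [self_mem_nhdsWithin] with s hs
      exact mul_pos hA0 hs
  have hsmall : ∀ᶠ s in 𝓝[>] (0 : ℝ), s < r / (4 * A) :=
    (eventually_lt_nhds (by positivity)).filter_mono nhdsWithin_le_nhds
  filter_upwards [hscale.eventually (hy ε' hε'0), self_mem_nhdsWithin, hsmall] with s hs hs0 hsr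
  have hs0' : (0 : ℝ) < s := hs0
  rw [lt_div_iff₀ (by positivity)] at hsr
  have hAs : A * s < r / 4 := by linarith
  have hA1 : 1 ≤ A := by rw [hA, hT]; linarith
  have hest := hv.setIntegral_abs_le_of_translate ho hb h.norm_eq hs0' (T := T * s)
    (y := y) (by positivity) (by
      intro z hz
      refine h.disjoint_ball ho hyx hyf (s := 2 * s) (by positivity) ?_ ?_
      · rw [hA, hT] at hAs
        nlinarith
      · have : (K + 1 : ℝ) * (2 * s) = T * s := by rw [hT]; ring
        rw [this]
        exact hz)
  have e3 : T * s + 2 * s = A * s := by rw [hA]; ring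
  rw [e3] at hest
  have hI : ∫ z in Ω ∩ Metric.ball y s, |v z| ≤ ε / 2 * ((κ * s) ^ n * ω) := by
    calc ∫ z in Ω ∩ Metric.ball y s, |v z|
        ≤ T * s * (ε' * (A * s) ^ (n - 1)) := hest.trans (by gcongr)
      _ = ε / 2 * ((κ * s) ^ n * ω) := by
        obtain ⟨m, rfl⟩ : ∃ m, n = m + 1 := ⟨n - 1, by omega⟩
        rw [hε', Nat.add_sub_cancel]
        have hT0 : T ≠ 0 := by positivity
        field_simp
        ring_nf
  have hsr2 : s ≤ r / 2 := by nlinarith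
  have hv1 := hvol s hs0' hsr2
  have hv0 : 0 < volume.real (Ω ∩ Metric.ball y s) := lt_of_lt_of_le (by positivity) hv1
  have hI0 : 0 ≤ ∫ z in Ω ∩ Metric.ball y s, |v z| := integral_nonneg fun z => abs_nonneg _
  rw [dist_zero_right, setAverage_eq, smul_eq_mul, Real.norm_of_nonneg (by positivity),
    inv_mul_lt_iff₀ hv0]
  nlinarith

/-! ### Covering the boundary by balls of small cost -/

/-- The cost of covering `s` by a single ball of radius less than `δ` centred in `F`; a ball
`B(x,r)` costs `μ(B(x,2r)) / r`, which is the order of `∫ |∇η| dμ` for a cutoff function `η`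
of that ball. -/
def ballCost (μ : Measure (Rn n)) (F : Set (Rn n)) (δ : ℝ) (s : Set (Rn n)) : ℝ≥0∞ :=
  ⨅ (x ∈ F) (r ∈ Ioo (0 : ℝ) δ) (_ : s ⊆ Metric.ball x r),
    μ (Metric.ball x (2 * r)) / ENNReal.ofReal r

/-- The least cost of covering a set by countably many balls. It plays the part of a capacity
relative to the measure `μ`. -/
def coverCost (μ : Measure (Rn n)) (F : Set (Rn n)) (δ : ℝ) : OuterMeasure (Rn n) :=
  OuterMeasure.boundedBy (ballCost μ F δ)

theorem coverCost_le {μ : Measure (Rn n)} {F : Set (Rn n)} {δ : ℝ} {x : Rn n} (hx : x ∈ F)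
    {r : ℝ} (hr : r ∈ Ioo (0 : ℝ) δ) {s : Set (Rn n)} (hs : s ⊆ Metric.ball x r) :
    coverCost μ F δ s ≤ μ (Metric.ball x (2 * r)) / ENNReal.ofReal r :=
  (OuterMeasure.boundedBy_le s).trans
    ((iInf₂_le x hx).trans ((iInf₂_le r hr).trans (iInf_le _ hs)))

theorem coverCost_le_hausdorffMeasure {μ : Measure (Rn n)} {F : Set (Rn n)} {δ : ℝ} (hδ : 0 < δ)
    (hn : 2 ≤ n) {E : Set (Rn n)} (hE : E ⊆ F) {c : ℝ≥0∞} (hc0 : c ≠ 0) (hc : c ≠ ∞) {r₀ : ℝ}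
    (hr₀ : 0 < r₀) (h : ∀ x ∈ E, ∀ r ∈ Ioo (0 : ℝ) r₀,
      μ (Metric.ball x (2 * r)) ≤ c * ENNReal.ofReal (r ^ n)) :
    coverCost μ F δ E ≤ c * Measure.hausdorffMeasure ((n : ℝ) - 1) E := by
  have key : (OuterMeasure.restrict E) (coverCost μ F δ) ≤
      OuterMeasure.mkMetric (c • fun d : ℝ≥0∞ => d ^ ((n : ℝ) - 1)) := by
    refine OuterMeasure.le_mkMetric _ _ (ENNReal.ofReal (min δ r₀ / 2))
      (ENNReal.ofReal_pos.2 (by positivity)) fun s hs => ?_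
    rw [OuterMeasure.restrict_apply]
    rcases (s ∩ E).eq_empty_or_nonempty with h0 | ⟨x, hxs, hxE⟩
    · rw [h0, measure_empty]
      exact zero_le
    have hst : Metric.ediam s ≠ ∞ := ne_top_of_le_ne_top ENNReal.ofReal_ne_top hs
    set d := (Metric.ediam s).toReal with hd
    have hd0 : 0 ≤ d := ENNReal.toReal_nonneg
    have hds : ENNReal.ofReal d = Metric.ediam s := ENNReal.ofReal_toReal hst
    have hdlt : d < min δ r₀ := by
      have h1 : d ≤ min δ r₀ / 2 := by
        rw [hd]
        exact ENNReal.toReal_le_of_le_ofReal (by positivity) hs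
      have : 0 < min δ r₀ := lt_min hδ hr₀
      linarith
    have hle : ∀ r ∈ Ioo d (min δ r₀),
        coverCost μ F δ (s ∩ E) ≤ c * ENNReal.ofReal r ^ ((n : ℝ) - 1) := by
      intro r hr
      have hr0 : 0 < r := hd0.trans_lt hr.1
      have hsub : s ∩ E ⊆ Metric.ball x r := by
        intro y hy
        rw [Metric.mem_ball, ← ENNReal.ofReal_lt_ofReal_iff hr0, ← edist_dist]
        refine (Metric.edist_le_ediam_of_mem hy.1 hxs).trans_lt ?_
        rw [← hds]
        exact (ENNReal.ofReal_lt_ofReal_iff hr0).2 hr.1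
      refine (coverCost_le (hE hxE) ⟨hr0, hr.2.trans_le (min_le_left _ _)⟩ hsub).trans ?_
      refine ENNReal.div_le_of_le_mul ((h x hxE r ⟨hr0, hr.2.trans_le (min_le_right _ _)⟩).trans ?_)
      rw [mul_assoc]
      gcongr
      have e1 : ((n : ℝ) - 1) = ((n - 1 : ℕ) : ℝ) := by
        rw [Nat.cast_sub (by omega), Nat.cast_one]
      rw [e1, ENNReal.rpow_natCast, ← pow_succ, Nat.sub_add_cancel (by omega),
        ENNReal.ofReal_pow hr0.le]
    have hlim : Tendsto (fun r : ℝ => c * ENNReal.ofReal r ^ ((n : ℝ) - 1)) (𝓝[>] d)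
        (𝓝 (c * ENNReal.ofReal d ^ ((n : ℝ) - 1))) := by
      refine tendsto_nhdsWithin_of_tendsto_nhds ?_
      refine ENNReal.Tendsto.const_mul ?_ (Or.inr hc)
      exact ((ENNReal.continuous_rpow_const.comp ENNReal.continuous_ofReal).tendsto d)
    rw [hds] at hlim
    refine ge_of_tendsto hlim ?_
    filter_upwards [Ioo_mem_nhdsGT hdlt] with r hr using hle r hr
  have h1 := key E
  rw [OuterMeasure.restrict_apply, inter_self, OuterMeasure.mkMetric_smul _ hc hc0] at h1
  refine h1.trans (le_of_eq ?_)
  rw [smul_apply, smul_eq_mul, OuterMeasure.coe_mkMetric]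
  rfl

theorem isClosed_measure_ball_le (μ : Measure (Rn n)) (r : ℝ) (c : ℝ≥0∞) :
    IsClosed {x | μ (Metric.ball x r) ≤ c} := by
  rw [← isOpen_compl_iff, Metric.isOpen_iff]
  intro x hx
  rw [mem_compl_iff, mem_ofPred_eq, not_le] at hx
  have hU : ⋃ k : ℕ, Metric.ball x (r - 1 / ((k : ℝ) + 1)) = Metric.ball x r := by
    ext y
    simp only [mem_iUnion, Metric.mem_ball]
    constructor
    · rintro ⟨k, hk⟩
      have : 0 < 1 / ((k : ℝ) + 1) := by positivity
      linarith
    · intro hy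
      obtain ⟨k, hk⟩ := exists_nat_one_div_lt (sub_pos.2 hy)
      exact ⟨k, by linarith⟩
  have hmono : Monotone fun k : ℕ => Metric.ball x (r - 1 / ((k : ℝ) + 1)) := by
    intro i j hij
    refine Metric.ball_subset_ball ?_
    have : 1 / ((j : ℝ) + 1) ≤ 1 / ((i : ℝ) + 1) := Nat.one_div_le_one_div hij
    linarith
  rw [← hU, hmono.measure_iUnion, lt_iSup_iff] at hx
  obtain ⟨k, hk⟩ := hx
  refine ⟨1 / ((k : ℝ) + 1), by positivity, fun y hy => ?_⟩
  rw [mem_compl_iff, mem_ofPred_eq, not_le]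
  refine hk.trans_le (measure_mono (Metric.ball_subset_ball' ?_))
  rw [Metric.mem_ball, dist_comm] at hy
  linarith

/-- A set of finite `(n-1)`-dimensional measure at whose points `μ` has vanishing
`n`-dimensional density can be covered at no cost. -/
theorem coverCost_eq_zero_of_density {μ : Measure (Rn n)} {F : Set (Rn n)} {δ : ℝ} (hδ : 0 < δ)
    (hn : 2 ≤ n) {E : Set (Rn n)} (hE : E ⊆ F) (hEm : MeasurableSet E)
    (hEfin : Measure.hausdorffMeasure ((n : ℝ) - 1) E ≠ ∞) {B : ℝ≥0∞} (hB0 : B ≠ 0) (hB : B ≠ ∞)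
    (hμB : ∀ x, ∀ r > 0, μ (Metric.ball x (2 * r)) ≤ B * ENNReal.ofReal (r ^ n))
    (hdens : ∀ x ∈ E, ∀ c : ℝ≥0∞, c ≠ 0 → ∀ᶠ r in 𝓝[>] (0 : ℝ),
      μ (Metric.ball x (2 * r)) ≤ c * ENNReal.ofReal (r ^ n)) :
    coverCost μ F δ E = 0 := by
  set σ : Measure (Rn n) := Measure.hausdorffMeasure ((n : ℝ) - 1) with hσ
  have main : ∀ c : ℝ≥0∞, c ≠ 0 → c ≠ ∞ → coverCost μ F δ E ≤ c * σ E := by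
    intro c hc0 hc
    set C : ℕ → Set (Rn n) := fun k => {x | ∀ r ∈ Ioo (0 : ℝ) (1 / ((k : ℝ) + 1)),
      μ (Metric.ball x (2 * r)) ≤ c * ENNReal.ofReal (r ^ n)} with hC
    have hCc : ∀ k, IsClosed (C k) := by
      intro k
      have : C k = ⋂ r ∈ Ioo (0 : ℝ) (1 / ((k : ℝ) + 1)),
          {x | μ (Metric.ball x (2 * r)) ≤ c * ENNReal.ofReal (r ^ n)} := by
        ext x
        simp [hC]
      rw [this]
      exact isClosed_biInter fun r _ => isClosed_measure_ball_le μ _ _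
    have hCm : Antitone fun k => E \ C k := by
      intro i j hij x hx
      refine ⟨hx.1, fun hxi => hx.2 fun r hr => hxi r ⟨hr.1, hr.2.trans_le ?_⟩⟩
      exact Nat.one_div_le_one_div hij
    have hinter : ⋂ k, E \ C k = ∅ := by
      rw [eq_empty_iff_forall_notMem]
      intro x hx
      rw [mem_iInter] at hx
      have h1 := hdens x (hx 0).1 c hc0
      obtain ⟨b, hb0, hb⟩ := mem_nhdsGT_iff_exists_Ioo_subset.1 h1
      obtain ⟨k, hk⟩ := exists_nat_one_div_lt (show (0 : ℝ) < b from hb0)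
      exact (hx k).2 fun r hr => hb ⟨hr.1, hr.2.trans hk⟩
    have hlim : Tendsto (fun k => σ (E \ C k)) atTop (𝓝 0) := by
      have := tendsto_measure_iInter_atTop (μ := σ)
        (fun k => (hEm.diff (hCc k).measurableSet).nullMeasurableSet) hCm
        ⟨0, ne_top_of_le_ne_top hEfin (measure_mono sdiff_subset)⟩
      rwa [hinter, measure_empty] at this
    have hbound : ∀ k, coverCost μ F δ E ≤ c * σ E + B * σ (E \ C k) := by
      intro k
      calc coverCost μ F δ E ≤ coverCost μ F δ ((E ∩ C k) ∪ (E \ C k)) := by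
            rw [inter_union_sdiff]
        _ ≤ coverCost μ F δ (E ∩ C k) + coverCost μ F δ (E \ C k) := measure_union_le _ _
        _ ≤ c * σ (E ∩ C k) + B * σ (E \ C k) := by
            gcongr
            · exact coverCost_le_hausdorffMeasure hδ hn (inter_subset_left.trans hE) hc0 hc
                (r₀ := 1 / ((k : ℝ) + 1)) (by positivity) fun x hx r hr => hx.2 r hr
            · exact coverCost_le_hausdorffMeasure hδ hn (sdiff_subset.trans hE) hB0 hB
                one_pos fun x _ r hr => hμB x r hr.1
        _ ≤ c * σ E + B * σ (E \ C k) := by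
            gcongr
            exact inter_subset_left
    have h2 : Tendsto (fun k => c * σ E + B * σ (E \ C k)) atTop (𝓝 (c * σ E + B * 0)) :=
      tendsto_const_nhds.add (ENNReal.Tendsto.const_mul hlim (Or.inr hB))
    rw [mul_zero, add_zero] at h2
    exact ge_of_tendsto' h2 hbound
  have hlim : Tendsto (fun k : ℕ => ((k : ℝ≥0∞) + 1)⁻¹ * σ E) atTop (𝓝 0) := by
    have h1 : Tendsto (fun k : ℕ => ((k : ℝ≥0∞) + 1)⁻¹) atTop (𝓝 0) := by
      have := (tendsto_add_atTop_iff_nat 1).2 ENNReal.tendsto_inv_nat_nhds_zero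
      simpa using this
    have := ENNReal.Tendsto.mul_const (b := σ E) h1 (Or.inr hEfin)
    simpa using this
  refine le_antisymm (ge_of_tendsto' hlim fun k => main _ ?_ ?_) zero_le
  · exact ENNReal.inv_ne_zero.2 (by finiteness)
  · exact ENNReal.inv_ne_top.2 (by simp)

/-- A compact set that can be covered at no cost has finite covers of arbitrarily small cost. -/
theorem exists_finite_cover {μ : Measure (Rn n)} {F : Set (Rn n)} (hF : IsCompact F) {δ : ℝ}
    (h : coverCost μ F δ F = 0) {ε : ℝ≥0∞} (hε : ε ≠ 0) :
    ∃ (J : Finset ℕ) (x : ℕ → Rn n) (r : ℕ → ℝ), (∀ i ∈ J, x i ∈ F ∧ r i ∈ Ioo (0 : ℝ) δ) ∧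
      F ⊆ ⋃ i ∈ J, Metric.ball (x i) (r i) ∧
      ∑ i ∈ J, μ (Metric.ball (x i) (2 * r i)) / ENNReal.ofReal (r i) ≤ ε := by
  have hε2 : ε / 2 ≠ 0 := by simp [hε]
  have h1 : coverCost μ F δ F < ε / 2 := h ▸ pos_iff_ne_zero.2 hε2
  rw [coverCost, OuterMeasure.boundedBy_apply] at h1
  simp only [iInf_lt_iff] at h1
  obtain ⟨t, ht, hsum⟩ := h1
  obtain ⟨ε', hε'0, hε'⟩ := ENNReal.exists_pos_sum_of_countable' hε2 ℕ
  have hch : ∀ i, (t i).Nonempty → ∃ p : Rn n × ℝ, p.1 ∈ F ∧ p.2 ∈ Ioo (0 : ℝ) δ ∧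
      t i ⊆ Metric.ball p.1 p.2 ∧
      μ (Metric.ball p.1 (2 * p.2)) / ENNReal.ofReal p.2 ≤ ballCost μ F δ (t i) + ε' i := by
    intro i hi
    have hfin : ballCost μ F δ (t i) ≠ ∞ := by
      have h2 := ENNReal.le_tsum (f := fun i => ⨆ _ : (t i).Nonempty, ballCost μ F δ (t i)) i
      rw [iSup_pos hi] at h2
      exact ne_top_of_lt (h2.trans_lt hsum)
    have h3 : ballCost μ F δ (t i) < ballCost μ F δ (t i) + ε' i :=
      ENNReal.lt_add_right hfin (hε'0 i).ne'
    conv_lhs at h3 => rw [ballCost]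
    simp only [iInf_lt_iff] at h3
    obtain ⟨x, hx, r, hr, hs, hlt⟩ := h3
    exact ⟨(x, r), hx, hr, hs, hlt.le⟩
  choose! p hpF hpr hpt hpc using hch
  set I : Set ℕ := {i | (t i).Nonempty} with hI
  have hcov : F ⊆ ⋃ i ∈ I, Metric.ball (p i).1 (p i).2 := by
    intro y hy
    obtain ⟨i, hi⟩ := mem_iUnion.1 (ht hy)
    exact mem_biUnion (show i ∈ I from ⟨y, hi⟩) (hpt i ⟨y, hi⟩ hi)
  obtain ⟨J, hJI, hJ, hJc⟩ := hF.elim_finite_subcover_image (fun _ _ => Metric.isOpen_ball) hcov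
  refine ⟨hJ.toFinset, fun i => (p i).1, fun i => (p i).2, fun i hi => ?_, ?_, ?_⟩
  · have hi' := hJI ((hJ.mem_toFinset).1 hi)
    exact ⟨hpF i hi', hpr i hi'⟩
  · simpa using hJc
  · calc ∑ i ∈ hJ.toFinset, μ (Metric.ball (p i).1 (2 * (p i).2)) / ENNReal.ofReal (p i).2
        ≤ ∑ i ∈ hJ.toFinset, ((⨆ _ : (t i).Nonempty, ballCost μ F δ (t i)) + ε' i) := by
          refine Finset.sum_le_sum fun i hi => ?_
          have hi' : (t i).Nonempty := hJI ((hJ.mem_toFinset).1 hi)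
          rw [iSup_pos hi']
          exact hpc i hi'
      _ ≤ ∑' i, ((⨆ _ : (t i).Nonempty, ballCost μ F δ (t i)) + ε' i) := ENNReal.sum_le_tsum _
      _ ≤ ε / 2 + ε / 2 := by
          rw [ENNReal.tsum_add]
          exact add_le_add hsum.le hε'.le
      _ = ε := ENNReal.add_halves ε

/-! ### Cutoff functions vanishing near the boundary -/

theorem IsTrace.comp_lipschitz {u g : Rn n → ℝ}
    (hu : MemLp u 2 (volume.restrict Ω)) (hg : IsTrace Ω u g) {G : ℝ → ℝ} {K : ℝ}
    (hG : ∀ s t, |G s - G t| ≤ K * |s - t|) :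
    IsTrace Ω (fun x => G (u x)) (fun x => G (g x)) := by
  filter_upwards [hg] with x hx
  have hs := hx.const_mul K
  rw [mul_zero] at hs
  refine squeeze_zero (fun r => ?_) (fun r => ?_) hs
  · rw [setAverage_eq, smul_eq_mul]
    exact mul_nonneg (by positivity) (integral_nonneg fun y => abs_nonneg _)
  · simp only [setAverage_eq, smul_eq_mul]
    rw [mul_left_comm, ← integral_const_mul K]
    refine mul_le_mul_of_nonneg_left ?_ (by positivity)
    exact integral_mono_of_nonneg (Eventually.of_forall fun y => abs_nonneg _)
      ((integrable_abs_sub hu x r _).const_mul K) (Eventually.of_forall fun y => hG _ _)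

theorem isCompact_frontier (hb : Bornology.IsBounded Ω) : IsCompact (frontier Ω) :=
  Metric.isCompact_of_isClosed_isBounded isClosed_frontier (hb.closure.subset frontier_subset_closure)

/-- The boundary can be covered at no cost relative to a bounded density with trace zero. -/
theorem IsPiecewiseC1Domain.coverCost_frontier (hΩ : IsPiecewiseC1Domain Ω) (hn : 2 ≤ n)
    {v : Rn n → ℝ} (hv : MemLp v 2 (volume.restrict Ω)) {B : ℝ} (hB : ∀ x, |v x| ≤ B)
    (htr : IsTrace Ω v 0) {δ : ℝ} (hδ : 0 < δ) :
    coverCost ((volume.restrict Ω).withDensity fun x => ‖v x‖ₑ) (frontier Ω) δ (frontier Ω) =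
      0 := by
  have ho := hΩ.isOpen
  have hb := hΩ.isBounded
  set μ := (volume.restrict Ω).withDensity fun x => ‖v x‖ₑ with hμ
  set ω : ℝ≥0∞ := volume (Metric.ball (0 : Rn n) 1) with hω
  have hω_top : ω ≠ ∞ := measure_ball_lt_top.ne
  have hω0 : ω ≠ 0 := (Metric.measure_ball_pos _ _ one_pos).ne'
  have hvol : ∀ (x : Rn n), ∀ r > 0,
      volume (Metric.ball x (2 * r)) = 2 ^ n * ω * ENNReal.ofReal (r ^ n) := by
    intro x r hr
    rw [Measure.addHaar_ball_of_pos _ _ (by positivity), finrank_euclideanSpace_fin, mul_pow,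
      ENNReal.ofReal_mul (by positivity), ENNReal.ofReal_pow (by norm_num), ← hω]
    simp only [ENNReal.ofReal_ofNat]
    ring
  have hμball : ∀ (x : Rn n) (r : ℝ), μ (Metric.ball x r) =
      ∫⁻ y in Ω ∩ Metric.ball x r, ‖v y‖ₑ := by
    intro x r
    rw [hμ, withDensity_apply _ measurableSet_ball, Measure.restrict_restrict measurableSet_ball,
      inter_comm]
  have hB0 : 0 ≤ B := (abs_nonneg _).trans (hB 0)
  set B' : ℝ≥0∞ := ENNReal.ofReal (B + 1) * (2 ^ n * ω) with hB'
  have hB'0 : B' ≠ 0 := by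
    refine mul_ne_zero (ENNReal.ofReal_pos.2 (by linarith)).ne' (mul_ne_zero (by positivity) hω0)
  have hB'top : B' ≠ ∞ := by
    refine ENNReal.mul_ne_top ENNReal.ofReal_ne_top (ENNReal.mul_ne_top (by finiteness) hω_top)
  have hμB : ∀ x, ∀ r > 0, μ (Metric.ball x (2 * r)) ≤ B' * ENNReal.ofReal (r ^ n) := by
    intro x r hr
    rw [hμball, hB', mul_assoc, ← hvol x r hr]
    refine (setLIntegral_mono' (g := fun _ => ENNReal.ofReal (B + 1))
      (ho.measurableSet.inter measurableSet_ball) fun y _ => ?_).trans ?_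
    · rw [← ofReal_norm, Real.norm_eq_abs]
      exact ENNReal.ofReal_le_ofReal (by linarith [hB y])
    · rw [setLIntegral_const]
      gcongr
      exact inter_subset_right
  have hnull : ∀ E ⊆ frontier Ω, Measure.hausdorffMeasure ((n : ℝ) - 1) E = 0 →
      coverCost μ (frontier Ω) δ E = 0 := by
    intro E hE h0
    have := coverCost_le_hausdorffMeasure hδ hn hE hB'0 hB'top one_pos
      fun x _ r hr => hμB x r hr.1
    rw [h0, mul_zero] at this
    exact le_antisymm this zero_le
  -- the points where the trace condition fails
  rw [IsTrace, surfaceMeasure, ae_restrict_iff' isClosed_frontier.measurableSet, ae_iff] at htr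
  set N := {x | ¬ (x ∈ frontier Ω → Tendsto
    (fun r : ℝ => ⨍ y in Ω ∩ Metric.ball x r, |v y - (0 : Rn n → ℝ) x|) (𝓝[>] 0) (𝓝 0))} with hN
  set N' := toMeasurable (Measure.hausdorffMeasure ((n : ℝ) - 1)) N with hN'
  have hN'0 : Measure.hausdorffMeasure ((n : ℝ) - 1) N' = 0 := by
    rw [hN', measure_toMeasurable, htr]
  have hdens : ∀ x ∈ frontier Ω \ N', ∀ c : ℝ≥0∞, c ≠ 0 → ∀ᶠ r in 𝓝[>] (0 : ℝ),
      μ (Metric.ball x (2 * r)) ≤ c * ENNReal.ofReal (r ^ n) := by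
    intro x hx c hc
    have hxN : x ∉ N := fun h => hx.2 (subset_toMeasurable _ _ h)
    rw [hN, mem_ofPred_eq, not_not] at hxN
    have ht := hxN hx.1
    simp only [Pi.zero_apply, sub_zero] at ht
    have hdbl : Tendsto (fun r : ℝ => 2 * r) (𝓝[>] 0) (𝓝[>] 0) := by
      refine tendsto_nhdsWithin_iff.2 ⟨?_, ?_⟩
      · have : Tendsto (fun r : ℝ => 2 * r) (𝓝 0) (𝓝 (2 * 0)) :=
          (continuous_const.mul continuous_id).tendsto 0
        rw [mul_zero] at this
        exact tendsto_nhdsWithin_of_tendsto_nhds this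
      · filter_upwards [self_mem_nhdsWithin] with r hr
        exact mul_pos two_pos (mem_Ioi.1 hr)
    have h1 : Tendsto (fun r : ℝ => ENNReal.ofReal (⨍ y in Ω ∩ Metric.ball x (2 * r), |v y|) *
        (2 ^ n * ω)) (𝓝[>] 0) (𝓝 0) := by
      have := ENNReal.Tendsto.mul_const (b := 2 ^ n * ω)
        (ENNReal.tendsto_ofReal (ht.comp hdbl))
        (Or.inr (ENNReal.mul_ne_top (by finiteness) hω_top))
      simpa using this
    filter_upwards [h1.eventually_le_const (pos_iff_ne_zero.2 hc), self_mem_nhdsWithin]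
      with r hr hr0
    have hfin : volume (Ω ∩ Metric.ball x (2 * r)) ≠ ∞ :=
      (hb.subset inter_subset_left).measure_lt_top.ne
    have hint : IntegrableOn (fun y => |v y|) (Ω ∩ Metric.ball x (2 * r)) := by
      have := integrable_abs_sub hv x (2 * r) 0
      simp only [sub_zero] at this
      exact this
    have e1 : ∫⁻ y in Ω ∩ Metric.ball x (2 * r), ‖v y‖ₑ =
        ENNReal.ofReal (∫ y in Ω ∩ Metric.ball x (2 * r), |v y|) := by
      rw [ofReal_integral_eq_lintegral_ofReal hint (Eventually.of_forall fun y => abs_nonneg _)]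
      simp only [← ofReal_norm, Real.norm_eq_abs]
    have e2 : ∫ y in Ω ∩ Metric.ball x (2 * r), |v y| =
        (⨍ y in Ω ∩ Metric.ball x (2 * r), |v y|) * volume.real (Ω ∩ Metric.ball x (2 * r)) := by
      rw [← measure_smul_setAverage _ hfin, smul_eq_mul, mul_comm]
    have e3 : 0 ≤ ⨍ y in Ω ∩ Metric.ball x (2 * r), |v y| := by
      rw [setAverage_eq, smul_eq_mul]
      exact mul_nonneg (by positivity) (integral_nonneg fun y => abs_nonneg _)
    rw [hμball, e1, e2, ENNReal.ofReal_mul e3, ofReal_measureReal hfin]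
    calc _ ≤ ENNReal.ofReal (⨍ y in Ω ∩ Metric.ball x (2 * r), |v y|) *
          (2 ^ n * ω * ENNReal.ofReal (r ^ n)) := by
            gcongr
            rw [← hvol x r hr0]
            exact measure_mono inter_subset_right
      _ ≤ _ := by
        rw [← mul_assoc]
        gcongr
  have hsplit : frontier Ω ⊆ (frontier Ω \ regularBoundary Ω) ∪
      ((frontier Ω ∩ N') ∪ (regularBoundary Ω \ N')) := by
    intro x hx
    by_cases h1 : x ∈ regularBoundary Ω <;> by_cases h2 : x ∈ N' <;> simp [h1, h2, hx]
  refine measure_mono_null hsplit (measure_union_null ?_ (measure_union_null ?_ ?_))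
  · exact hnull _ sdiff_subset hΩ.hausdorffMeasure_singular
  · exact hnull _ inter_subset_left (measure_mono_null inter_subset_right hN'0)
  · refine measure_null_of_locally_null _ fun x hx => ?_
    obtain ⟨r, e, γ, K, hg⟩ := exists_isLocalGraph hx.1
    refine ⟨_, inter_mem_nhdsWithin _ (Metric.ball_mem_nhds x hg.pos), ?_⟩
    obtain ⟨C, hC⟩ := hg.hausdorffMeasure_le ho
    have hsub : (regularBoundary Ω \ N') ∩ Metric.ball x r ⊆
        (frontier Ω \ N') ∩ Metric.ball x r := fun y hy => ⟨⟨hy.1.1.1, hy.1.2⟩, hy.2⟩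
    refine measure_mono_null hsub ?_
    refine coverCost_eq_zero_of_density hδ hn (inter_subset_left.trans sdiff_subset)
      ((isClosed_frontier.measurableSet.diff (measurableSet_toMeasurable _ _)).inter
        measurableSet_ball) ?_ hB'0 hB'top hμB fun y hy => hdens y hy.1
    refine ne_top_of_le_ne_top (ENNReal.mul_ne_top ENNReal.coe_ne_top ENNReal.ofReal_ne_top)
      ((measure_mono ?_).trans (hC x r hg.pos.le))
    exact fun y hy => ⟨⟨hy.1.1, hy.2⟩, Metric.ball_subset_closedBall hy.2⟩

/-- Cutoff functions vanishing near the boundary whose gradients are small against a bounded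
function with trace zero. -/
theorem IsPiecewiseC1Domain.exists_cutoff (hΩ : IsPiecewiseC1Domain Ω) (hn : 2 ≤ n)
    {v : Rn n → ℝ} (hv : MemLp v 2 (volume.restrict Ω)) {B : ℝ} (hB : ∀ x, |v x| ≤ B)
    (htr : IsTrace Ω v 0) {δ : ℝ} (hδ : 0 < δ) (w : Rn n) :
    ∃ ζ : Rn n → ℝ, ContDiff ℝ (⊤ : ℕ∞) ζ ∧ (∀ x, 0 ≤ ζ x ∧ ζ x ≤ 1) ∧
      (∀ x ∈ frontier Ω, ζ =ᶠ[𝓝 x] 0) ∧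
      (∀ x, (∀ y ∈ frontier Ω, 2 * δ ≤ dist x y) → ζ x = 1) ∧
      ∫⁻ x in Ω, ‖v x‖ₑ * ‖fderiv ℝ ζ x w‖ₑ ≤ ENNReal.ofReal δ := by
  have ho := hΩ.isOpen
  let β : ContDiffBump (0 : Rn n) := ⟨1, 2, one_pos, one_lt_two⟩
  have hβs : ContDiff ℝ (⊤ : ℕ∞) β := β.contDiff
  have hdc : Continuous fun x => fderiv ℝ β x w :=
    (hβs.continuous_fderiv (by simp)).clm_apply continuous_const
  obtain ⟨M, hM⟩ := (β.hasCompactSupport.fderiv_apply (𝕜 := ℝ) w).exists_bound_of_continuous hdc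
  have hM0 : 0 ≤ M := (norm_nonneg _).trans (hM 0)
  set μ := (volume.restrict Ω).withDensity fun x => ‖v x‖ₑ with hμ
  obtain ⟨J, p, r, hJ, hcov, hsum⟩ := exists_finite_cover (isCompact_frontier hΩ.isBounded)
    (hΩ.coverCost_frontier hn hv hB htr hδ)
    (ε := ENNReal.ofReal (δ / (M + 1))) (ENNReal.ofReal_pos.2 (by positivity)).ne'
  set η : ℕ → Rn n → ℝ := fun i x => β ((r i)⁻¹ • (x - p i)) with hη
  have hηs : ∀ i, ContDiff ℝ (⊤ : ℕ∞) (η i) := fun i =>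
    hβs.comp (by fun_prop : ContDiff ℝ _ fun x => (r i)⁻¹ • (x - p i))
  have hη01 : ∀ i x, 0 ≤ 1 - η i x ∧ 1 - η i x ≤ 1 := fun i x =>
    ⟨sub_nonneg.2 β.le_one, sub_le_self _ β.nonneg⟩
  have hnorm : ∀ i ∈ J, ∀ x, ‖(r i)⁻¹ • (x - p i)‖ = dist x (p i) / r i := by
    intro i hi x
    rw [norm_smul, norm_inv, Real.norm_of_nonneg (hJ i hi).2.1.le, dist_eq_norm, div_eq_inv_mul]
  have hη1 : ∀ i ∈ J, ∀ x ∈ Metric.ball (p i) (r i), η i x = 1 := by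
    intro i hi x hx
    refine β.one_of_mem_closedBall ?_
    rw [mem_closedBall_zero_iff, hnorm i hi, div_le_one (hJ i hi).2.1]
    exact hx.le
  have hη0 : ∀ i ∈ J, ∀ x, 2 * r i ≤ dist x (p i) → η i x = 0 := by
    intro i hi x hx
    refine β.zero_of_le_dist ?_
    rw [dist_zero_right, hnorm i hi]
    exact (le_div_iff₀ (hJ i hi).2.1).2 hx
  have hηd : ∀ i ∈ J, ∀ x, ‖fderiv ℝ (η i) x w‖ₑ ≤
      (Metric.ball (p i) (2 * r i)).indicator (fun _ => ENNReal.ofReal (M / r i)) x := by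
    intro i hi x
    have hr0 := (hJ i hi).2.1
    by_cases hx : x ∈ Metric.ball (p i) (2 * r i)
    · rw [indicator_of_mem hx, ← ofReal_norm]
      refine ENNReal.ofReal_le_ofReal ?_
      have h1 : HasFDerivAt β (fderiv ℝ β ((r i)⁻¹ • (x - p i))) ((r i)⁻¹ • (x - p i)) :=
        (hβs.differentiable (by simp)).differentiableAt.hasFDerivAt
      have h2 : HasFDerivAt (fun x => (r i)⁻¹ • (x - p i))
          ((r i)⁻¹ • ContinuousLinearMap.id ℝ (Rn n)) x :=
        ((hasFDerivAt_id x).sub_const (p i)).const_smul (r i)⁻¹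
      have h3 := (h1.comp x h2).fderiv
      change fderiv ℝ (η i) x = _ at h3
      rw [h3]
      simp only [ContinuousLinearMap.comp_apply, smul_apply, ContinuousLinearMap.id_apply,
        map_smul, smul_eq_mul, norm_mul, norm_inv, Real.norm_of_nonneg hr0.le]
      rw [div_eq_inv_mul]
      gcongr
      exact hM _
    · -- outside the ball the bump function attains its minimum
      rw [indicator_of_notMem hx]
      have h0 : η i x = 0 := hη0 i hi x (not_lt.1 hx)
      have hmin : IsLocalMin (η i) x := Eventually.of_forall fun y => by
        rw [h0]
        exact β.nonneg
      rw [hmin.fderiv_eq_zero]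
      simp
  refine ⟨fun x => ∏ i ∈ J, (1 - η i x), ?_, fun x => ⟨?_, ?_⟩, fun x hx => ?_, fun x hx => ?_, ?_⟩
  · exact contDiff_prod fun i _ => contDiff_const.sub (hηs i)
  · exact Finset.prod_nonneg fun i _ => (hη01 i x).1
  · exact Finset.prod_le_one (fun i _ => (hη01 i x).1) fun i _ => (hη01 i x).2
  · obtain ⟨i, hi, hxi⟩ := mem_iUnion₂.1 (hcov hx)
    filter_upwards [Metric.isOpen_ball.mem_nhds hxi] with y hy
    exact Finset.prod_eq_zero hi (by rw [hη1 i hi y hy, sub_self])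
  · refine Finset.prod_eq_one fun i hi => ?_
    rw [hη0 i hi x, sub_zero]
    have := hx (p i) (hJ i hi).1
    linarith [(hJ i hi).2.2]
  · have hpt : ∀ x, ‖fderiv ℝ (fun x => ∏ i ∈ J, (1 - η i x)) x w‖ₑ ≤
        ∑ i ∈ J, (Metric.ball (p i) (2 * r i)).indicator (fun _ => ENNReal.ofReal (M / r i)) x := by
      intro x
      have h1 : ∀ i ∈ J, HasFDerivAt (fun x => 1 - η i x) (-fderiv ℝ (η i) x) x := fun i _ =>
        ((hηs i).differentiable (by simp)).differentiableAt.hasFDerivAt.const_sub 1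
      have h2 := HasFDerivAt.finsetProd h1
      rw [h2.fderiv]
      simp only [sum_apply, smul_apply, neg_apply, smul_eq_mul]
      refine (enorm_sum_le _ _).trans (Finset.sum_le_sum fun i hi => ?_)
      rw [enorm_mul, enorm_neg]
      refine le_trans ?_ (hηd i hi x)
      refine mul_le_of_le_one_left zero_le ?_
      have h3 : 0 ≤ ∏ j ∈ J.erase i, (1 - η j x) := Finset.prod_nonneg fun j _ => (hη01 j x).1
      rw [Real.enorm_eq_ofReal h3, ← ENNReal.ofReal_one]
      exact ENNReal.ofReal_le_ofReal
        (Finset.prod_le_one (fun i _ => (hη01 i x).1) fun i _ => (hη01 i x).2)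
    calc ∫⁻ x in Ω, ‖v x‖ₑ * ‖fderiv ℝ (fun x => ∏ i ∈ J, (1 - η i x)) x w‖ₑ
        ≤ ∫⁻ x in Ω, ‖v x‖ₑ * ∑ i ∈ J,
            (Metric.ball (p i) (2 * r i)).indicator (fun _ => ENNReal.ofReal (M / r i)) x := by
          refine lintegral_mono fun x => ?_
          dsimp only
          gcongr
          exact hpt x
      _ = ∫⁻ x, ∑ i ∈ J, (Metric.ball (p i) (2 * r i)).indicator
            (fun _ => ENNReal.ofReal (M / r i)) x ∂μ := by
          rw [hμ, lintegral_withDensity_eq_lintegral_mul₀ hv.1.enorm]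
          · rfl
          · exact (Finset.measurable_fun_sum _ fun i _ =>
              measurable_const.indicator measurableSet_ball).aemeasurable
      _ = ∑ i ∈ J, ENNReal.ofReal (M / r i) * μ (Metric.ball (p i) (2 * r i)) := by
          rw [lintegral_finsetSum _ fun i _ => measurable_const.indicator measurableSet_ball]
          refine Finset.sum_congr rfl fun i _ => ?_
          rw [lintegral_indicator_const measurableSet_ball]
      _ = ENNReal.ofReal M *
            ∑ i ∈ J, μ (Metric.ball (p i) (2 * r i)) / ENNReal.ofReal (r i) := by
          rw [Finset.mul_sum]
          refine Finset.sum_congr rfl fun i hi => ?_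
          rw [ENNReal.ofReal_div_of_pos (hJ i hi).2.1, ENNReal.div_eq_inv_mul,
            ENNReal.div_eq_inv_mul]
          ring
      _ ≤ ENNReal.ofReal M * ENNReal.ofReal (δ / (M + 1)) := by gcongr
      _ ≤ ENNReal.ofReal δ := by
          rw [← ENNReal.ofReal_mul hM0]
          refine ENNReal.ofReal_le_ofReal ?_
          rw [← mul_div_assoc, div_le_iff₀ (by positivity)]
          nlinarith

/-! ### Functions with trace zero belong to `H₀¹(Ω)` -/

/-- Cutting a smooth function off near the boundary makes it a test function in `Ω`. -/
theorem isTestFunction_indicator (hΩ : IsOpen Ω) (hb : Bornology.IsBounded Ω) {φ : Rn n → ℝ}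
    (hφ : ContDiff ℝ (⊤ : ℕ∞) φ) (h0 : ∀ x ∈ frontier Ω, φ =ᶠ[𝓝 x] 0) :
    IsTestFunction Ω (Ω.indicator φ) := by
  have hloc : ∀ x ∉ Ω, Ω.indicator φ =ᶠ[𝓝 x] 0 := by
    intro x hx
    by_cases hxc : x ∈ closure Ω
    · have hxf : x ∈ frontier Ω := by rw [hΩ.frontier_eq]; exact ⟨hxc, hx⟩
      filter_upwards [h0 x hxf] with y hy
      by_cases hyΩ : y ∈ Ω <;> simp [hyΩ, hy]
    · filter_upwards [isClosed_closure.isOpen_compl.mem_nhds hxc] with y hy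
      exact indicator_of_notMem (fun h => hy (subset_closure h)) _
  have hts : tsupport (Ω.indicator φ) ⊆ Ω := by
    intro x hx
    by_contra hxΩ
    exact (notMem_tsupport_iff_eventuallyEq.2 (hloc x hxΩ)) hx
  refine ⟨contDiff_iff_contDiffAt.2 fun x => ?_, ?_, hts⟩
  · by_cases hx : x ∈ Ω
    · refine hφ.contDiffAt.congr_of_eventuallyEq ?_
      filter_upwards [hΩ.mem_nhds hx] with y hy
      exact indicator_of_mem hy _
    · exact contDiffAt_const.congr_of_eventuallyEq (hloc x hx)
  · exact Metric.isCompact_of_isClosed_isBounded (isClosed_tsupport _) (hb.subset hts)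

/-- A bounded function of `H¹(Ω)` with trace zero belongs to `H₀¹(Ω)`. -/
theorem IsH1.isH10_of_bounded (hΩ : IsPiecewiseC1Domain Ω) (hn : 2 ≤ n) {v : Rn n → ℝ}
    {Dv : Rn n → Rn n} (hv : IsH1 Ω v Dv) {B : ℝ} (hB : ∀ x, |v x| ≤ B) (htr : IsTrace Ω v 0) :
    IsH10 Ω v Dv := by
  refine ⟨hv, fun φ hφ hφc w => ?_⟩
  have ho := hΩ.isOpen
  have hb := hΩ.isBounded
  have hvi := hv.integrableOn hb
  have hDvi : IntegrableOn (fun x => (inner ℝ (Dv x) w : ℝ)) Ω :=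
    (hv.integrableOn_grad hb).inner_const w (𝕜 := ℝ)
  choose ζ hζs hζ01 hζ0 hζ1 hζI using fun k : ℕ =>
    hΩ.exists_cutoff hn hv.memLp hB htr (δ := 1 / ((k : ℝ) + 1)) (by positivity) w
  have hdφ : Continuous fun x => fderiv ℝ φ x w :=
    (hφ.continuous_fderiv (by simp)).clm_apply continuous_const
  obtain ⟨A, hA⟩ := (hφc.fderiv_apply (𝕜 := ℝ) w).exists_bound_of_continuous hdφ
  obtain ⟨A', hA'⟩ := hφc.exists_bound_of_continuous hφ.continuous
  have hA'0 : 0 ≤ A' := (norm_nonneg _).trans (hA' 0)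
  have hdζ : ∀ k, Continuous fun x => fderiv ℝ (ζ k) x w := fun k =>
    ((hζs k).continuous_fderiv (by simp)).clm_apply continuous_const
  have hζabs : ∀ k x, ‖ζ k x‖ ≤ 1 := fun k x => by
    rw [Real.norm_of_nonneg (hζ01 k x).1]
    exact (hζ01 k x).2
  -- every point of `Ω` is eventually outside the region where the cutoff acts
  have hζlim : ∀ x ∈ Ω, Tendsto (fun k => ζ k x) atTop (𝓝 1) := by
    intro x hx
    obtain ⟨ρ, hρ, hρΩ⟩ := Metric.isOpen_iff.1 ho x hx
    have h1 : Tendsto (fun k : ℕ => 2 * (1 / ((k : ℝ) + 1))) atTop (𝓝 0) := by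
      have := (tendsto_one_div_add_atTop_nhds_zero_nat (𝕜 := ℝ)).const_mul 2
      rwa [mul_zero] at this
    refine tendsto_const_nhds.congr' ?_
    filter_upwards [h1.eventually_lt_const hρ] with k hk
    refine (hζ1 k x fun y hy => ?_).symm
    by_contra! hlt
    have hyΩ : y ∈ Ω := hρΩ (by rw [Metric.mem_ball, dist_comm]; exact hlt.trans hk)
    rw [ho.frontier_eq] at hy
    exact hy.2 hyΩ
  have hI1 : ∀ k, IntegrableOn (fun x => v x * (ζ k x * fderiv ℝ φ x w)) Ω := fun k =>
    hvi.mul_bdd (c := A) ((hζs k).continuous.mul hdφ).aestronglyMeasurable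
      (Eventually.of_forall fun x => by
        rw [norm_mul]
        exact (mul_le_of_le_one_left (norm_nonneg _) (hζabs k x)).trans (hA x))
  have hlint : ∀ k, ∫⁻ x in Ω, ‖v x * (φ x * fderiv ℝ (ζ k) x w)‖ₑ ≤
      ENNReal.ofReal A' * ENNReal.ofReal (1 / ((k : ℝ) + 1)) := by
    intro k
    calc ∫⁻ x in Ω, ‖v x * (φ x * fderiv ℝ (ζ k) x w)‖ₑ
        ≤ ∫⁻ x in Ω, ENNReal.ofReal A' * (‖v x‖ₑ * ‖fderiv ℝ (ζ k) x w‖ₑ) := by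
          refine lintegral_mono fun x => ?_
          dsimp only
          rw [enorm_mul, enorm_mul, mul_left_comm]
          gcongr
          rw [← ofReal_norm]
          exact ENNReal.ofReal_le_ofReal (hA' x)
      _ ≤ _ := by
          rw [lintegral_const_mul' _ _ ENNReal.ofReal_ne_top]
          gcongr
          exact hζI k
  have hI2 : ∀ k, IntegrableOn (fun x => v x * (φ x * fderiv ℝ (ζ k) x w)) Ω := fun k =>
    ⟨hvi.1.mul (hφ.continuous.mul (hdζ k)).aestronglyMeasurable,
      (hlint k).trans_lt (ENNReal.mul_lt_top ENNReal.ofReal_lt_top ENNReal.ofReal_lt_top)⟩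
  have hid : ∀ k, (∫ x in Ω, v x * (ζ k x * fderiv ℝ φ x w)) +
      (∫ x in Ω, v x * (φ x * fderiv ℝ (ζ k) x w)) =
      - ∫ x in Ω, inner ℝ (Dv x) w * (ζ k x * φ x) := by
    intro k
    have htest : IsTestFunction Ω (Ω.indicator fun x => ζ k x * φ x) := by
      refine isTestFunction_indicator ho hb ((hζs k).mul hφ) fun x hx => ?_
      filter_upwards [hζ0 k x hx] with y hy
      simp [hy]
    have h := hv.weak_grad _ htest w
    have e1 : ∀ x ∈ Ω, fderiv ℝ (Ω.indicator fun x => ζ k x * φ x) x w =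
        ζ k x * fderiv ℝ φ x w + φ x * fderiv ℝ (ζ k) x w := by
      intro x hx
      have heq : (Ω.indicator fun x => ζ k x * φ x) =ᶠ[𝓝 x] fun x => ζ k x * φ x := by
        filter_upwards [ho.mem_nhds hx] with y hy
        exact indicator_of_mem hy _
      rw [heq.fderiv_eq]
      have h1 : HasFDerivAt (ζ k) (fderiv ℝ (ζ k) x) x :=
        ((hζs k).differentiable (by simp)).differentiableAt.hasFDerivAt
      have h2 : HasFDerivAt φ (fderiv ℝ φ x) x :=
        (hφ.differentiable (by simp)).differentiableAt.hasFDerivAt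
      have h3 := (h1.mul h2).fderiv
      have h4 : fderiv ℝ (fun x => ζ k x * φ x) x = _ := h3
      rw [h4]
      simp
    have e2 : ∫ x in Ω, v x * fderiv ℝ (Ω.indicator fun x => ζ k x * φ x) x w =
        ∫ x in Ω, (v x * (ζ k x * fderiv ℝ φ x w) + v x * (φ x * fderiv ℝ (ζ k) x w)) :=
      setIntegral_congr_fun ho.measurableSet fun x hx => by
        simp only [e1 x hx, mul_add]
    have e3 : ∫ x in Ω, inner ℝ (Dv x) w * (Ω.indicator fun x => ζ k x * φ x) x =
        ∫ x in Ω, inner ℝ (Dv x) w * (ζ k x * φ x) :=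
      setIntegral_congr_fun ho.measurableSet fun x hx => by
        simp only [indicator_of_mem hx]
    rw [e2, e3, integral_add (hI1 k) (hI2 k)] at h
    exact h
  have hL1 : Tendsto (fun k => ∫ x in Ω, v x * (ζ k x * fderiv ℝ φ x w)) atTop
      (𝓝 (∫ x in Ω, v x * fderiv ℝ φ x w)) := by
    refine tendsto_integral_of_dominated_convergence (fun x => ‖v x‖ * A)
      (fun k => (hI1 k).1) (hvi.norm.mul_const A) (fun k => Eventually.of_forall fun x => ?_) ?_
    · rw [norm_mul, norm_mul]
      gcongr
      exact (mul_le_of_le_one_left (norm_nonneg _) (hζabs k x)).trans (hA x)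
    · filter_upwards [ae_restrict_mem ho.measurableSet] with x hx
      have := ((hζlim x hx).mul_const (fderiv ℝ φ x w)).const_mul (v x)
      rwa [one_mul] at this
  have hL2 : Tendsto (fun k => ∫ x in Ω, v x * (φ x * fderiv ℝ (ζ k) x w)) atTop (𝓝 0) := by
    have h1 : Tendsto (fun k : ℕ => A' * (1 / ((k : ℝ) + 1))) atTop (𝓝 0) := by
      have := (tendsto_one_div_add_atTop_nhds_zero_nat (𝕜 := ℝ)).const_mul A'
      rwa [mul_zero] at this
    refine squeeze_zero_norm (fun k => ?_) h1
    have h2 := (enorm_integral_le_lintegral_enorm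
      (μ := volume.restrict Ω) fun x => v x * (φ x * fderiv ℝ (ζ k) x w)).trans (hlint k)
    rw [← ENNReal.ofReal_mul hA'0, ← ofReal_norm] at h2
    exact (ENNReal.ofReal_le_ofReal_iff (by positivity)).1 h2
  have hL3 : Tendsto (fun k => ∫ x in Ω, inner ℝ (Dv x) w * (ζ k x * φ x)) atTop
      (𝓝 (∫ x in Ω, inner ℝ (Dv x) w * φ x)) := by
    refine tendsto_integral_of_dominated_convergence (fun x => ‖(inner ℝ (Dv x) w : ℝ)‖ * A')
      (fun k => hDvi.1.mul ((hζs k).continuous.mul hφ.continuous).aestronglyMeasurable)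
      (hDvi.norm.mul_const A') (fun k => Eventually.of_forall fun x => ?_) ?_
    · rw [norm_mul, norm_mul]
      gcongr
      exact (mul_le_of_le_one_left (norm_nonneg _) (hζabs k x)).trans (hA' x)
    · filter_upwards [ae_restrict_mem ho.measurableSet] with x hx
      have := ((hζlim x hx).mul_const (φ x)).const_mul (inner ℝ (Dv x) w : ℝ)
      rwa [one_mul] at this
  have hfin := tendsto_nhds_unique ((hL1.add hL2).congr hid) hL3.neg
  rwa [add_zero] at hfin

theorem hasDerivAt_truncation (δ s : ℝ) :
    HasDerivAt (fun s => s / (1 + (δ * s) ^ 2))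
      ((1 - (δ * s) ^ 2) / (1 + (δ * s) ^ 2) ^ 2) s := by
  have h1 : HasDerivAt (fun s : ℝ => 1 + (δ * s) ^ 2) (2 * (δ * s) * δ) s := by
    simpa using (((hasDerivAt_id s).const_mul δ).pow 2).const_add 1
  refine ((hasDerivAt_id s).div h1 (by positivity)).congr_deriv ?_
  simp only [id]
  congr 1
  ring

theorem abs_truncation_deriv_le (δ s : ℝ) :
    |(1 - (δ * s) ^ 2) / (1 + (δ * s) ^ 2) ^ 2| ≤ 1 := by
  rw [abs_div, abs_of_nonneg (by positivity : (0 : ℝ) ≤ (1 + (δ * s) ^ 2) ^ 2)]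
  refine div_le_one_of_le₀ ?_ (by positivity)
  rw [abs_le]
  constructor <;> nlinarith [sq_nonneg (δ * s), sq_nonneg ((δ * s) ^ 2)]

theorem abs_truncation_le (δ s : ℝ) : |s / (1 + (δ * s) ^ 2)| ≤ |s| := by
  rw [abs_div, abs_of_nonneg (by positivity : (0 : ℝ) ≤ 1 + (δ * s) ^ 2)]
  exact div_le_self (abs_nonneg _) (by nlinarith [sq_nonneg (δ * s)])

theorem abs_truncation_le_inv {δ : ℝ} (hδ : 0 < δ) (s : ℝ) :
    |s / (1 + (δ * s) ^ 2)| ≤ 1 / δ := by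
  rw [abs_div, abs_of_nonneg (by positivity : (0 : ℝ) ≤ 1 + (δ * s) ^ 2),
    div_le_div_iff₀ (by positivity) hδ, one_mul, mul_pow, ← sq_abs s]
  nlinarith [sq_nonneg (δ * |s| - 1), abs_nonneg s]

/-- A function of `H¹(Ω)` with trace zero belongs to `H₀¹(Ω)`: corners, edges and cusps of the
boundary do no harm, because they are negligible for surface measure. -/
theorem IsH1.isH10 (hΩ : IsPiecewiseC1Domain Ω) (hn : 2 ≤ n) {v : Rn n → ℝ}
    {Dv : Rn n → Rn n} (hv : IsH1 Ω v Dv) (htr : IsTrace Ω v 0) : IsH10 Ω v Dv := by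
  refine ⟨hv, fun φ hφ hφc w => ?_⟩
  have ho := hΩ.isOpen
  have hb := hΩ.isBounded
  have hvi := hv.integrableOn hb
  have hDvi : IntegrableOn (fun x => (inner ℝ (Dv x) w : ℝ)) Ω :=
    (hv.integrableOn_grad hb).inner_const w (𝕜 := ℝ)
  have hdφ : Continuous fun x => fderiv ℝ φ x w :=
    (hφ.continuous_fderiv (by simp)).clm_apply continuous_const
  obtain ⟨A, hA⟩ := (hφc.fderiv_apply (𝕜 := ℝ) w).exists_bound_of_continuous hdφ
  obtain ⟨A', hA'⟩ := hφc.exists_bound_of_continuous hφ.continuous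
  set d : ℕ → ℝ := fun k => 1 / ((k : ℝ) + 1) with hd
  have hd0 : ∀ k, 0 < d k := fun k => by positivity
  have hdlim : Tendsto d atTop (𝓝 0) := tendsto_one_div_add_atTop_nhds_zero_nat
  set G : ℕ → ℝ → ℝ := fun k s => s / (1 + (d k * s) ^ 2) with hG
  set τ : ℕ → ℝ → ℝ := fun k s => (1 - (d k * s) ^ 2) / (1 + (d k * s) ^ 2) ^ 2 with hτ
  have hτc : ∀ k, Continuous (τ k) := fun k => by
    refine Continuous.div (by fun_prop) (by fun_prop) fun s => ?_
    positivity
  have hGt : ∀ k, IsH10 Ω (fun x => G k (v x)) (fun x => τ k (v x) • Dv x) := by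
    intro k
    have h1 := hv.comp ho hb (hasDerivAt_truncation (d k)) (hτc k) (abs_truncation_deriv_le (d k))
    refine h1.isH10_of_bounded hΩ hn (fun x => abs_truncation_le_inv (hd0 k) (v x)) ?_
    have h2 := htr.comp_lipschitz hv.memLp
      (abs_sub_le_of_hasDerivAt (hasDerivAt_truncation (d k)) (abs_truncation_deriv_le (d k)))
    simp only [Pi.zero_apply, zero_div] at h2
    exact h2
  have hsq : ∀ s, Tendsto (fun k => (d k * s) ^ 2) atTop (𝓝 0) := by
    intro s
    have := (hdlim.mul_const s).pow 2
    simpa using this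
  have hGlim : ∀ s, Tendsto (fun k => G k s) atTop (𝓝 s) := by
    intro s
    have := (tendsto_const_nhds (x := s)).div ((hsq s).const_add 1) (by norm_num)
    rw [add_zero, div_one] at this
    exact this
  have hτlim : ∀ s, Tendsto (fun k => τ k s) atTop (𝓝 1) := by
    intro s
    have := ((hsq s).const_sub 1).div (((hsq s).const_add 1).pow 2) (by norm_num)
    rw [add_zero, sub_zero, one_pow, div_one] at this
    exact this
  have hL1 : Tendsto (fun k => ∫ x in Ω, G k (v x) * fderiv ℝ φ x w) atTop
      (𝓝 (∫ x in Ω, v x * fderiv ℝ φ x w)) := by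
    refine tendsto_integral_of_dominated_convergence (fun x => ‖v x‖ * A)
      (fun k => ((hGt k).isH1.memLp.1).mul hdφ.aestronglyMeasurable) (hvi.norm.mul_const A)
      (fun k => Eventually.of_forall fun x => ?_) (Eventually.of_forall fun x => ?_)
    · rw [norm_mul]
      exact mul_le_mul (abs_truncation_le _ _) (hA x) (norm_nonneg _) (norm_nonneg _)
    · exact (hGlim (v x)).mul_const _
  have hL2 : Tendsto (fun k => ∫ x in Ω, inner ℝ (τ k (v x) • Dv x) w * φ x) atTop
      (𝓝 (∫ x in Ω, inner ℝ (Dv x) w * φ x)) := by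
    refine tendsto_integral_of_dominated_convergence (fun x => ‖(inner ℝ (Dv x) w : ℝ)‖ * A')
      (fun k => ((hGt k).isH1.memLp_grad.inner_const w (𝕜 := ℝ)).1.mul
        hφ.continuous.aestronglyMeasurable)
      (hDvi.norm.mul_const A')
      (fun k => Eventually.of_forall fun x => ?_) (Eventually.of_forall fun x => ?_)
    · rw [norm_mul, inner_smul_left, norm_mul]
      refine mul_le_mul ?_ (hA' x) (norm_nonneg _) (norm_nonneg _)
      exact mul_le_of_le_one_left (norm_nonneg _) (abs_truncation_deriv_le _ _)
    · simp only [inner_smul_left, RCLike.conj_to_real]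
      have := ((hτlim (v x)).mul_const (inner ℝ (Dv x) w : ℝ)).mul_const (φ x)
      rwa [one_mul] at this
  exact tendsto_nhds_unique (hL1.congr fun k => (hGt k).weak_grad φ hφ hφc w) hL2.neg

/-! ### The Poincaré inequality and strongly monotone maps -/

theorem hasDerivAt_sq_truncation (δ s : ℝ) :
    HasDerivAt (fun s => s ^ 2 / (1 + (δ * s) ^ 2)) (2 * s / (1 + (δ * s) ^ 2) ^ 2) s := by
  have h1 : HasDerivAt (fun s : ℝ => 1 + (δ * s) ^ 2) (2 * (δ * s) * δ) s := by
    simpa using (((hasDerivAt_id s).const_mul δ).pow 2).const_add 1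
  have h2 : HasDerivAt (fun s : ℝ => s ^ 2) (2 * s) s := by simpa using hasDerivAt_pow 2 s
  refine (h2.div h1 (by positivity)).congr_deriv ?_
  congr 1
  ring

theorem abs_sq_truncation_deriv_le (δ s : ℝ) : |2 * s / (1 + (δ * s) ^ 2) ^ 2| ≤ 2 * |s| := by
  rw [abs_div, abs_of_nonneg (by positivity : (0 : ℝ) ≤ (1 + (δ * s) ^ 2) ^ 2), abs_mul, abs_two]
  refine div_le_self (by positivity) ?_
  nlinarith [sq_nonneg (δ * s), sq_nonneg ((δ * s) ^ 2)]

theorem abs_sq_truncation_deriv_le_inv {δ : ℝ} (hδ : 0 < δ) (s : ℝ) :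
    |2 * s / (1 + (δ * s) ^ 2) ^ 2| ≤ 2 / δ := by
  have h := abs_truncation_le_inv hδ s
  rw [abs_div, abs_of_nonneg (by positivity : (0 : ℝ) ≤ 1 + (δ * s) ^ 2)] at h
  rw [abs_div, abs_of_nonneg (by positivity : (0 : ℝ) ≤ (1 + (δ * s) ^ 2) ^ 2), abs_mul, abs_two]
  calc 2 * |s| / (1 + (δ * s) ^ 2) ^ 2 ≤ 2 * |s| / (1 + (δ * s) ^ 2) := by
        gcongr
        nlinarith [sq_nonneg (δ * s), sq_nonneg ((δ * s) ^ 2)]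
    _ = 2 * (|s| / (1 + (δ * s) ^ 2)) := by ring
    _ ≤ 2 * (1 / δ) := by gcongr
    _ = 2 / δ := by ring

/-- The Poincaré inequality, obtained by testing the weak gradient of `v²` with a coordinate. -/
theorem IsH10.poincare (hΩ : IsOpen Ω) (hb : Bornology.IsBounded Ω) (i : Fin n) {R : ℝ}
    (hR : Ω ⊆ Metric.ball 0 R) {v : Rn n → ℝ} {Dv : Rn n → Rn n}
    (hv : IsH10 Ω v Dv) : ∫ x in Ω, v x ^ 2 ≤ 4 * R ^ 2 * ∫ x in Ω, ‖Dv x‖ ^ 2 := by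
  have hv2 : IntegrableOn (fun x => v x ^ 2) Ω := hv.isH1.memLp.integrable_sq
  have hD2 : IntegrableOn (fun x => ‖Dv x‖ ^ 2) Ω :=
    (memLp_two_iff_integrable_sq_norm hv.isH1.memLp_grad.1).1 hv.isH1.memLp_grad
  have hvD : IntegrableOn (fun x => |v x| * ‖Dv x‖) Ω :=
    hv.isH1.memLp.norm.integrable_mul hv.isH1.memLp_grad.norm
  have main : ∀ δ > 0, ∫ x in Ω, v x ^ 2 / (1 + (δ * v x) ^ 2) ≤
      ∫ x in Ω, 2 * R * (|v x| * ‖Dv x‖) := by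
    intro δ hδ
    have hT := hv.comp hΩ hb (hasDerivAt_sq_truncation δ) (by simp)
      (by
        refine Continuous.div (by fun_prop) (by fun_prop) fun s => ?_
        positivity)
      (abs_sq_truncation_deriv_le_inv hδ)
    have hφ : ContDiff ℝ (⊤ : ℕ∞) fun x : Rn n => x i := by fun_prop
    have h := hT.integral_fderiv hΩ hb hφ (EuclideanSpace.single i 1)
    have e1 : ∀ x : Rn n, fderiv ℝ (fun x : Rn n => x i) x (EuclideanSpace.single i 1) = 1 := by
      intro x
      have : HasFDerivAt (fun x : Rn n => x i) (EuclideanSpace.proj i : Rn n →L[ℝ] ℝ) x :=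
        (EuclideanSpace.proj i : Rn n →L[ℝ] ℝ).hasFDerivAt
      rw [this.fderiv]
      simp
    simp only [e1, mul_one] at h
    rw [h]
    refine (neg_le_abs _).trans ?_
    rw [← Real.norm_eq_abs]
    refine norm_integral_le_of_norm_le (hvD.const_mul (2 * R)) ?_
    filter_upwards [ae_restrict_mem hΩ.measurableSet] with x hx
    have hxi : |x i| ≤ R := by
      have h2 := mem_ball_zero_iff.1 (hR hx)
      rw [← Real.norm_eq_abs]
      exact (PiLp.norm_apply_le x i).trans h2.le
    rw [norm_mul, inner_smul_left, norm_mul, Real.norm_eq_abs, Real.norm_eq_abs, Real.norm_eq_abs]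
    have h3 : |(inner ℝ (Dv x) (EuclideanSpace.single i (1 : ℝ)) : ℝ)| ≤ ‖Dv x‖ := by
      refine (abs_real_inner_le_norm _ _).trans ?_
      simp
    calc _ ≤ 2 * |v x| * ‖Dv x‖ * R := by
          gcongr
          exact abs_sq_truncation_deriv_le δ (v x)
      _ = _ := by ring
  set d : ℕ → ℝ := fun k => 1 / ((k : ℝ) + 1) with hd
  have hd0 : ∀ k, 0 < d k := fun k => by positivity
  have hdlim : Tendsto d atTop (𝓝 0) := tendsto_one_div_add_atTop_nhds_zero_nat
  have hlim : Tendsto (fun k => ∫ x in Ω, v x ^ 2 / (1 + (d k * v x) ^ 2)) atTop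
      (𝓝 (∫ x in Ω, v x ^ 2)) := by
    refine tendsto_integral_of_dominated_convergence (fun x => v x ^ 2) (fun k => ?_) hv2
      (fun k => Eventually.of_forall fun x => ?_) (Eventually.of_forall fun x => ?_)
    · have hc : Continuous fun s : ℝ => s ^ 2 / (1 + (d k * s) ^ 2) := by
        refine Continuous.div (by fun_prop) (by fun_prop) fun s => ?_
        positivity
      exact hc.comp_aestronglyMeasurable hv.isH1.memLp.1
    · rw [Real.norm_of_nonneg (by positivity)]
      exact div_le_self (sq_nonneg _) (by nlinarith [sq_nonneg (d k * v x)])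
    · have h1 : Tendsto (fun k => (d k * v x) ^ 2) atTop (𝓝 0) := by
        have := (hdlim.mul_const (v x)).pow 2
        simpa using this
      have h2 := (tendsto_const_nhds (x := v x ^ 2)).div (h1.const_add 1) (by norm_num)
      rw [add_zero, div_one] at h2
      exact h2
  have h1 : ∫ x in Ω, v x ^ 2 ≤ ∫ x in Ω, 2 * R * (|v x| * ‖Dv x‖) :=
    le_of_tendsto' hlim fun k => main _ (hd0 k)
  have h2 : ∫ x in Ω, 2 * R * (|v x| * ‖Dv x‖) ≤
      ∫ x in Ω, (1 / 2 * v x ^ 2 + 2 * R ^ 2 * ‖Dv x‖ ^ 2) := by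
    refine integral_mono (hvD.const_mul _) ((hv2.const_mul _).add (hD2.const_mul _)) fun x => ?_
    dsimp only
    nlinarith [sq_nonneg (|v x| - 2 * R * ‖Dv x‖), sq_abs (v x)]
  rw [integral_add (hv2.const_mul _) (hD2.const_mul _), integral_const_mul (1 / 2),
    integral_const_mul (2 * R ^ 2)] at h2
  linarith

/-- A strongly monotone Lipschitz map of a Hilbert space has a zero (Zarantonello). -/
theorem exists_zero_of_strongly_monotone {V : Type*} [NormedAddCommGroup V]
    [InnerProductSpace ℝ V] [CompleteSpace V] {F : V → V} {m L : ℝ} (hm : 0 < m)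
    (hL : ∀ x y, ‖F x - F y‖ ≤ L * ‖x - y‖)
    (hF : ∀ x y, m * ‖x - y‖ ^ 2 ≤ inner ℝ (F x - F y) (x - y)) : ∃ x, F x = 0 := by
  set L' : ℝ := |L| + m with hL'
  have hL'0 : 0 < L' := by positivity
  have hLL' : L ≤ L' := (le_abs_self L).trans (by linarith)
  have hmL : m ≤ L' := by linarith [abs_nonneg L]
  set t : ℝ := m / L' ^ 2 with ht
  have ht0 : 0 < t := by positivity
  set q : ℝ := 1 - m ^ 2 / L' ^ 2 with hq
  have hq0 : 0 ≤ q := by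
    rw [hq, sub_nonneg, div_le_one (by positivity)]
    gcongr
  have hq1 : q < 1 := by
    rw [hq]
    have : 0 < m ^ 2 / L' ^ 2 := by positivity
    linarith
  have hcontr : ContractingWith (Real.toNNReal (Real.sqrt q)) fun x => x - t • F x := by
    refine ⟨?_, LipschitzWith.of_dist_le_mul fun x y => ?_⟩
    · rw [← NNReal.coe_lt_coe, Real.coe_toNNReal _ (Real.sqrt_nonneg _), NNReal.coe_one]
      rw [Real.sqrt_lt' one_pos]
      simpa using hq1
    · rw [Real.coe_toNNReal _ (Real.sqrt_nonneg _), dist_eq_norm, dist_eq_norm]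
      refine le_of_sq_le_sq ?_ (by positivity)
      rw [mul_pow, Real.sq_sqrt hq0]
      have e1 : x - t • F x - (y - t • F y) = (x - y) - t • (F x - F y) := by
        rw [smul_sub]
        abel
      rw [e1, norm_sub_sq_real, inner_smul_right, norm_smul, mul_pow, Real.norm_of_nonneg ht0.le,
        real_inner_comm]
      have h1 := hF x y
      have h2 : ‖F x - F y‖ ^ 2 ≤ L' ^ 2 * ‖x - y‖ ^ 2 := by
        rw [← mul_pow]
        have := hL x y
        gcongr
        exact this.trans (by gcongr)
      have h3 : t ^ 2 * ‖F x - F y‖ ^ 2 ≤ t ^ 2 * (L' ^ 2 * ‖x - y‖ ^ 2) := by gcongr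
      have h4 : t * (m * ‖x - y‖ ^ 2) ≤ t * inner ℝ (F x - F y) (x - y) := by gcongr
      have h5 : t ^ 2 * (L' ^ 2 * ‖x - y‖ ^ 2) = m ^ 2 / L' ^ 2 * ‖x - y‖ ^ 2 := by
        rw [ht]
        field_simp
      have h6 : t * (m * ‖x - y‖ ^ 2) = m ^ 2 / L' ^ 2 * ‖x - y‖ ^ 2 := by
        rw [ht]
        field_simp
      rw [hq]
      nlinarith
  obtain ⟨x, hx⟩ : ∃ x, x - t • F x = x := ⟨_, hcontr.fixedPoint_isFixedPt⟩
  exact ⟨x, (smul_eq_zero.1 (sub_eq_self.1 hx)).resolve_left ht0.ne'⟩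

/-! ### A semilinear Dirichlet problem -/

/-- The Hilbert space `L²(Ω) × L²(Ω; ℝⁿ)`. -/
abbrev L2Pair (Ω : Set (Rn n)) : Type :=
  WithLp 2 (Lp ℝ 2 (volume.restrict Ω) × Lp (Rn n) 2 (volume.restrict Ω))

/-- The pair of classes of a function and a vector field. -/
def toL2Pair {u : Rn n → ℝ} {U : Rn n → Rn n} (hu : MemLp u 2 (volume.restrict Ω))
    (hU : MemLp U 2 (volume.restrict Ω)) : L2Pair Ω :=
  WithLp.toLp 2 (hu.toLp u, hU.toLp U)

theorem inner_toL2Pair {u : Rn n → ℝ} {U : Rn n → Rn n} (hu : MemLp u 2 (volume.restrict Ω))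
    (hU : MemLp U 2 (volume.restrict Ω)) (p : L2Pair Ω) :
    inner ℝ (toL2Pair hu hU) p =
      (∫ x in Ω, u x * p.fst x) + ∫ x in Ω, inner ℝ (U x) (p.snd x) := by
  rw [WithLp.prod_inner_apply, L2.inner_def, L2.inner_def]
  congr 1
  · refine integral_congr_ae ?_
    filter_upwards [hu.coeFn_toLp] with x hx
    simp [toL2Pair, hx, mul_comm]
  · refine integral_congr_ae ?_
    filter_upwards [hU.coeFn_toLp] with x hx
    simp [toL2Pair, hx]

theorem memLp_testFunction {φ : Rn n → ℝ} (hφ : ContDiff ℝ (⊤ : ℕ∞) φ) (hφc : HasCompactSupport φ)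
    (w : Rn n) : MemLp (fun x => fderiv ℝ φ x w) 2 (volume.restrict Ω) ∧
      MemLp (fun x => φ x • w) 2 (volume.restrict Ω) := by
  have hdc : Continuous (fun x => fderiv ℝ φ x w) :=
    (hφ.continuous_fderiv (by simp)).clm_apply continuous_const
  exact ⟨hdc.memLp_of_hasCompactSupport (hφc.fderiv_apply (𝕜 := ℝ) w),
    (hφ.continuous.smul continuous_const).memLp_of_hasCompactSupport hφc.smul_right⟩

/-- The elements of `L2Pair Ω` to which the pairs `(v, ∇v)` with `v ∈ H₀¹(Ω)` are orthogonal. -/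
def h10Constraints (Ω : Set (Rn n)) : Set (L2Pair Ω) :=
  {q | ∃ (φ : Rn n → ℝ) (hφ : ContDiff ℝ (⊤ : ℕ∞) φ) (hφc : HasCompactSupport φ) (w : Rn n),
    q = toL2Pair (memLp_testFunction hφ hφc w).1 (memLp_testFunction hφ hφc w).2}

/-- `H₀¹(Ω)` as a closed subspace of `L²(Ω) × L²(Ω; ℝⁿ)`, through `v ↦ (v, ∇v)`. -/
def h10Submodule (Ω : Set (Rn n)) : Submodule ℝ (L2Pair Ω) :=
  (Submodule.span ℝ (h10Constraints Ω))ᗮ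

theorem mem_h10Submodule_iff {p : L2Pair Ω} :
    p ∈ h10Submodule Ω ↔ ∀ φ : Rn n → ℝ, ContDiff ℝ (⊤ : ℕ∞) φ → HasCompactSupport φ →
      ∀ w : Rn n, ∫ x in Ω, p.fst x * fderiv ℝ φ x w = - ∫ x in Ω, inner ℝ (p.snd x) w * φ x := by
  have key : ∀ (φ : Rn n → ℝ) (hφ : ContDiff ℝ (⊤ : ℕ∞) φ) (hφc : HasCompactSupport φ) (w : Rn n),
      inner ℝ (toL2Pair (memLp_testFunction hφ hφc w).1 (memLp_testFunction hφ hφc w).2) p =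
      (∫ x in Ω, p.fst x * fderiv ℝ φ x w) + ∫ x in Ω, inner ℝ (p.snd x) w * φ x := by
    intro φ hφ hφc w
    rw [inner_toL2Pair]
    congr 1
    · simp only [mul_comm]
    · simp only [inner_smul_left, RCLike.conj_to_real, real_inner_comm, mul_comm]
  rw [h10Submodule, Submodule.mem_orthogonal]
  constructor
  · intro h φ hφ hφc w
    have h1 := h _ (Submodule.subset_span ⟨φ, hφ, hφc, w, rfl⟩)
    rw [key φ hφ hφc w] at h1
    linarith
  · intro h q hq
    induction hq using Submodule.span_induction with
    | mem q hq =>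
      obtain ⟨φ, hφ, hφc, w, rfl⟩ := hq
      rw [key φ hφ hφc w, h φ hφ hφc w]
      ring
    | zero => simp
    | add a b _ _ ha hb => rw [inner_add_left, ha, hb, add_zero]
    | smul t a _ ha => rw [inner_smul_left, ha, mul_zero]

theorem isH10_of_mem {p : L2Pair Ω} (hp : p ∈ h10Submodule Ω) : IsH10 Ω p.fst p.snd := by
  rw [mem_h10Submodule_iff] at hp
  exact ⟨⟨Lp.memLp _, Lp.memLp _, fun φ hφ w => hp φ hφ.1 hφ.2.1 w⟩, hp⟩

theorem IsH10.toL2Pair_mem {v : Rn n → ℝ} {Dv : Rn n → Rn n} (hv : IsH10 Ω v Dv) :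
    toL2Pair hv.isH1.memLp hv.isH1.memLp_grad ∈ h10Submodule Ω := by
  rw [mem_h10Submodule_iff]
  intro φ hφ hφc w
  have e1 : ∫ x in Ω, (hv.isH1.memLp.toLp v) x * fderiv ℝ φ x w =
      ∫ x in Ω, v x * fderiv ℝ φ x w := by
    refine integral_congr_ae ?_
    filter_upwards [hv.isH1.memLp.coeFn_toLp] with x hx
    rw [hx]
  have e2 : ∫ x in Ω, inner ℝ ((hv.isH1.memLp_grad.toLp Dv) x) w * φ x =
      ∫ x in Ω, inner ℝ (Dv x) w * φ x := by
    refine integral_congr_ae ?_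
    filter_upwards [hv.isH1.memLp_grad.coeFn_toLp] with x hx
    rw [hx]
  have h := hv.weak_grad φ hφ hφc w
  rw [← e1, ← e2] at h
  exact h

theorem memLp_bdd_mul {c u : Rn n → ℝ} (hc : AEStronglyMeasurable c (volume.restrict Ω)) {C : ℝ}
    (hcC : ∀ᵐ x ∂(volume.restrict Ω), 0 ≤ c x ∧ c x ≤ C) (hu : MemLp u 2 (volume.restrict Ω)) :
    MemLp (fun x => c x * u x) 2 (volume.restrict Ω) := by
  refine (hu.const_mul C).mono (hc.mul hu.1) ?_
  filter_upwards [hcC] with x hx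
  rw [norm_mul, norm_mul, Real.norm_of_nonneg hx.1, Real.norm_of_nonneg (hx.1.trans hx.2)]
  gcongr
  exact hx.2

theorem integrable_inner_of_memLp {μ : Measure (Rn n)} {U W : Rn n → Rn n} (hU : MemLp U 2 μ)
    (hW : MemLp W 2 μ) : Integrable (fun x => (inner ℝ (U x) (W x) : ℝ)) μ :=
  (hU.norm.integrable_mul hW.norm).mono' (hU.1.inner hW.1)
    (Eventually.of_forall fun _ => norm_inner_le_norm _ _)

theorem toL2Pair_sub {f g : Rn n → ℝ} {U W : Rn n → Rn n} (hf : MemLp f 2 (volume.restrict Ω))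
    (hg : MemLp g 2 (volume.restrict Ω)) (hU : MemLp U 2 (volume.restrict Ω))
    (hW : MemLp W 2 (volume.restrict Ω)) :
    toL2Pair hf hU - toL2Pair hg hW = toL2Pair (hf.sub hg) (hU.sub hW) := rfl

theorem norm_toL2Pair_sub_le {f g : Rn n → ℝ} {U W : Rn n → Rn n}
    (hf : MemLp f 2 (volume.restrict Ω)) (hg : MemLp g 2 (volume.restrict Ω))
    (hU : MemLp U 2 (volume.restrict Ω)) (hW : MemLp W 2 (volume.restrict Ω)) {p q : L2Pair Ω}
    {L : ℝ} (hL : 0 ≤ L)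
    (hfg : ∀ᵐ x ∂(volume.restrict Ω), |f x - g x| ≤ L * |p.fst x - q.fst x|)
    (hUW : ∀ᵐ x ∂(volume.restrict Ω), U x - W x = p.snd x - q.snd x) :
    ‖toL2Pair hf hU - toL2Pair hg hW‖ ≤ (L + 1) * ‖p - q‖ := by
  rw [toL2Pair_sub]
  have h1 : ‖(hf.sub hg).toLp‖ ≤ L * ‖p.fst - q.fst‖ := by
    refine Lp.norm_le_mul_norm_of_ae_le_mul ?_
    filter_upwards [(hf.sub hg).coeFn_toLp, Lp.coeFn_sub p.fst q.fst, hfg] with x h1 h2 h3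
    rw [h1, h2]
    exact h3
  have h2 : (hU.sub hW).toLp = p.snd - q.snd := by
    refine Lp.ext ?_
    filter_upwards [(hU.sub hW).coeFn_toLp, Lp.coeFn_sub p.snd q.snd, hUW] with x h1 h2 h3
    rw [h1, h2]
    exact h3
  have h3 : ‖toL2Pair (hf.sub hg) (hU.sub hW)‖ ^ 2 =
      ‖(hf.sub hg).toLp‖ ^ 2 + ‖(hU.sub hW).toLp‖ ^ 2 := WithLp.prod_norm_sq_eq_of_L2 _
  have h4 : ‖p - q‖ ^ 2 = ‖p.fst - q.fst‖ ^ 2 + ‖p.snd - q.snd‖ ^ 2 :=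
    WithLp.prod_norm_sq_eq_of_L2 _
  refine le_of_sq_le_sq ?_ (by positivity)
  rw [mul_pow, h3, h4, h2]
  have h5 : ‖(hf.sub hg).toLp‖ ^ 2 ≤ L ^ 2 * ‖p.fst - q.fst‖ ^ 2 := by
    rw [← mul_pow]
    gcongr
  nlinarith [sq_nonneg ‖p.fst - q.fst‖, sq_nonneg ‖p.snd - q.snd‖,
    mul_nonneg hL (sq_nonneg ‖p.fst - q.fst‖), mul_nonneg hL (sq_nonneg ‖p.snd - q.snd‖),
    mul_nonneg (mul_nonneg hL hL) (sq_nonneg ‖p.snd - q.snd‖)]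

theorem strongly_monotone_toL2Pair_sub (hΩ : IsOpen Ω) (hb : Bornology.IsBounded Ω) (i : Fin n)
    {R : ℝ} (hR : Ω ⊆ Metric.ball 0 R) {f g : Rn n → ℝ} {U W : Rn n → Rn n}
    (hf : MemLp f 2 (volume.restrict Ω)) (hg : MemLp g 2 (volume.restrict Ω))
    (hU : MemLp U 2 (volume.restrict Ω)) (hW : MemLp W 2 (volume.restrict Ω)) {p q : L2Pair Ω}
    (hpq : p - q ∈ h10Submodule Ω)
    (hfg : ∀ᵐ x ∂(volume.restrict Ω), 0 ≤ (f x - g x) * (p.fst x - q.fst x))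
    (hUW : ∀ᵐ x ∂(volume.restrict Ω), U x - W x = p.snd x - q.snd x) :
    1 / (1 + 4 * R ^ 2) * ‖p - q‖ ^ 2 ≤
      inner ℝ (toL2Pair hf hU - toL2Pair hg hW) (p - q) := by
  rw [toL2Pair_sub, inner_toL2Pair]
  have e1 : (p - q).fst =ᵐ[volume.restrict Ω] fun x => p.fst x - q.fst x :=
    Lp.coeFn_sub p.fst q.fst
  have e2 : (p - q).snd =ᵐ[volume.restrict Ω] fun x => p.snd x - q.snd x :=
    Lp.coeFn_sub p.snd q.snd
  have hpo := (isH10_of_mem hpq).poincare hΩ hb i hR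
  have e3 : ∫ t in Ω, (p - q).fst t ^ 2 = ‖(p - q).fst‖ ^ 2 := by
    rw [← real_inner_self_eq_norm_sq, L2.inner_def]
    simp [sq]
  have e4 : ∫ t in Ω, ‖(p - q).snd t‖ ^ 2 = ‖(p - q).snd‖ ^ 2 := by
    rw [← real_inner_self_eq_norm_sq, L2.inner_def]
    simp only [real_inner_self_eq_norm_sq]
  have e5 : ‖p - q‖ ^ 2 = ‖(p - q).fst‖ ^ 2 + ‖(p - q).snd‖ ^ 2 :=
    WithLp.prod_norm_sq_eq_of_L2 _
  have h1 : 0 ≤ ∫ x in Ω, (f - g) x * (p - q).fst x := by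
    refine integral_nonneg_of_ae ?_
    filter_upwards [e1, hfg] with x h1 h2
    rw [h1]
    exact h2
  have h2 : ∫ x in Ω, inner ℝ ((U - W) x) ((p - q).snd x) = ‖(p - q).snd‖ ^ 2 := by
    rw [← e4]
    refine integral_congr_ae ?_
    filter_upwards [e2, hUW] with x h1 h2
    rw [Pi.sub_apply, h2, ← h1, real_inner_self_eq_norm_sq]
  rw [e3, e4] at hpo
  rw [h2, e5, one_div, inv_mul_le_iff₀ (by positivity)]
  nlinarith [sq_nonneg R, mul_nonneg (sq_nonneg R) h1]

/-- Solvability of the semilinear Dirichlet problem `-Δw + c b(w) = 0`, `w - w₀ ∈ H₀¹(Ω)`, for a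
nondecreasing Lipschitz function `b`. -/
theorem exists_semilinear (hΩ : IsOpen Ω) (hb : Bornology.IsBounded Ω) (hn : 0 < n)
    {w₀ : Rn n → ℝ} {Dw₀ : Rn n → Rn n} (hw₀ : IsH1 Ω w₀ Dw₀) {c : Rn n → ℝ}
    (hc : AEStronglyMeasurable c (volume.restrict Ω)) {C : ℝ} (hC : 0 ≤ C)
    (hcC : ∀ᵐ x ∂(volume.restrict Ω), 0 ≤ c x ∧ c x ≤ C) {b : ℝ → ℝ} {K : ℝ} (hK : 0 ≤ K)
    (hbK : ∀ s t, |b s - b t| ≤ K * |s - t|) (hbm : Monotone b) :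
    ∃ z Dz, IsH10 Ω z Dz ∧ ∀ v Dv, IsH10 Ω v Dv →
      ∫ x in Ω, (inner ℝ (Dw₀ x + Dz x) (Dv x) + c x * b (w₀ x + z x) * v x) = 0 := by
  obtain ⟨R, hR0, hR⟩ := hb.subset_ball_lt 0 0
  have hcomplete : CompleteSpace (h10Submodule Ω) :=
    (Submodule.isClosed_orthogonal _).completeSpace_coe
  have hN1 : ∀ p : L2Pair Ω, MemLp (fun x => c x * b (w₀ x + p.fst x)) 2 (volume.restrict Ω) :=
    fun p => memLp_bdd_mul hc hcC (memLp_comp_lipschitz hb (hw₀.memLp.add (Lp.memLp p.fst)) hbK)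
  have hN2 : ∀ p : L2Pair Ω, MemLp (fun x => Dw₀ x + p.snd x) 2 (volume.restrict Ω) :=
    fun p => hw₀.memLp_grad.add (Lp.memLp p.snd)
  -- the weak form of the equation says that the projection of this map to `H₀¹` vanishes
  set F : h10Submodule Ω → h10Submodule Ω := fun z =>
    (h10Submodule Ω).orthogonalProjectionOnto
      (toL2Pair (hN1 (z : L2Pair Ω)) (hN2 (z : L2Pair Ω))) with hF
  have hUW : ∀ p q : L2Pair Ω, ∀ᵐ x ∂(volume.restrict Ω),
      (Dw₀ x + p.snd x) - (Dw₀ x + q.snd x) = p.snd x - q.snd x := fun p q =>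
    Eventually.of_forall fun x => add_sub_add_left_eq_sub _ _ _
  obtain ⟨z, hz⟩ : ∃ z, F z = 0 := by
    refine exists_zero_of_strongly_monotone (m := 1 / (1 + 4 * R ^ 2)) (L := C * K + 1)
      (by positivity) (fun x y => ?_) (fun x y => ?_)
    · rw [hF, ← map_sub]
      refine ((h10Submodule Ω).norm_orthogonalProjectionOnto_apply_le _).trans ?_
      refine norm_toL2Pair_sub_le _ _ _ _ (by positivity) ?_ (hUW _ _)
      filter_upwards [hcC] with t ht
      rw [← mul_sub, abs_mul, abs_of_nonneg ht.1, mul_assoc]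
      refine mul_le_mul ht.2 ?_ (abs_nonneg _) hC
      have := hbK (w₀ t + (x : L2Pair Ω).fst t) (w₀ t + (y : L2Pair Ω).fst t)
      rwa [add_sub_add_left_eq_sub] at this
    · rw [hF, ← map_sub, Submodule.inner_orthogonalProjectionOnto_eq_of_mem_right]
      refine strongly_monotone_toL2Pair_sub hΩ hb ⟨0, hn⟩ hR _ _ _ _ (x - y).2 ?_ (hUW _ _)
      filter_upwards [hcC] with t ht
      rw [← mul_sub, mul_assoc]
      refine mul_nonneg ht.1 ?_
      rcases le_total ((x : L2Pair Ω).fst t) ((y : L2Pair Ω).fst t) with hle | hle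
      · exact mul_nonneg_of_nonpos_of_nonpos (sub_nonpos.2 (hbm (by linarith)))
          (sub_nonpos.2 hle)
      · exact mul_nonneg (sub_nonneg.2 (hbm (by linarith))) (sub_nonneg.2 hle)
  refine ⟨(z : L2Pair Ω).fst, (z : L2Pair Ω).snd, isH10_of_mem z.2, fun v Dv hv => ?_⟩
  have h1 := Submodule.inner_orthogonalProjectionOnto_eq_of_mem_right
    (⟨_, hv.toL2Pair_mem⟩ : h10Submodule Ω) (toL2Pair (hN1 (z : L2Pair Ω)) (hN2 (z : L2Pair Ω)))
  have h2 : (h10Submodule Ω).orthogonalProjectionOnto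
    (toL2Pair (hN1 (z : L2Pair Ω)) (hN2 (z : L2Pair Ω))) = 0 := hz
  rw [h2, inner_zero_left, inner_toL2Pair] at h1
  have i1 : IntegrableOn (fun x => (inner ℝ (Dw₀ x + (z : L2Pair Ω).snd x) (Dv x) : ℝ)) Ω :=
    integrable_inner_of_memLp (hN2 z) hv.isH1.memLp_grad
  have i2 : IntegrableOn (fun x => c x * b (w₀ x + (z : L2Pair Ω).fst x) * v x) Ω :=
    (hN1 z).integrable_mul hv.isH1.memLp
  rw [integral_add i1 i2, add_comm, h1]
  congr 1
  · refine integral_congr_ae ?_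
    filter_upwards [hv.isH1.memLp.coeFn_toLp] with x hx
    have : (toL2Pair hv.isH1.memLp hv.isH1.memLp_grad).fst x = v x := hx
    rw [this]
  · refine integral_congr_ae ?_
    filter_upwards [hv.isH1.memLp_grad.coeFn_toLp] with x hx
    have : (toL2Pair hv.isH1.memLp hv.isH1.memLp_grad).snd x = Dv x := hx
    rw [this]

/-! ### Smooth functions and their traces -/

/-- The trace of a continuous function is its restriction to the boundary. -/
theorem isTrace_of_continuous {F : Rn n → ℝ} (hF : Continuous F) : IsTrace Ω F F := by
  refine Eventually.of_forall fun x => ?_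
  rw [Metric.tendsto_nhds]
  intro ε hε
  obtain ⟨δ, hδ, hδF⟩ := Metric.continuous_iff.1 hF x (ε / 2) (by positivity)
  filter_upwards [Ioo_mem_nhdsGT hδ] with r hr
  have hfin : volume (Ω ∩ Metric.ball x r) < ∞ :=
    (Metric.isBounded_ball.subset inter_subset_right).measure_lt_top
  have h1 := norm_setIntegral_le_of_norm_le_const (f := fun y => |F y - F x|) (C := ε / 2) hfin
    (fun y hy => by
      rw [Real.norm_eq_abs, abs_abs, ← Real.dist_eq]
      exact (hδF y ((Metric.mem_ball.1 hy.2).trans hr.2)).le)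
  rw [dist_zero_right, setAverage_eq, norm_smul, norm_inv,
    Real.norm_of_nonneg measureReal_nonneg]
  rcases eq_or_lt_of_le (measureReal_nonneg (μ := volume) (s := Ω ∩ Metric.ball x r)) with h0 | h0
  · rw [← h0, inv_zero, zero_mul]
    exact hε
  · rw [inv_mul_lt_iff₀ h0]
    refine h1.trans_lt ?_
    rw [mul_comm]
    gcongr
    linarith

theorem memLp_of_continuous (hb : Bornology.IsBounded Ω) (hΩ : IsOpen Ω) {E : Type*}
    [NormedAddCommGroup E] [SecondCountableTopology E] {f : Rn n → E} (hf : Continuous f) :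
    MemLp f 2 (volume.restrict Ω) := by
  have := isFiniteMeasure_restrict hb
  obtain ⟨B, hB⟩ := hb.isCompact_closure.exists_bound_of_continuousOn hf.continuousOn
  exact MemLp.of_bound hf.aestronglyMeasurable B
    (ae_restrict_of_forall_mem hΩ.measurableSet fun x hx => hB x (subset_closure hx))

theorem inner_gradient (φ : Rn n → ℝ) (x w : Rn n) : inner ℝ (gradient φ x) w = fderiv ℝ φ x w :=
  InnerProductSpace.toDual_symm_apply

theorem continuous_gradient {φ : Rn n → ℝ} (hφ : ContDiff ℝ (⊤ : ℕ∞) φ) :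
    Continuous (gradient φ) :=
  (InnerProductSpace.toDual ℝ (Rn n)).symm.continuous.comp (hφ.continuous_fderiv (by simp))

theorem integral_mul_fderiv_of_hasCompactSupport {φ ψ : Rn n → ℝ} (hφ : ContDiff ℝ (⊤ : ℕ∞) φ)
    (hψ : ContDiff ℝ (⊤ : ℕ∞) ψ) (hψc : HasCompactSupport ψ) (w : Rn n) :
    ∫ x, φ x * fderiv ℝ ψ x w = - ∫ x, inner ℝ (gradient φ x) w * ψ x := by
  have hdφ : Continuous (fun x => fderiv ℝ φ x w) :=
    (hφ.continuous_fderiv (by simp)).clm_apply continuous_const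
  have hdψ : Continuous (fun x => fderiv ℝ ψ x w) :=
    (hψ.continuous_fderiv (by simp)).clm_apply continuous_const
  simp only [inner_gradient]
  exact integral_mul_fderiv_eq_neg_fderiv_mul_of_integrable
    ((hdφ.mul hψ.continuous).integrable_of_hasCompactSupport hψc.mul_left)
    ((hφ.continuous.mul hdψ).integrable_of_hasCompactSupport
      (hψc.fderiv_apply (𝕜 := ℝ) w).mul_left)
    ((hφ.continuous.mul hψ.continuous).integrable_of_hasCompactSupport hψc.mul_left)
    (fun x _ => (hφ.differentiable (by simp)).differentiableAt)
    (fun x _ => (hψ.differentiable (by simp)).differentiableAt)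

theorem isH1_of_contDiff (hΩ : IsOpen Ω) (hb : Bornology.IsBounded Ω) {φ : Rn n → ℝ}
    (hφ : ContDiff ℝ (⊤ : ℕ∞) φ) : IsH1 Ω φ (gradient φ) := by
  refine ⟨memLp_of_continuous hb hΩ hφ.continuous,
    memLp_of_continuous hb hΩ (continuous_gradient hφ), fun ψ hψ w => ?_⟩
  have h := integral_mul_fderiv_of_hasCompactSupport hφ hψ.1 hψ.2.1 w
  rw [setIntegral_eq_integral_of_forall_compl_eq_zero fun x hx => ?_,
    setIntegral_eq_integral_of_forall_compl_eq_zero fun x hx => ?_, h]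
  · rw [image_eq_zero_of_notMem_tsupport fun hx' => hx (hψ.2.2 hx'), mul_zero]
  · rw [fderiv_of_notMem_tsupport ℝ fun hx' => hx (hψ.2.2 hx'), _root_.zero_apply, mul_zero]

theorem IsTestFunction.isH10 (hΩ : IsOpen Ω) (hb : Bornology.IsBounded Ω) {φ : Rn n → ℝ}
    (hφ : IsTestFunction Ω φ) : IsH10 Ω φ (gradient φ) := by
  refine ⟨isH1_of_contDiff hΩ hb hφ.1, fun ψ hψ hψc w => ?_⟩
  have h := integral_mul_fderiv_of_hasCompactSupport hφ.1 hψ hψc w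
  rw [setIntegral_eq_integral_of_forall_compl_eq_zero fun x hx => ?_,
    setIntegral_eq_integral_of_forall_compl_eq_zero fun x hx => ?_, h]
  · rw [inner_gradient, fderiv_of_notMem_tsupport ℝ fun hx' => hx (hφ.2.2 hx'),
      _root_.zero_apply, zero_mul]
  · rw [image_eq_zero_of_notMem_tsupport fun hx' => hx (hφ.2.2 hx'), zero_mul]

/-! ### The Kirchhoff transform and the Dirichlet problem -/

/-- The Kirchhoff transform `s ↦ ∫₀ˢ a`, for which `a(u)∇u = ∇(kirchhoff a (u))`. -/
def kirchhoff (a : ℝ → ℝ) (s : ℝ) : ℝ := ∫ t in (0 : ℝ)..s, a t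

theorem hasDerivAt_kirchhoff {a : ℝ → ℝ} (ha : Continuous a) (s : ℝ) :
    HasDerivAt (kirchhoff a) (a s) s :=
  intervalIntegral.integral_hasDerivAt_right (ha.intervalIntegrable _ _)
    ha.aestronglyMeasurable.stronglyMeasurableAtFilter ha.continuousAt

theorem exists_inverse_kirchhoff {a : ℝ → ℝ} (ha : Continuous a) {α : ℝ} (hα : 0 < α)
    (hαa : ∀ t, α ≤ a t) :
    ∃ b : ℝ → ℝ, Monotone b ∧ (∀ s, b (kirchhoff a s) = s) ∧
      ∀ s, HasDerivAt b (a (b s))⁻¹ s := by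
  set A := kirchhoff a with hA
  have hd : ∀ s, HasDerivAt A (a s) s := hasDerivAt_kirchhoff ha
  have hdiff : Differentiable ℝ A := fun s => (hd s).differentiableAt
  have hder : ∀ s, α ≤ deriv A s := fun s => by
    rw [(hd s).deriv]
    exact hαa s
  have hgrow := mul_sub_le_image_sub_of_le_deriv hdiff hder
  have hmono : StrictMono A := strictMono_of_deriv_pos fun s => hα.trans_le (hder s)
  have htop : Tendsto A atTop atTop := by
    have h1 : Tendsto (fun s => α * s + A 0) atTop atTop :=
      tendsto_atTop_add_const_right _ _ (tendsto_id.const_mul_atTop hα)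
    refine tendsto_atTop_mono' _ ?_ h1
    filter_upwards [eventually_ge_atTop 0] with s hs
    have := hgrow hs
    rw [sub_zero] at this
    linarith
  have hbot : Tendsto A atBot atBot := by
    have h1 : Tendsto (fun s => α * s + A 0) atBot atBot :=
      tendsto_atBot_add_const_right _ _ (tendsto_id.const_mul_atBot hα)
    refine tendsto_atBot_mono' _ ?_ h1
    filter_upwards [eventually_le_atBot 0] with s hs
    have := hgrow hs
    rw [zero_sub] at this
    linarith
  set e : ℝ ≃o ℝ := hmono.orderIsoOfSurjective A (hdiff.continuous.surjective htop hbot) with he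
  refine ⟨e.symm, e.symm.monotone, e.symm_apply_apply, fun s => ?_⟩
  exact HasDerivAt.of_local_left_inverse e.symm.continuous.continuousAt (hd _)
    (hα.trans_le (hαa _)).ne' (Eventually.of_forall e.apply_symm_apply)

/-- The Dirichlet problem for the quasilinear equation is solved through the substitution
`w = kirchhoff a (u)`, which turns it into a semilinear problem with monotone nonlinearity. -/
theorem exists_isH1_form_eq_zero (hΩ : IsPiecewiseC1Domain Ω) (hn : 2 ≤ n) {a : ℝ → ℝ}
    {c : Rn n → ℝ} (hac : Admissible Ω a c) {G : Rn n → ℝ} (hG : ContDiff ℝ (⊤ : ℕ∞) G) :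
    ∃ u Du, IsH1 Ω u Du ∧ IsTrace Ω u G ∧
      IsH1 Ω (fun x => kirchhoff a (u x)) (fun x => a (u x) • Du x) ∧
      ∀ v Dv, IsH10 Ω v Dv → form Ω a c u Du v Dv = 0 := by
  obtain ⟨ha, hc, α, hα, haα, hcα⟩ := hac
  have hopen := hΩ.isOpen
  have hb := hΩ.isBounded
  have habs : ∀ s, |a s| ≤ 1 / α := fun s => by
    rw [abs_of_pos (hα.trans_le (haα s).1)]
    exact (haα s).2
  obtain ⟨b, hbm, hbA, hbd⟩ := exists_inverse_kirchhoff ha hα fun t => (haα t).1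
  have hbc : Continuous b := continuous_iff_continuousAt.2 fun s => (hbd s).continuousAt
  have hpos : ∀ s, 0 < a s := fun s => hα.trans_le (haα s).1
  have hb' : ∀ s, |(a (b s))⁻¹| ≤ 1 / α := fun s => by
    rw [abs_of_pos (inv_pos.2 (hpos _)), one_div]
    exact inv_anti₀ hα (haα _).1
  have hbL := abs_sub_le_of_hasDerivAt hbd hb'
  have hw₀ := (isH1_of_contDiff hopen hb hG).comp hopen hb (hasDerivAt_kirchhoff ha) ha habs
  obtain ⟨z, Dz, hz, hzeq⟩ := exists_semilinear hopen hb (by omega) hw₀ hc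
    (by positivity : 0 ≤ 1 / α) hcα (by positivity) hbL hbm
  have hw := hw₀.add hz.isH1
  have htw := (((isTrace_of_continuous (Ω := Ω) hG.continuous).comp_lipschitz
    (isH1_of_contDiff hopen hb hG).memLp
    (abs_sub_le_of_hasDerivAt (hasDerivAt_kirchhoff ha) habs)).add hw₀.memLp hz.isH1.memLp
    (hz.isTrace_zero hΩ)).comp_lipschitz hw.memLp hbL
  have hu := hw.comp hopen hb hbd
    ((ha.comp hbc).inv₀ fun s => (hpos _).ne') hb'
  refine ⟨_, _, hu, ?_, hu.comp hopen hb (hasDerivAt_kirchhoff ha) ha habs, fun v Dv hv => ?_⟩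
  · simpa only [Pi.add_apply, Pi.zero_apply, add_zero, hbA] using htw
  · rw [← hzeq v Dv hv, form]
    refine integral_congr_ae (Eventually.of_forall fun x => ?_)
    simp only [Pi.add_apply, inner_smul_left, RCLike.conj_to_real]
    rw [mul_inv_cancel_left₀ (hpos _).ne']

/-! ### The conormal derivative -/

theorem inner_toL2Pair_toL2Pair {u v : Rn n → ℝ} {U V : Rn n → Rn n}
    (hu : MemLp u 2 (volume.restrict Ω)) (hU : MemLp U 2 (volume.restrict Ω))
    (hv : MemLp v 2 (volume.restrict Ω)) (hV : MemLp V 2 (volume.restrict Ω)) :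
    inner ℝ (toL2Pair hu hU) (toL2Pair hv hV) = ∫ x in Ω, (inner ℝ (U x) (V x) + u x * v x) := by
  have i1 : IntegrableOn (fun x => u x * v x) Ω := hu.integrable_mul hv
  rw [inner_toL2Pair, integral_add (integrable_inner_of_memLp hU hV) i1, add_comm]
  congr 1
  · refine integral_congr_ae ?_
    filter_upwards [hV.coeFn_toLp] with x hx
    have : (toL2Pair hv hV).snd x = V x := hx
    rw [this]
  · refine integral_congr_ae ?_
    filter_upwards [hv.coeFn_toLp] with x hx
    have : (toL2Pair hv hV).fst x = v x := hx
    rw [this]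

theorem norm_toL2Pair {v : Rn n → ℝ} {Dv : Rn n → Rn n} (hv : IsH1 Ω v Dv) :
    ‖toL2Pair hv.memLp hv.memLp_grad‖ = h1Norm Ω v Dv := by
  rw [norm_eq_sqrt_real_inner, inner_toL2Pair_toL2Pair, h1Norm]
  simp only [real_inner_self_eq_norm_sq, ← sq, add_comm]

theorem IsH1.form_eq_inner {u v : Rn n → ℝ} {Du Dv : Rn n → Rn n} (hv : IsH1 Ω v Dv) {a : ℝ → ℝ}
    {c : Rn n → ℝ} (hcu : MemLp (fun x => c x * u x) 2 (volume.restrict Ω))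
    (hau : MemLp (fun x => a (u x) • Du x) 2 (volume.restrict Ω)) :
    form Ω a c u Du v Dv = inner ℝ (toL2Pair hcu hau) (toL2Pair hv.memLp hv.memLp_grad) := by
  rw [inner_toL2Pair_toL2Pair, form]
  simp only [inner_smul_left, RCLike.conj_to_real]

/-- The functional `v|_∂Ω ↦ form (u, v)` is well defined and bounded when `u` is a weak solution
in the sense that the form vanishes on `H₀¹(Ω)`. -/
theorem exists_conormalDerivative (hΩ : IsPiecewiseC1Domain Ω) (hn : 2 ≤ n) {a : ℝ → ℝ}
    {c u : Rn n → ℝ} {Du : Rn n → Rn n}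
    (hcu : MemLp (fun x => c x * u x) 2 (volume.restrict Ω))
    (hau : MemLp (fun x => a (u x) • Du x) 2 (volume.restrict Ω))
    (hform : ∀ v Dv, IsH10 Ω v Dv → form Ω a c u Du v Dv = 0) :
    ∃ ψ : HNegHalf Ω, IsConormalDerivative Ω a c u Du ψ := by
  choose v Dv hv htr using fun h : HHalf Ω => h.2
  set P := toL2Pair hcu hau with hP
  have key : ∀ (h : HHalf Ω) w Dw, IsH1 Ω w Dw →
      IsTrace Ω w (h : Rn n →ₘ[surfaceMeasure Ω] ℝ) →
      form Ω a c u Du w Dw = form Ω a c u Du (v h) (Dv h) := by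
    intro h w Dw hw hwt
    have hd := hw.add ((hv h).smul (-1))
    have ht : IsTrace Ω (w + (-1 : ℝ) • v h) 0 :=
      (hwt.add hw.memLp ((hv h).smul (-1)).memLp ((htr h).smul (-1))).congr
        (Eventually.of_forall fun x => by simp)
    have h0 := hform _ _ (hd.isH10 hΩ hn ht)
    rw [hd.form_eq_inner hcu hau] at h0
    have e : toL2Pair hd.memLp hd.memLp_grad = toL2Pair hw.memLp hw.memLp_grad +
        (-1 : ℝ) • toL2Pair (hv h).memLp (hv h).memLp_grad := rfl
    rw [e, inner_add_right, inner_smul_right] at h0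
    rw [hw.form_eq_inner hcu hau, (hv h).form_eq_inner hcu hau]
    linarith
  let ψ : HHalf Ω →ₗ[ℝ] ℝ :=
    { toFun := fun h => form Ω a c u Du (v h) (Dv h)
      map_add' := fun h k => by
        have hd := (hv h).add (hv k)
        have e : toL2Pair hd.memLp hd.memLp_grad = toL2Pair (hv h).memLp (hv h).memLp_grad +
            toL2Pair (hv k).memLp (hv k).memLp_grad := rfl
        rw [← key (h + k) _ _ hd (((htr h).add (hv h).memLp (hv k).memLp (htr k)).congr
          (AEEqFun.coeFn_add _ _)), hd.form_eq_inner hcu hau, e, inner_add_right,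
          (hv h).form_eq_inner hcu hau, (hv k).form_eq_inner hcu hau]
      map_smul' := fun t h => by
        have hd := (hv h).smul t
        have e : toL2Pair hd.memLp hd.memLp_grad =
            t • toL2Pair (hv h).memLp (hv h).memLp_grad := rfl
        rw [← key (t • h) _ _ hd (((htr h).smul t).congr (AEEqFun.coeFn_smul _ _)),
          hd.form_eq_inner hcu hau, e, inner_smul_right, (hv h).form_eq_inner hcu hau]
        rfl }
  refine ⟨⟨ψ, ‖P‖ + 1, fun h => ?_⟩, fun w Dw hw h hwt => (key h w Dw hw hwt).symm⟩
  have hpos : 0 < ‖P‖ + 1 := by positivity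
  rw [mul_comm, ← div_le_iff₀ hpos, hHalfNorm]
  refine le_csInf ⟨_, v h, Dv h, hv h, htr h, rfl⟩ ?_
  rintro s ⟨w, Dw, hw, hwt, rfl⟩
  rw [div_le_iff₀ hpos]
  change |form Ω a c u Du (v h) (Dv h)| ≤ _
  rw [← key h w Dw hw hwt, hw.form_eq_inner hcu hau, ← norm_toL2Pair hw]
  refine (abs_real_inner_le_norm _ _).trans ?_
  rw [mul_comm]
  gcongr
  linarith

/-! ### The weak maximum principle -/

/-- The slope of `excess M`: it vanishes exactly on `[-M, M]`. -/
def excessSlope (M s : ℝ) : ℝ := min 1 (max (|s| - M) 0)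

/-- A `C¹` variant of the function `s ↦ (s - M)⁺ - (s + M)⁻`, with bounded derivative. -/
def excess (M s : ℝ) : ℝ := ∫ t in (0 : ℝ)..s, excessSlope M t

theorem continuous_excessSlope (M : ℝ) : Continuous (excessSlope M) := by
  unfold excessSlope
  fun_prop

theorem excessSlope_nonneg (M s : ℝ) : 0 ≤ excessSlope M s :=
  le_min zero_le_one (le_max_right _ _)

theorem excessSlope_pos {M s : ℝ} (h : M < |s|) : 0 < excessSlope M s :=
  lt_min one_pos (lt_max_of_lt_left (sub_pos.2 h))

theorem excessSlope_eq_zero {M s : ℝ} (h : |s| ≤ M) : excessSlope M s = 0 := by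
  rw [excessSlope, max_eq_right (sub_nonpos.2 h), min_eq_right zero_le_one]

theorem abs_excessSlope_le (M s : ℝ) : |excessSlope M s| ≤ 1 := by
  rw [abs_of_nonneg (excessSlope_nonneg M s)]
  exact min_le_left _ _

theorem hasDerivAt_excess (M s : ℝ) : HasDerivAt (excess M) (excessSlope M s) s :=
  hasDerivAt_kirchhoff (continuous_excessSlope M) s

theorem excess_neg (M s : ℝ) : excess M (-s) = - excess M s := by
  have h := intervalIntegral.integral_comp_neg (a := 0) (b := s) (excessSlope M)
  rw [neg_zero, intervalIntegral.integral_symm 0 (-s)] at h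
  rw [excess, excess, ← neg_eq_iff_eq_neg, ← h]
  simp only [excessSlope, abs_neg]

theorem excess_nonneg (M : ℝ) {s : ℝ} (hs : 0 ≤ s) : 0 ≤ excess M s :=
  intervalIntegral.integral_nonneg hs fun t _ => excessSlope_nonneg M t

theorem excess_pos {M s : ℝ} (hM : 0 ≤ M) (hs : M < s) : 0 < excess M s := by
  have hs0 : 0 < s := hM.trans_lt hs
  exact intervalIntegral.integral_pos hs0 (continuous_excessSlope M).continuousOn
    (fun t _ => excessSlope_nonneg M t)
    ⟨s, right_mem_Icc.2 hs0.le, excessSlope_pos (by rwa [abs_of_pos hs0])⟩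

theorem mul_excess_nonneg (M s : ℝ) : 0 ≤ s * excess M s := by
  rcases le_total 0 s with hs | hs
  · exact mul_nonneg hs (excess_nonneg M hs)
  · have := mul_nonneg (neg_nonneg.2 hs) (excess_nonneg M (neg_nonneg.2 hs))
    rwa [excess_neg, neg_mul_neg] at this

theorem excess_eq_zero_iff {M s : ℝ} (hM : 0 ≤ M) : excess M s = 0 ↔ |s| ≤ M := by
  constructor
  · intro h
    by_contra! hlt
    rcases le_total 0 s with hs | hs
    · rw [abs_of_nonneg hs] at hlt
      exact (excess_pos hM hlt).ne' h
    · rw [abs_of_nonpos hs] at hlt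
      have := excess_pos hM hlt
      rw [excess_neg, h, neg_zero] at this
      exact this.false
  · intro h
    rw [excess, intervalIntegral.integral_congr (g := fun _ => 0),
      intervalIntegral.integral_zero]
    intro t ht
    refine excessSlope_eq_zero (le_trans ?_ h)
    rcases le_total 0 s with hs | hs
    · rw [uIcc_of_le hs] at ht
      rw [abs_of_nonneg ht.1, abs_of_nonneg hs]
      exact ht.2
    · rw [uIcc_of_ge hs] at ht
      rw [abs_of_nonpos ht.2, abs_of_nonpos hs]
      exact neg_le_neg ht.1

/-- The weak maximum principle. -/
theorem ae_abs_le_of_form_eq_zero (hΩ : IsPiecewiseC1Domain Ω) (hn : 2 ≤ n) {a : ℝ → ℝ}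
    {c : Rn n → ℝ} (hac : Admissible Ω a c) {u g : Rn n → ℝ} {Du : Rn n → Rn n}
    (hu : IsH1 Ω u Du) (htr : IsTrace Ω u g) {M : ℝ} (hM : 0 ≤ M)
    (hg : ∀ᵐ x ∂(surfaceMeasure Ω), |g x| ≤ M)
    (hform : ∀ v Dv, IsH10 Ω v Dv → form Ω a c u Du v Dv = 0) :
    ∀ᵐ x ∂(volume.restrict Ω), |u x| ≤ M := by
  obtain ⟨ha, hc, α, hα, haα, hcα⟩ := hac
  have hopen := hΩ.isOpen
  have hb := hΩ.isBounded
  have habs : ∀ s, |a s| ≤ 1 / α := fun s => by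
    rw [abs_of_pos (hα.trans_le (haα s).1)]
    exact (haα s).2
  have hT1 := hu.comp hopen hb (hasDerivAt_excess M) (continuous_excessSlope M)
    (abs_excessSlope_le M)
  have hTtr := (htr.comp_lipschitz hu.memLp (abs_sub_le_of_hasDerivAt (hasDerivAt_excess M)
    (abs_excessSlope_le M))).congr (h := 0) (by
      filter_upwards [hg] with x hx
      exact ((excess_eq_zero_iff hM).2 hx).symm)
  have hT : IsH10 Ω (fun x => excess M (u x)) (fun x => excessSlope M (u x) • Du x) :=
    hT1.isH10 hΩ hn hTtr
  have h0 := hform _ _ hT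
  set f : Rn n → ℝ := fun x => a (u x) * inner ℝ (Du x) (excessSlope M (u x) • Du x) +
    c x * u x * excess M (u x) with hf
  have i1 : IntegrableOn (fun x => a (u x) * inner ℝ (Du x) (excessSlope M (u x) • Du x)) Ω := by
    have h := integrable_inner_of_memLp (memLp_comp_smul hu ha habs) hT1.memLp_grad
    simp only [inner_smul_left, RCLike.conj_to_real] at h
    exact h
  have i2 : IntegrableOn (fun x => c x * u x * excess M (u x)) Ω :=
    (memLp_bdd_mul hc hcα hu.memLp).integrable_mul hT1.memLp
  have e1 : ∀ x, a (u x) * inner ℝ (Du x) (excessSlope M (u x) • Du x) =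
      a (u x) * excessSlope M (u x) * ‖Du x‖ ^ 2 := fun x => by
    rw [inner_smul_right, real_inner_self_eq_norm_sq, mul_assoc]
  have ef : ∀ x, f x = a (u x) * excessSlope M (u x) * ‖Du x‖ ^ 2 +
      c x * u x * excess M (u x) := fun x => by rw [← e1]
  have n1 : ∀ x, 0 ≤ a (u x) * excessSlope M (u x) * ‖Du x‖ ^ 2 := fun x =>
    mul_nonneg (mul_nonneg (hα.le.trans (haα _).1) (excessSlope_nonneg _ _)) (sq_nonneg _)
  have n2 : ∀ᵐ x ∂(volume.restrict Ω), 0 ≤ c x * u x * excess M (u x) := by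
    filter_upwards [hcα] with x hx
    rw [mul_assoc]
    exact mul_nonneg hx.1 (mul_excess_nonneg _ _)
  have hf0 : 0 ≤ᵐ[volume.restrict Ω] f := by
    filter_upwards [n2] with x hx
    rw [ef]
    exact add_nonneg (n1 x) hx
  have hfz := (integral_eq_zero_iff_of_nonneg_ae hf0 (i1.add i2)).1 h0
  have hgrad : ∀ᵐ x ∂(volume.restrict Ω), ‖excessSlope M (u x) • Du x‖ ^ 2 = 0 := by
    filter_upwards [hfz, n2] with x hx hx2
    rw [ef, Pi.zero_apply] at hx
    have hz : a (u x) * excessSlope M (u x) * ‖Du x‖ ^ 2 = 0 := by linarith [n1 x]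
    rw [mul_assoc] at hz
    have hz' := (mul_eq_zero.1 hz).resolve_left (hα.trans_le (haα _).1).ne'
    rw [norm_smul, mul_pow, Real.norm_of_nonneg (excessSlope_nonneg _ _), sq (excessSlope M _),
      mul_assoc, hz', mul_zero]
  obtain ⟨R, -, hR⟩ := hb.subset_ball_lt 0 0
  have hpo := hT.poincare hopen hb ⟨0, by omega⟩ hR
  rw [integral_eq_zero_of_ae hgrad, mul_zero] at hpo
  have hsq := (integral_eq_zero_iff_of_nonneg (fun x => sq_nonneg (excess M (u x)))
    hT.isH1.memLp.integrable_sq).1 (le_antisymm hpo (integral_nonneg fun x => sq_nonneg _))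
  filter_upwards [hsq] with x hx
  exact (excess_eq_zero_iff hM).1 (pow_eq_zero_iff two_ne_zero |>.1 hx)

/-! ### The integral identity behind uniqueness -/

/-- The class in `H^{1/2}(∂Ω)` of the boundary values of a smooth function. -/
theorem exists_hHalf_of_contDiff (hΩ : IsOpen Ω) (hb : Bornology.IsBounded Ω) {G : Rn n → ℝ}
    (hG : ContDiff ℝ (⊤ : ℕ∞) G) :
    ∃ g : HHalf Ω, (g : Rn n →ₘ[surfaceMeasure Ω] ℝ) =ᵐ[surfaceMeasure Ω] G := by
  have hm : AEStronglyMeasurable G (surfaceMeasure Ω) := hG.continuous.aestronglyMeasurable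
  exact ⟨⟨AEEqFun.mk G hm, G, gradient G, isH1_of_contDiff hΩ hb hG,
    (isTrace_of_continuous hG.continuous).congr (AEEqFun.coeFn_mk G hm)⟩, AEEqFun.coeFn_mk G hm⟩

theorem ae_surfaceMeasure_of_frontier {p : Rn n → Prop} (hp : ∀ x ∈ frontier Ω, p x) :
    ∀ᵐ x ∂(surfaceMeasure Ω), p x :=
  ae_restrict_of_forall_mem isClosed_frontier.measurableSet hp

theorem Admissible.memLp {a : ℝ → ℝ} {c : Rn n → ℝ} (h : Admissible Ω a c) {u : Rn n → ℝ}
    {Du : Rn n → Rn n} (hu : IsH1 Ω u Du) :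
    MemLp (fun x => c x * u x) 2 (volume.restrict Ω) := by
  obtain ⟨-, hc, α, -, -, hcα⟩ := h
  exact memLp_bdd_mul hc hcα hu.memLp

theorem Admissible.exists_abs_le {a : ℝ → ℝ} {c : Rn n → ℝ} (h : Admissible Ω a c) :
    ∃ K, ∀ s, |a s| ≤ K := by
  obtain ⟨-, -, α, hα, haα, -⟩ := h
  refine ⟨1 / α, fun s => ?_⟩
  rw [abs_of_pos (hα.trans_le (haα s).1)]
  exact (haα s).2

/-- The effect of equal Dirichlet-to-Neumann maps: with Dirichlet data `g ∘ v` and the harmonic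
function `v` as test function, the difference of the two conormal identities no longer involves
the gradients of the solutions, since by the Kirchhoff transform these enter only through a
function which has the boundary values of a primitive of `a₁ - a₂` at `g ∘ v`. -/
theorem exists_integral_identity (hΩ : IsPiecewiseC1Domain Ω) (hn : 2 ≤ n) {a₁ a₂ : ℝ → ℝ}
    {c : Rn n → ℝ} (h₁ : Admissible Ω a₁ c) (h₂ : Admissible Ω a₂ c)
    (hΛ : dirichletToNeumann Ω a₁ c = dirichletToNeumann Ω a₂ c) {v : Rn n → ℝ}
    (hv : ContDiff ℝ (⊤ : ℕ∞) v)
    (hharm : ∀ Z DZ, IsH10 Ω Z DZ → ∫ x in Ω, inner ℝ (DZ x) (gradient v x) = 0)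
    {g g' : ℝ → ℝ} (hg : ContDiff ℝ (⊤ : ℕ∞) g) (hgd : ∀ s, HasDerivAt g (g' s) s) {K : ℝ}
    (hgK : ∀ s, |g' s| ≤ K) {M : ℝ} (hM : 0 ≤ M) (hgM : ∀ x ∈ frontier Ω, |g (v x)| ≤ M) :
    ∃ U : Rn n → ℝ, (∀ᵐ x ∂(volume.restrict Ω), |U x| ≤ 2 * M) ∧
      ∫ x in Ω, (a₁ (g (v x)) - a₂ (g (v x))) * g' (v x) * ‖gradient v x‖ ^ 2 =
        - ∫ x in Ω, c x * U x * v x := by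
  have hopen := hΩ.isOpen
  have hb := hΩ.isBounded
  have hG : ContDiff ℝ (⊤ : ℕ∞) fun x => g (v x) := hg.comp hv
  have hvH := isH1_of_contDiff hopen hb hv
  obtain ⟨K₁, hK₁⟩ := h₁.exists_abs_le
  obtain ⟨K₂, hK₂⟩ := h₂.exists_abs_le
  have ha₁ := h₁.1
  have ha₂ := h₂.1
  obtain ⟨u₁, Du₁, hu₁, ht₁, hw₁, hform₁⟩ := exists_isH1_form_eq_zero hΩ hn h₁ hG
  obtain ⟨γ, hγ⟩ := exists_hHalf_of_contDiff hopen hb hG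
  obtain ⟨γv, hγv⟩ := exists_hHalf_of_contDiff hopen hb hv
  have htv := (isTrace_of_continuous (Ω := Ω) hv.continuous).congr hγv
  obtain ⟨ψ, hψ⟩ := exists_conormalDerivative hΩ hn (h₁.memLp hu₁) hw₁.memLp_grad hform₁
  have hmem : (γ, ψ) ∈ dirichletToNeumann Ω a₁ c :=
    ⟨u₁, Du₁, ⟨hu₁, ht₁.congr hγ, fun φ hφ => hform₁ _ _ (hφ.isH10 hopen hb)⟩, hψ⟩
  rw [hΛ] at hmem
  obtain ⟨u₂, Du₂, ⟨hu₂, ht₂, -⟩, hψ₂⟩ := hmem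
  replace ht₂ : IsTrace Ω u₂ fun x => g (v x) := ht₂.congr hγ.symm
  have hform₂ : ∀ w Dw, IsH10 Ω w Dw → form Ω a₂ c u₂ Du₂ w Dw = 0 := fun w Dw hw => by
    have := hψ₂ w Dw hw.isH1 0 ((hw.isTrace_zero hΩ).congr AEEqFun.coeFn_zero)
    rw [← this, map_zero]
  have hw₂ := hu₂.comp hopen hb (hasDerivAt_kirchhoff ha₂) ha₂ hK₂
  have hL₁ := abs_sub_le_of_hasDerivAt (hasDerivAt_kirchhoff ha₁) hK₁
  have hL₂ := abs_sub_le_of_hasDerivAt (hasDerivAt_kirchhoff ha₂) hK₂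
  have hgae := ae_surfaceMeasure_of_frontier hgM
  have hM₁ := ae_abs_le_of_form_eq_zero hΩ hn h₁ hu₁ ht₁ hM hgae hform₁
  have hM₂ := ae_abs_le_of_form_eq_zero hΩ hn h₂ hu₂ ht₂ hM hgae hform₂
  -- the lift of the boundary values of `kirchhoff a₁ (u₁) - kirchhoff a₂ (u₂)`
  have hg'c : Continuous g' := by
    rw [← funext fun s => (hgd s).deriv]
    exact hg.continuous_deriv (by simp)
  have hP := hvH.comp hopen hb (G := fun s => kirchhoff a₁ (g s) - kirchhoff a₂ (g s))
    (τ := fun s => (a₁ (g s) - a₂ (g s)) * g' s) (K := (K₁ + K₂) * K)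
    (fun s => by
      have := ((hasDerivAt_kirchhoff ha₁ (g s)).comp s (hgd s)).sub
        ((hasDerivAt_kirchhoff ha₂ (g s)).comp s (hgd s))
      rw [← sub_mul] at this
      exact this)
    (((ha₁.comp hg.continuous).sub (ha₂.comp hg.continuous)).mul hg'c)
    (fun s => by
      rw [abs_mul]
      refine mul_le_mul ((abs_sub _ _).trans (add_le_add (hK₁ _) (hK₂ _))) (hgK s) (abs_nonneg _)
        (add_nonneg ((abs_nonneg _).trans (hK₁ 0)) ((abs_nonneg _).trans (hK₂ 0))))
  have hPt : IsTrace Ω (fun x => kirchhoff a₁ (g (v x)) - kirchhoff a₂ (g (v x)))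
      fun x => kirchhoff a₁ (g (v x)) - kirchhoff a₂ (g (v x)) := by
    refine isTrace_of_continuous ?_
    have c₁ : Continuous (kirchhoff a₁) :=
      continuous_iff_continuousAt.2 fun s => (hasDerivAt_kirchhoff ha₁ s).continuousAt
    have c₂ : Continuous (kirchhoff a₂) :=
      continuous_iff_continuousAt.2 fun s => (hasDerivAt_kirchhoff ha₂ s).continuousAt
    exact (c₁.comp hG.continuous).sub (c₂.comp hG.continuous)
  have hZ := (hw₁.add (hw₂.smul (-1))).add (hP.smul (-1))
  have hZt : IsTrace Ω _ 0 := ((((ht₁.comp_lipschitz hu₁.memLp hL₁).add hw₁.memLp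
    (hw₂.smul (-1)).memLp ((ht₂.comp_lipschitz hu₂.memLp hL₂).smul (-1))).add
    (hw₁.add (hw₂.smul (-1))).memLp (hP.smul (-1)).memLp (hPt.smul (-1)))).congr
    (Eventually.of_forall fun x => by
      simp only [Pi.zero_apply, Pi.add_apply, Pi.smul_apply, smul_eq_mul]
      ring)
  have hzero := hharm _ _ (hZ.isH10 hΩ hn hZt)
  have hdn := (hψ v _ hvH γv htv).symm.trans (hψ₂ v _ hvH γv htv)
  have i₁ := integrable_inner_of_memLp hw₁.memLp_grad hvH.memLp_grad
  have i₂ := integrable_inner_of_memLp hw₂.memLp_grad hvH.memLp_grad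
  have i₃ := integrable_inner_of_memLp hP.memLp_grad hvH.memLp_grad
  have j₁ : IntegrableOn (fun x => c x * u₁ x * v x) Ω := (h₁.memLp hu₁).integrable_mul hvH.memLp
  have j₂ : IntegrableOn (fun x => c x * u₂ x * v x) Ω := (h₁.memLp hu₂).integrable_mul hvH.memLp
  simp only [inner_smul_left, RCLike.conj_to_real, real_inner_self_eq_norm_sq] at i₁ i₂ i₃
  rw [form, form, integral_add i₁ j₁, integral_add i₂ j₂] at hdn
  simp only [Pi.add_apply, Pi.smul_apply, inner_add_left, inner_smul_left, RCLike.conj_to_real,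
    real_inner_self_eq_norm_sq] at hzero
  have i₁₂ : IntegrableOn (fun x => a₁ (u₁ x) * inner ℝ (Du₁ x) (gradient v x) +
      -1 * (a₂ (u₂ x) * inner ℝ (Du₂ x) (gradient v x))) Ω := i₁.add (i₂.const_mul (-1))
  rw [integral_add i₁₂ (i₃.const_mul (-1)),
    integral_add i₁ (i₂.const_mul (-1)), integral_const_mul, integral_const_mul] at hzero
  refine ⟨fun x => u₁ x - u₂ x, ?_, ?_⟩
  · filter_upwards [hM₁, hM₂] with x hx₁ hx₂
    linarith [abs_sub (u₁ x) (u₂ x)]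
  · simp only [mul_sub, sub_mul (c _ * _)]
    rw [integral_sub j₁ j₂]
    linarith

/-! ### Harmonic exponentials -/

/-- `x ↦ e^{k xᵢ} cos (k xⱼ)`, which is harmonic for `i ≠ j`. -/
def expCos (k : ℝ) (i j : Fin n) (x : Rn n) : ℝ := Real.exp (k * x i) * Real.cos (k * x j)

/-- `x ↦ e^{k xᵢ} sin (k xⱼ)`. -/
def expSin (k : ℝ) (i j : Fin n) (x : Rn n) : ℝ := Real.exp (k * x i) * Real.sin (k * x j)

theorem contDiff_coord (i : Fin n) : ContDiff ℝ (⊤ : ℕ∞) fun x : Rn n => x i :=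
  (EuclideanSpace.proj i : Rn n →L[ℝ] ℝ).contDiff

theorem hasFDerivAt_coord (i : Fin n) (x : Rn n) :
    HasFDerivAt (fun x : Rn n => x i) (EuclideanSpace.proj i : Rn n →L[ℝ] ℝ) x :=
  (EuclideanSpace.proj i : Rn n →L[ℝ] ℝ).hasFDerivAt

theorem contDiff_expCos (k : ℝ) (i j : Fin n) : ContDiff ℝ (⊤ : ℕ∞) (expCos k i j) :=
  (contDiff_const.mul (contDiff_coord i)).exp.mul (contDiff_const.mul (contDiff_coord j)).cos

theorem contDiff_expSin (k : ℝ) (i j : Fin n) : ContDiff ℝ (⊤ : ℕ∞) (expSin k i j) :=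
  (contDiff_const.mul (contDiff_coord i)).exp.mul (contDiff_const.mul (contDiff_coord j)).sin

theorem fderiv_expCos (k : ℝ) (i j : Fin n) (x w : Rn n) :
    fderiv ℝ (expCos k i j) x w = k * (expCos k i j x * w i - expSin k i j x * w j) := by
  have h := (((hasFDerivAt_coord i x).const_mul k).exp).mul
    (((hasFDerivAt_coord j x).const_mul k).cos)
  have hproj : ∀ l, (EuclideanSpace.proj l : Rn n →L[ℝ] ℝ) w = w l := fun _ => rfl
  have h' := h.fderiv
  change fderiv ℝ (expCos k i j) x = _ at h'
  rw [h']
  simp only [_root_.add_apply, _root_.smul_apply, smul_eq_mul, hproj, expCos,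
    expSin]
  ring

theorem fderiv_expSin (k : ℝ) (i j : Fin n) (x w : Rn n) :
    fderiv ℝ (expSin k i j) x w = k * (expSin k i j x * w i + expCos k i j x * w j) := by
  have h := (((hasFDerivAt_coord i x).const_mul k).exp).mul
    (((hasFDerivAt_coord j x).const_mul k).sin)
  have hproj : ∀ l, (EuclideanSpace.proj l : Rn n →L[ℝ] ℝ) w = w l := fun _ => rfl
  have h' := h.fderiv
  change fderiv ℝ (expSin k i j) x = _ at h'
  rw [h']
  simp only [_root_.add_apply, _root_.smul_apply, smul_eq_mul, hproj, expCos,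
    expSin]
  ring

theorem expCos_sq_add_expSin_sq (k : ℝ) (i j : Fin n) (x : Rn n) :
    expCos k i j x ^ 2 + expSin k i j x ^ 2 = Real.exp (k * x i) ^ 2 := by
  rw [expCos, expSin, mul_pow, mul_pow, ← mul_add, Real.cos_sq_add_sin_sq, mul_one]

theorem abs_expCos_le (k : ℝ) (i j : Fin n) (x : Rn n) : |expCos k i j x| ≤ Real.exp (k * x i) := by
  rw [expCos, abs_mul, Real.abs_exp]
  exact mul_le_of_le_one_right (Real.exp_pos _).le (Real.abs_cos_le_one _)

theorem norm_gradient_expCos_sq (k : ℝ) {i j : Fin n} (hij : i ≠ j) (x : Rn n) :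
    ‖gradient (expCos k i j) x‖ ^ 2 = k ^ 2 * Real.exp (k * x i) ^ 2 := by
  have hc : ∀ l, gradient (expCos k i j) x l =
      fderiv ℝ (expCos k i j) x (EuclideanSpace.single l 1) := fun l => by
    rw [← inner_gradient, EuclideanSpace.inner_single_right]
    simp
  rw [← real_inner_self_eq_norm_sq, inner_gradient, fderiv_expCos, hc, hc, fderiv_expCos,
    fderiv_expCos]
  simp only [PiLp.single_apply, hij, hij.symm, if_true, if_false]
  rw [← expCos_sq_add_expSin_sq k i j x]
  ring

/-- `expCos k i j` is harmonic, in weak form up to the boundary. -/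
theorem integral_inner_gradient_expCos (hΩ : IsOpen Ω) (hb : Bornology.IsBounded Ω) (k : ℝ)
    {i j : Fin n} (hij : i ≠ j) {Z : Rn n → ℝ} {DZ : Rn n → Rn n} (hZ : IsH10 Ω Z DZ) :
    ∫ x in Ω, inner ℝ (DZ x) (gradient (expCos k i j) x) = 0 := by
  have h1 := hZ.integral_fderiv hΩ hb (contDiff_expCos k i j) (EuclideanSpace.single i 1)
  have h2 := hZ.integral_fderiv hΩ hb (contDiff_expSin k i j) (EuclideanSpace.single j 1)
  have hin : ∀ x l, (inner ℝ (DZ x) (EuclideanSpace.single l 1) : ℝ) = DZ x l := fun x l => by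
    rw [EuclideanSpace.inner_single_right]
    simp
  have e1 : ∀ x, fderiv ℝ (expCos k i j) x (EuclideanSpace.single i 1) =
      fderiv ℝ (expSin k i j) x (EuclideanSpace.single j 1) := fun x => by
    rw [fderiv_expCos, fderiv_expSin]
    simp [hij, hij.symm]
  have hint : ∀ (l : Fin n) {φ : Rn n → ℝ}, Continuous φ → IntegrableOn (fun x => DZ x l * φ x) Ω :=
    fun l φ hφ => by
      have h := hZ.isH1.memLp_grad.inner_const (EuclideanSpace.single l (1 : ℝ)) (𝕜 := ℝ)
      simp only [hin] at h
      exact h.integrable_mul (memLp_of_continuous hb hΩ hφ)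
  have e2 : ∀ x, (inner ℝ (DZ x) (gradient (expCos k i j) x) : ℝ) =
      k * (DZ x i * expCos k i j x - DZ x j * expSin k i j x) := fun x => by
    rw [real_inner_comm, inner_gradient, fderiv_expCos]
    ring
  simp only [hin, e1] at h1 h2
  simp only [e2]
  rw [integral_const_mul, integral_sub (hint i (contDiff_expCos k i j).continuous)
    (hint j (contDiff_expSin k i j).continuous)]
  rw [h2] at h1
  rw [neg_inj.1 h1, sub_self, mul_zero]

theorem arsinh_exp_le {y : ℝ} (hy : 0 ≤ y) : Real.arsinh (Real.exp y) ≤ y + 1 := by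
  rw [← Real.arsinh_sinh (y + 1), Real.arsinh_le_arsinh, Real.sinh_eq, Real.exp_add]
  have h1 : (2.7 : ℝ) ≤ Real.exp 1 := by linarith [Real.exp_one_gt_d9]
  have h2 : Real.exp (-(y + 1)) ≤ Real.exp (-1) := Real.exp_le_exp.2 (by linarith)
  have h3 : 1 ≤ Real.exp y := Real.one_le_exp hy
  have h4 := Real.exp_neg_one_lt_d9
  nlinarith

theorem abs_arsinh_le {s y : ℝ} (hy : 0 ≤ y) (hs : |s| ≤ Real.exp y) : |Real.arsinh s| ≤ y + 1 := by
  rw [abs_le] at hs ⊢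
  have h1 := Real.arsinh_le_arsinh.2 hs.1
  have h2 := Real.arsinh_le_arsinh.2 hs.2
  rw [Real.arsinh_neg] at h1
  have := arsinh_exp_le hy
  constructor <;> linarith

/-! ### Uniqueness of the coefficient -/

/-- The estimate behind the contradiction: if the two coefficients differ by at least `η` on
`[s₀ - δ, s₀ + δ]`, then `k η δ` is bounded independently of `k`. -/
theorem mul_le_of_dirichletToNeumann_eq (hΩ : IsPiecewiseC1Domain Ω) {i j : Fin n} (hij : i ≠ j)
    (hn : 2 ≤ n) {a₁ a₂ : ℝ → ℝ} {c : Rn n → ℝ} (h₁ : Admissible Ω a₁ c) (h₂ : Admissible Ω a₂ c)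
    (hΛ : dirichletToNeumann Ω a₁ c = dirichletToNeumann Ω a₂ c) {R : ℝ} (hR0 : 0 < R)
    (hR : Ω ⊆ Metric.ball 0 R) {C : ℝ} (hcC : ∀ᵐ x ∂(volume.restrict Ω), 0 ≤ c x ∧ c x ≤ C)
    {s₀ δ η : ℝ} (hδ : 0 < δ) (hη : 0 ≤ η) (hη' : ∀ s, |s - s₀| ≤ δ → η ≤ a₁ s - a₂ s)
    {k : ℝ} (hk : 1 ≤ k) :
    k * (η * δ) ≤ 4 * C * (|s₀| + δ) * (2 * R + 1) := by
  have hopen := hΩ.isOpen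
  have hb := hΩ.isBounded
  have hk0 : 0 < k := one_pos.trans_le hk
  set v := expCos k i j with hv
  set E : Rn n → ℝ := fun x => Real.exp (k * x i) with hE
  set ε : ℝ := Real.exp (-(k * R)) with hε
  set L : ℝ := 2 * (k * R) + 1 with hL
  have hε0 : 0 < ε := Real.exp_pos _
  have hL0 : 0 < L := by positivity
  have hcl : closure Ω ⊆ Metric.closedBall 0 R :=
    closure_minimal (hR.trans Metric.ball_subset_closedBall) Metric.isClosed_closedBall
  have hcoord : ∀ x ∈ closure Ω, |x i| ≤ R := fun x hx => by
    have h1 := hcl hx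
    rw [mem_closedBall_zero_iff] at h1
    exact (PiLp.norm_apply_le x i).trans h1
  have hεE : ∀ x ∈ closure Ω, ε ≤ E x := fun x hx => by
    refine Real.exp_le_exp.2 ?_
    have := mul_le_mul_of_nonneg_left (neg_le_of_abs_le (hcoord x hx)) hk0.le
    linarith
  have hvE : ∀ x, |v x| ≤ E x := abs_expCos_le k i j
  have hbound : ∀ x ∈ closure Ω, |Real.arsinh (v x / ε)| ≤ L := fun x hx => by
    refine abs_arsinh_le (by positivity) ?_
    rw [abs_div, abs_of_pos hε0, div_le_iff₀ hε0, hε, ← Real.exp_add]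
    refine (hvE x).trans (Real.exp_le_exp.2 ?_)
    have := mul_le_mul_of_nonneg_left (le_of_abs_le (hcoord x hx)) hk0.le
    linarith
  set g : ℝ → ℝ := fun s => s₀ + δ / L * Real.arsinh (s / ε) with hg
  set g' : ℝ → ℝ := fun s => δ / L * ((Real.sqrt (1 + (s / ε) ^ 2))⁻¹ * (1 / ε)) with hg'
  have hgC : ContDiff ℝ (⊤ : ℕ∞) g :=
    contDiff_const.add (contDiff_const.mul (contDiff_id.div_const ε).arsinh)
  have hgd : ∀ s, HasDerivAt g (g' s) s := fun s =>
    ((((hasDerivAt_id s).div_const ε).arsinh.const_mul (δ / L)).const_add s₀)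
  have hg'0 : ∀ s, 0 ≤ g' s := fun s => by positivity
  have hg'K : ∀ s, |g' s| ≤ δ / L * (1 / ε) := fun s => by
    rw [abs_of_nonneg (hg'0 s)]
    refine mul_le_mul_of_nonneg_left (mul_le_of_le_one_left (by positivity) ?_) (by positivity)
    refine inv_le_one_of_one_le₀ (Real.one_le_sqrt.2 ?_)
    linarith [sq_nonneg (s / ε)]
  have hgs : ∀ x ∈ closure Ω, |g (v x) - s₀| ≤ δ := fun x hx => by
    rw [hg, add_sub_cancel_left, abs_mul, abs_of_pos (by positivity : 0 < δ / L)]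
    calc δ / L * |Real.arsinh (v x / ε)| ≤ δ / L * L := by
          gcongr
          exact hbound x hx
      _ = δ := div_mul_cancel₀ _ hL0.ne'
  obtain ⟨U, hU, hid⟩ := exists_integral_identity hΩ hn h₁ h₂ hΛ (contDiff_expCos k i j)
    (fun Z DZ hZ => integral_inner_gradient_expCos hopen hb k hij hZ) hgC hgd hg'K
    (by positivity : 0 ≤ |s₀| + δ) (fun x hx => by
      have h1 := hgs x (frontier_subset_closure hx)
      have h2 := abs_sub_abs_le_abs_sub (g (v x)) s₀
      linarith)
  have hEc : Continuous E := ((contDiff_const.mul (contDiff_coord i)).exp).continuous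
  have hint : ∀ {F : Rn n → ℝ}, Continuous F → IntegrableOn F Ω := fun {F} hF => by
    have := isFiniteMeasure_restrict hb
    exact (memLp_of_continuous hb hopen hF).integrable (by norm_num)
  have hEpos : 0 < ∫ x in Ω, E x := by
    rw [setIntegral_pos_iff_support_of_nonneg_ae (Eventually.of_forall fun x => (Real.exp_pos _).le)
      (hint hEc), Function.support_eq_univ fun x => (Real.exp_pos _).ne', univ_inter]
    exact hopen.measure_pos volume hΩ.isConnected.nonempty
  have hlow : η * δ * k ^ 2 / (2 * L) * ∫ x in Ω, E x ≤
      ∫ x in Ω, (a₁ (g (v x)) - a₂ (g (v x))) * g' (v x) * ‖gradient v x‖ ^ 2 := by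
    rw [← integral_const_mul]
    have hg'c : Continuous g' := by
      rw [← funext fun s => (hgd s).deriv]
      exact hgC.continuous_deriv (by simp)
    have hvc : Continuous v := (contDiff_expCos k i j).continuous
    refine setIntegral_mono_on ((hint hEc).const_mul _) (hint ?_) hopen.measurableSet
      fun x hx => ?_
    · exact (((h₁.1.comp (hgC.continuous.comp hvc)).sub (h₂.1.comp (hgC.continuous.comp hvc))).mul
        (hg'c.comp hvc)).mul ((continuous_gradient (contDiff_expCos k i j)).norm.pow 2)
    · have hxc := subset_closure hx
      have hEx : 0 < E x := Real.exp_pos _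
      -- the slope of `arsinh (· / ε)` at `v x` is at least `1 / (2 * E x)`, since `ε, |v x| ≤ E x`
      have hsq : Real.sqrt (1 + (v x / ε) ^ 2) * ε ≤ 2 * E x := by
        have h1 : Real.sqrt (1 + (v x / ε) ^ 2) ≤ 1 + |v x / ε| := by
          refine Real.sqrt_le_iff.2 ⟨by positivity, ?_⟩
          rw [add_sq, sq_abs]
          linarith [abs_nonneg (v x / ε)]
        calc Real.sqrt (1 + (v x / ε) ^ 2) * ε ≤ (1 + |v x / ε|) * ε := by gcongr
          _ = ε + |v x| := by
            rw [abs_div, abs_of_pos hε0]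
            field_simp
          _ ≤ 2 * E x := by linarith [hεE x hxc, hvE x]
      have hg'l : δ / L * (1 / (2 * E x)) ≤ g' (v x) := by
        refine mul_le_mul_of_nonneg_left ?_ (by positivity)
        rw [← one_div, one_div_mul_one_div]
        exact one_div_le_one_div_of_le (by positivity) hsq
      rw [norm_gradient_expCos_sq k hij]
      calc η * δ * k ^ 2 / (2 * L) * E x
          = η * (δ / L * (1 / (2 * E x))) * (k ^ 2 * E x ^ 2) := by
            field_simp
        _ ≤ _ := by
            have h1 := hη' _ (hgs x hxc)
            have h2 := hη.trans h1
            gcongr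
  have hup : - ∫ x in Ω, c x * U x * v x ≤ C * (2 * (|s₀| + δ)) * ∫ x in Ω, E x := by
    rw [← integral_const_mul]
    refine (neg_le_abs _).trans ?_
    rw [← Real.norm_eq_abs]
    refine norm_integral_le_of_norm_le ((hint hEc).const_mul _) ?_
    filter_upwards [hU, hcC] with x hx hcx
    rw [norm_mul, norm_mul, Real.norm_of_nonneg hcx.1]
    have := hcx.1.trans hcx.2
    gcongr
    · exact hcx.2
    · exact hx
    · exact hvE x
  have hfin : η * δ * k ^ 2 / (2 * L) ≤ C * (2 * (|s₀| + δ)) := by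
    refine le_of_mul_le_mul_right (hlow.trans ?_) hEpos
    rw [hid]
    exact hup
  rw [div_le_iff₀ (by positivity)] at hfin
  have hLk : L ≤ k * (2 * R + 1) := by
    rw [hL]
    linarith
  have hC0 : 0 ≤ C * (2 * (|s₀| + δ)) := by
    have h0 : 0 ≤ η * δ * k ^ 2 / (2 * L) := by positivity
    exact h0.trans ((div_le_iff₀ (by positivity)).2 hfin)
  have hlast : k * (k * (η * δ)) ≤ k * (4 * C * (|s₀| + δ) * (2 * R + 1)) := by
    have := mul_le_mul_of_nonneg_left hLk hC0
    linarith
  exact le_of_mul_le_mul_left hlast hk0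

/-- Equality of the Dirichlet-to-Neumann maps gives one inequality between the coefficients;
the other one holds by symmetry. -/
theorem le_of_dirichletToNeumann_eq (hΩ : IsPiecewiseC1Domain Ω) (hn : 2 ≤ n) {a₁ a₂ : ℝ → ℝ}
    {c : Rn n → ℝ} (h₁ : Admissible Ω a₁ c) (h₂ : Admissible Ω a₂ c)
    (hΛ : dirichletToNeumann Ω a₁ c = dirichletToNeumann Ω a₂ c) (s₀ : ℝ) : a₁ s₀ ≤ a₂ s₀ := by
  by_contra! hlt
  set η : ℝ := (a₁ s₀ - a₂ s₀) / 2 with hη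
  have hη0 : 0 < η := by linarith
  obtain ⟨δ, hδ, hδη⟩ := Metric.continuous_iff.1 (h₁.1.sub h₂.1) s₀ η hη0
  obtain ⟨R, hR0, hR⟩ := hΩ.isBounded.subset_ball_lt 0 0
  obtain ⟨-, -, α, hα, -, hcα⟩ := id h₁
  have hij : (⟨0, by omega⟩ : Fin n) ≠ ⟨1, by omega⟩ := by simp
  set B : ℝ := 4 * (1 / α) * (|s₀| + δ / 2) * (2 * R + 1) with hB
  have key : ∀ k : ℝ, 1 ≤ k → k * (η * (δ / 2)) ≤ B := fun k hk =>
    mul_le_of_dirichletToNeumann_eq hΩ hij hn h₁ h₂ hΛ hR0 hR hcα (half_pos hδ) hη0.le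
      (fun s hs => by
        have h1 := hδη s (by rw [Real.dist_eq]; linarith)
        rw [Real.dist_eq] at h1
        have h2 := neg_lt_of_abs_lt h1
        simp only [Pi.sub_apply] at h2
        linarith) hk
  have hpos : 0 < η * (δ / 2) := by positivity
  have h1 := key (max 1 ((B + 1) / (η * (δ / 2)))) (le_max_left _ _)
  have h2 : (B + 1) / (η * (δ / 2)) * (η * (δ / 2)) ≤
      max 1 ((B + 1) / (η * (δ / 2))) * (η * (δ / 2)) := by
    gcongr
    exact le_max_right _ _
  rw [div_mul_cancel₀ _ hpos.ne'] at h2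
  linarith

end QuasilinearDtN

end

theorem theorem4 (n : ℕ) (hn : n = 2 ∨ n = 3)
    (Ω : Set (QuasilinearDtN.Rn n)) (hΩ : QuasilinearDtN.IsPiecewiseC1Domain Ω)
    (a₁ a₂ : ℝ → ℝ) (c : QuasilinearDtN.Rn n → ℝ)
    (h₁ : QuasilinearDtN.Admissible Ω a₁ c) (h₂ : QuasilinearDtN.Admissible Ω a₂ c)
    (hΛ : QuasilinearDtN.dirichletToNeumann Ω a₁ c = QuasilinearDtN.dirichletToNeumann Ω a₂ c) :
    ∀ u : ℝ, a₁ u = a₂ u := by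
  have hn2 : 2 ≤ n := by omega
  exact fun u => le_antisymm (QuasilinearDtN.le_of_dirichletToNeumann_eq hΩ hn2 h₁ h₂ hΛ u)
    (QuasilinearDtN.le_of_dirichletToNeumann_eq hΩ hn2 h₂ h₁ hΛ.symm u)
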